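/- **Setting.** Let $T\subset\mathbb R^3$ be the surface of the regular tetrahedron $\max\{-u-v-w,\,-u+v+w,\,u-v+w,\,u+v-w\}=2$, and let $\mu$ be the Lebesgue measure (surface area) on $T$, normalised to total mass $1$. Let $f(u,v)=v$ if $u\ge|v|$, $f=u$ if $v\ge|u|$, $f=-v$ if $-u\ge|v|$, $f=-u$ if $-v\ge|u|$. Consider on $\mathbb R^3$ the tropical Vieta involution $(u,v,w)\mapsto(u,v,-w+2f(u,v))$, the cyclic permutation $(u,v,w)\mapsto(v,w,u)$ and the transposition $(u,v,w)\mapsto(v,u,w)$. For a path $\gamma$ (a sequence of left and right turns) in the planar binary tree of the Farey fractions let $A_n(\gamma)=\begin{pmatrix}p&q\\r&s\end{pmatrix}\in SL_2(\mathbb Z)$ be the matrix attached to its $n$-th edge: $A_0$ is the identity, a left turn replaces $p/r$ and a right turn replaces $q/s$ by the mediant $(p+q)/(r+s)$. The path leads to $\xi\in[0,\infty]$ if $q/s\le\xi\le p/r$ along all its edges. Let $\gamma_\xi$ be the path that turns right exactly when the mediant is $\le\xi$; it leads to $\xi$, and it is the only path that does so unless $\xi$ is a positive rational number, which has two such paths.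 Along $\gamma_\xi$ let $c_n(\xi)$ be the $n$-th number on the Euclid tree (the sides of the root edge carry $1,1$, and the number ahead of an edge with $a,b$ on its sides is $c=a+b$) and $z_n(\xi)$ the $n$-th number on the Markov tree (the sides of the root edge carry $1,1$, the number ahead of it is $2$, and the numbers are continued by the Vieta involutions, such as $(x,y,z)\mapsto(x,z,3xz-y)$, of $x^2+y^2+z^2=3xyz$). Put $$\Lambda(\xi)=\limsup_{n\to\infty}\frac{\ln\ln z_n(\xi)}{n}=\limsup_{n\to\infty}\frac{\ln c_n(\xi)}{n}.$$ **Theorem 1.** There is a unique action of $GL_2(\mathbb Z)$ on $\mathbb R^3$ by bijections in which $\begin{pmatrix}1&0\\0&-1\end{pmatrix}$, $\begin{pmatrix}0&1\\-1&-1\end{pmatrix}$ and $\begin{pmatrix}0&1\\1&0\end{pmatrix}$ act as the tropical Vieta involution, the cyclic permutation and the transposition; $-1$ acts trivially. Its restriction to $SL_2(\mathbb Z)$, the *tropical Cayley–Markov action* (of $PSL_2(\mathbb Z)$), preserves $T$ and $\mu$. 1. Let $A\in SL_2(\mathbb Z)$ be hyperbolic, that is, $|\operatorname{tr}A|>2$.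 Then the action of $A$ on $T$ is ergodic for $\mu$. Its Lyapunov exponent, the limit of $\frac1n\ln\|D_xA^n\|$ for the derivative $D_xA^n$ along $T$ of the $n$-th iterate of the action of $A$, exists and equals $\ln\rho(A)$ for $\mu$-almost every $x\in T$, where $\rho(A)$ is the spectral radius of $A$. Its metric (Kolmogorov–Sinai) entropy for $\mu$ and its topological entropy both equal $\ln\rho(A)$ as well. 2. For every $\xi\in[0,\infty]$ the two expressions for $\Lambda(\xi)$ agree, and for every path $\gamma$ that leads to $\xi$ the actions on $T$ of all $A_n(\gamma)$ have Lyapunov exponents $\lambda_n$ (constant $\mu$-almost everywhere), metric entropies $h_n$ and topological entropies $h_n^{\mathrm{top}}$ with $$\limsup_{n\to\infty}\frac{\lambda_n}{n}=\limsup_{n\to\infty}\frac{h_n}{n}=\limsup_{n\to\infty}\frac{h^{\mathrm{top}}_n}{n}=\Lambda(\xi).$$ -/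

import Mathlib

open MeasureTheory Filter Topology
open scoped ENNReal MatrixGroups ProbabilityTheory

namespace CayleyMarkov

noncomputable section

/-! ### The tetrahedron and the tropical Cayley-Markov action -/

/-- Euclidean three-space, with coordinates `u = p 0`, `v = p 1`, `w = p 2`. -/
abbrev E3 : Type := EuclideanSpace ℝ (Fin 3)

/-- The surface of the regular tetrahedron with vertices `(2,2,2)`, `(2,-2,-2)`, `(-2,2,-2)`,
`(-2,-2,2)`, given by the tropical Cayley equation. -/
def tetra : Set E3 :=
  {p | max (max (-p 0 - p 1 - p 2) (-p 0 + p 1 + p 2))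
        (max (p 0 - p 1 + p 2) (p 0 + p 1 - p 2)) = 2}

/-- The piecewise linear function `f` of the tropical Vieta involution. -/
def tropF (u v : ℝ) : ℝ :=
  if |v| ≤ u then v else if |u| ≤ v then u else if |v| ≤ -u then -v else -u

/-- The tropical Vieta involution `(u, v, w) ↦ (u, v, -w + 2 f(u, v))`. -/
def vieta (p : E3) : E3 := !₂[p 0, p 1, -p 2 + 2 * tropF (p 0) (p 1)]

/-- The cyclic permutation `(u, v, w) ↦ (v, w, u)`. -/
def cyc (p : E3) : E3 := !₂[p 1, p 2, p 0]

/-- The transposition `(u, v, w) ↦ (v, u, w)`. -/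
def transp (p : E3) : E3 := !₂[p 1, p 0, p 2]

/-- The matrix of `(φ, ψ) ↦ (φ, -ψ)`; it takes `φ + ψ` to `φ - ψ`. -/
def matVieta : GL (Fin 2) ℤ := ⟨!![1, 0; 0, -1], !![1, 0; 0, -1], by decide, by decide⟩

/-- The matrix of `(φ, ψ) ↦ (ψ, -(φ + ψ))`; it permutes `±φ, ±ψ, ±(φ + ψ)` cyclically. -/
def matCyc : GL (Fin 2) ℤ := ⟨!![0, 1; -1, -1], !![-1, -1; 1, 0], by decide, by decide⟩

/-- The matrix of `(φ, ψ) ↦ (ψ, φ)`. -/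
def matTransp : GL (Fin 2) ℤ := ⟨!![0, 1; 1, 0], !![0, 1; 1, 0], by decide, by decide⟩

/-- `Φ` is the tropical Cayley-Markov action: the Vieta involution, the cyclic permutation and the
transposition are the actions of the three matrices through which they act on lax superbases
`{±φ, ±ψ, ±(φ + ψ)}`. -/
def IsTropicalAction (Φ : GL (Fin 2) ℤ →* Equiv.Perm E3) : Prop :=
  (∀ p, Φ matVieta p = vieta p) ∧ (∀ p, Φ matCyc p = cyc p) ∧ (∀ p, Φ matTransp p = transp p)

/-- The Lebesgue measure (surface area) on the tetrahedron, normalised to total mass one, seen as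
a measure on the ambient space. -/
def tetraMeasure : Measure E3 :=
  ProbabilityTheory.cond (Measure.euclideanHausdorffMeasure 2) tetra

/-! ### Dynamical invariants -/

/-- `l` is the Lyapunov exponent of `g` on the surface `S` at `x`: all iterates of `g` are
differentiable along `S` at `x`, and their derivatives, restricted to the tangent space of `S`
at `x`, have operator norms with exponential growth rate `l`. -/
def HasLyapunovExponentAt (g : E3 → E3) (S : Set E3) (x : E3) (l : ℝ) : Prop :=
  ∃ D : ℕ → E3 →L[ℝ] E3, (∀ n, HasFDerivWithinAt (g^[n]) (D n) S x) ∧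
    Tendsto (fun n : ℕ =>
      Real.log ‖(D n).comp (Submodule.span ℝ (tangentConeAt ℝ S x)).subtypeL‖ / n) atTop (𝓝 l)

/-- `l` is the Lyapunov exponent of `g` on the tetrahedron at almost every point. -/
def HasLyapunovExponent (g : E3 → E3) (l : ℝ) : Prop :=
  ∀ᵐ x ∂tetraMeasure, HasLyapunovExponentAt g tetra x l

/-- Shannon entropy of the finite partition into the level sets of `P`. -/
def partitionEntropy {X : Type*} [MeasurableSpace X] (μ : Measure X) {ι : Type*} [Fintype ι]
    (P : X → ι) : ℝ :=
  ∑ i, Real.negMulLog (μ.real (P ⁻¹' {i}))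

/-- The join of the preimages of the partition `P` under the first `n` iterates of `g`. -/
def joinPartition {X : Type*} (g : X → X) {k : ℕ} (P : X → Fin k) (n : ℕ) : X → (Fin n → Fin k) :=
  fun x i => P (g^[i] x)

/-- Measure-theoretic (Kolmogorov-Sinai) entropy of a map `g` preserving the probability
measure `μ`. -/
def metricEntropy {X : Type*} [MeasurableSpace X] (μ : Measure X) (g : X → X) : EReal :=
  ⨆ (k : ℕ) (P : X → Fin k) (_ : Measurable P),
    limsup (fun n : ℕ => ((partitionEntropy μ (joinPartition g P n) / n : ℝ) : EReal)) atTop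

/-- The logarithm of the spectral radius of an integer matrix, the maximum of the moduli of its
complex eigenvalues. -/
def logSpectralRadius (A : SL(2, ℤ)) : ℝ :=
  Real.log (spectralRadius ℂ ((A : Matrix (Fin 2) (Fin 2) ℤ).map (Int.cast : ℤ → ℂ))).toReal

/-! ### Paths on the Farey, Euclid and Markov trees

A path is a sequence of turns, `false` meaning towards smaller and `true` towards larger
fractions. An edge of the tree, with the fractions `p / r` and `q / s` on its two sides, is encoded
by the matrix with rows `(p, q)` and `(r, s)`, where `q / s < p / r`; the root is the edge between
`0 / 1` and `1 / 0`. -/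

/-- The matrix of the left turn, replacing `p / r` by the mediant. -/
def stepLeft : SL(2, ℤ) := ⟨!![1, 0; 1, 1], by decide⟩

/-- The matrix of the right turn, replacing `q / s` by the mediant. -/
def stepRight : SL(2, ℤ) := ⟨!![1, 1; 0, 1], by decide⟩

/-- The matrix attached to the `n`-th edge along the path. -/
def edgeMatrix (γ : ℕ → Bool) : ℕ → SL(2, ℤ)
  | 0 => 1
  | n + 1 => edgeMatrix γ n * (if γ n then stepRight else stepLeft)

/-- The smaller fraction `q / s` at an edge. -/
def lowerFraction (A : SL(2, ℤ)) : ℝ≥0∞ := ((A 0 1).toNat : ℝ≥0∞) / ((A 1 1).toNat : ℝ≥0∞)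

/-- The larger fraction `p / r` at an edge; it may be `1 / 0 = ∞`. -/
def upperFraction (A : SL(2, ℤ)) : ℝ≥0∞ := ((A 0 0).toNat : ℝ≥0∞) / ((A 1 0).toNat : ℝ≥0∞)

/-- The Farey mediant `(p + q) / (r + s)`. -/
def mediant (A : SL(2, ℤ)) : ℝ≥0∞ :=
  ((A 0 0 + A 0 1).toNat : ℝ≥0∞) / ((A 1 0 + A 1 1).toNat : ℝ≥0∞)

/-- The path `γ` leads to `ξ ∈ [0, ∞]`: all its Farey intervals contain `ξ`. An irrational number
has exactly one such path, a positive rational number has two. -/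
def LeadsTo (γ : ℕ → Bool) (ξ : ℝ≥0∞) : Prop :=
  ∀ n, lowerFraction (edgeMatrix γ n) ≤ ξ ∧ ξ ≤ upperFraction (edgeMatrix γ n)

open Classical in
/-- The edges met when one searches for `ξ` in the Farey tree. -/
def searchMatrix (ξ : ℝ≥0∞) : ℕ → SL(2, ℤ)
  | 0 => 1
  | n + 1 => searchMatrix ξ n * (if mediant (searchMatrix ξ n) ≤ ξ then stepRight else stepLeft)

open Classical in
/-- The path `γ_ξ` (turning right, and then always left, when `ξ` is met as a mediant). -/
def pathTo (ξ : ℝ≥0∞) (n : ℕ) : Bool := decide (mediant (searchMatrix ξ n) ≤ ξ)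

/-- The two numbers `(a, b)` on the sides of the `n`-th edge of the Euclid tree along a path (`a`
on the side of the larger fraction); the number ahead is `a + b`. -/
def euclidEdge (γ : ℕ → Bool) : ℕ → ℕ × ℕ
  | 0 => (1, 1)
  | n + 1 =>
    let e := euclidEdge γ n
    if γ n then (e.1, e.1 + e.2) else (e.1 + e.2, e.2)

/-- The number `c_n` on the Euclid tree along a path. -/
def euclidNumber (γ : ℕ → Bool) (n : ℕ) : ℕ := (euclidEdge γ n).1 + (euclidEdge γ n).2

/-- The Markov triple `(x, y, z)` met after the `n`-th edge along a path, `x` and `y` being on the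
sides of the edge (`x` on the side of the larger fraction) and `z` ahead. -/
def markovTriple (γ : ℕ → Bool) : ℕ → ℤ × ℤ × ℤ
  | 0 => (1, 1, 2)
  | n + 1 =>
    let t := markovTriple γ n
    if γ n then (t.1, t.2.2, 3 * t.1 * t.2.2 - t.2.1)
    else (t.2.2, t.2.1, 3 * t.2.2 * t.2.1 - t.1)

/-- The Markov number `z_n` along a path. -/
def markovNumber (γ : ℕ → Bool) (n : ℕ) : ℤ := (markovTriple γ n).2.2

/-- `Λ(ξ)` through the Markov numbers along `γ_ξ`. -/
def lyapunovMarkov (ξ : ℝ≥0∞) : EReal :=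
  limsup (fun n : ℕ =>
    ((Real.log (Real.log (markovNumber (pathTo ξ) n : ℝ)) / n : ℝ) : EReal)) atTop

/-- `Λ(ξ)` through the Euclid numbers along `γ_ξ`. -/
def lyapunovEuclid (ξ : ℝ≥0∞) : EReal :=
  limsup (fun n : ℕ =>
    ((Real.log (euclidNumber (pathTo ξ) n : ℝ) / n : ℝ) : EReal)) atTop

end

end CayleyMarkov

open MeasureTheory Filter Topology
open scoped ENNReal MatrixGroups ProbabilityTheory

namespace CayleyMarkov

noncomputable section


/-! ### The torus as a double cover of the tetrahedron -/

/-! The tetrahedron is the quotient of the torus by `t ↦ -t`. The map `tau`, built from distances to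
the nearest integer, has image `tetra` (`range_tau`) and fibres `{t, -t}` (`tau_eq_iff`), and it
turns the Vieta involution, the cyclic permutation and the transposition into the linear maps of
their matrices (`vieta_tau`, `cyc_tau`, `transp_tau`). All these maps are positively homogeneous and
the cone over the tetrahedron is the whole space, so the linear action on the torus descends to an
action on space; it is the only one because the three matrices generate `GL₂(ℤ)`.

On each face `tau` is affine, and translations of the torus by half-periods permute the faces
isometrically. Normalised surface area is therefore the image of Haar measure (`tetraMeasure_eq`),
and the action of `A` is a two-to-one factor of the toral automorphism of `A`.

Ergodicity descends from the torus, where it is the Fourier argument: Fourier coefficients of an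
invariant set are constant along the infinite orbits of nonzero characters, hence vanish
(`ergodic_tact`). Away from the edges the derivative of the `n`-th iterate is `A ^ n` in affine
coordinates of slope `±8`, so its growth is given by Gelfand's formula
(`tendsto_log_entryNorm_pow`).

The entropies are squeezed without the variational principle. From above, cells adapted to the two
eigenforms of `A` follow orbits up to time `n` with about `ρ ^ n` cells (`hasSmallCovers_tact`);
this bounds the topological entropy directly and the metric entropy through a coding inequality
(`metricEntropy_le`), and both bounds pass to the factor. From below, sets of points of the
tetrahedron with close orbits up to time `n` have measure about `ρ ^ (-n)`
(`IsTropicalAction.hasSmallBowenSets`). The unknown sign in the fibres of `tau` costs a factor two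
per observation, which is made harmless by observing only every `m`-th iterate.

Along a Farey path the matrices have nonnegative entries, their spectral radius is comparable with
the trace, and the trace with the Euclid number up to a factor linear in `n`
(`euclidNumber_le_trace`). Markov numbers lie between exponentials of Euclid numbers
(`markovTriple_bounds`). All logarithmic rates thus have the same upper limit. Two different paths
to one number are eventually constant, so both have rate zero (`LeadsTo.tendsto_sub`). -/

/-- The two-dimensional torus `(ℝ / ℤ)²`. -/
abbrev Torus : Type := UnitAddTorus (Fin 2)

/-- The action of integer matrices on the torus. -/
def tact (A : Matrix (Fin 2) (Fin 2) ℤ) (t : Torus) : Torus :=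
  fun i => A i 0 • t 0 + A i 1 • t 1

/-- The folding map of the torus onto the tetrahedron; its fibres are the pairs `±t`. -/
def tau (t : Torus) : E3 := !₂[2 - 8 * ‖t 0‖, 2 - 8 * ‖t 1‖, 2 - 8 * ‖t 0 + t 1‖]

/-- The covering map of the torus by the plane. -/
def proj (y : Fin 2 → ℝ) : Torus := fun i => (y i : UnitAddCircle)

@[simp] lemma tau_zero (t : Torus) : tau t 0 = 2 - 8 * ‖t 0‖ := rfl
@[simp] lemma tau_one (t : Torus) : tau t 1 = 2 - 8 * ‖t 1‖ := rfl
@[simp] lemma tau_two (t : Torus) : tau t 2 = 2 - 8 * ‖t 0 + t 1‖ := rfl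

lemma continuous_tau : Continuous tau := by
  unfold tau
  refine (PiLp.continuous_toLp 2 _).comp (continuous_pi fun i => ?_)
  fin_cases i <;> simp <;> fun_prop

lemma continuous_tact (A : Matrix (Fin 2) (Fin 2) ℤ) : Continuous (tact A) := by
  unfold tact; fun_prop

lemma tact_one (t : Torus) : tact 1 t = t := by
  ext i; fin_cases i <;> simp [tact, Matrix.one_apply]

lemma tact_mul (A B : Matrix (Fin 2) (Fin 2) ℤ) (t : Torus) :
    tact (A * B) t = tact A (tact B t) := by
  ext i
  simp only [tact, Matrix.mul_apply, Fin.sum_univ_two]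
  module

lemma tact_neg (A : Matrix (Fin 2) (Fin 2) ℤ) (t : Torus) : tact A (-t) = -tact A t := by
  ext i; simp [tact]; abel

lemma tact_add (A : Matrix (Fin 2) (Fin 2) ℤ) (s t : Torus) :
    tact A (s + t) = tact A s + tact A t := by
  ext i; simp [tact]; abel

lemma tact_sub (A : Matrix (Fin 2) (Fin 2) ℤ) (s t : Torus) :
    tact A (s - t) = tact A s - tact A t := by
  rw [sub_eq_add_neg, tact_add, tact_neg, sub_eq_add_neg]

lemma tact_iterate (A : Matrix (Fin 2) (Fin 2) ℤ) (n : ℕ) (t : Torus) :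
    (tact A)^[n] t = tact (A ^ n) t := by
  induction n generalizing t with
  | zero => simp [tact_one]
  | succ n ih => rw [Function.iterate_succ_apply, ih, ← tact_mul, pow_succ]

lemma tau_neg (t : Torus) : tau (-t) = tau t := by
  ext i
  fin_cases i
  · simp
  · simp
  · change 2 - 8 * ‖-t 0 + -t 1‖ = 2 - 8 * ‖t 0 + t 1‖
    rw [← neg_add, norm_neg]

lemma norm_circle_le (x : UnitAddCircle) : ‖x‖ ≤ 1 / 2 := by
  simpa using AddCircle.norm_le_half_period (1 : ℝ) (x := x) one_ne_zero

lemma norm_coe_circle {x : ℝ} (h : |x| ≤ 1 / 2) : ‖(x : UnitAddCircle)‖ = |x| :=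
  (AddCircle.norm_coe_eq_abs_iff (1 : ℝ) one_ne_zero).2 (by simpa using h)

lemma exists_coe_circle (x : UnitAddCircle) :
    ∃ y : ℝ, (y : UnitAddCircle) = x ∧ |y| = ‖x‖ := by
  obtain ⟨y, rfl⟩ := QuotientAddGroup.mk_surjective x
  refine ⟨y - round y, ?_, ?_⟩
  · have : ((round y : ℤ) : ℝ) = (round y : ℤ) • (1 : ℝ) := by simp
    rw [AddCircle.coe_sub, this, AddCircle.coe_zsmul, AddCircle.coe_period]
    simp
  · exact (UnitAddCircle.norm_eq (x := y)).symm

lemma circle_eq_or_neg {x y : UnitAddCircle} (h : ‖x‖ = ‖y‖) : x = y ∨ x = -y := by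
  obtain ⟨a, rfl, ha⟩ := exists_coe_circle x
  obtain ⟨b, rfl, hb⟩ := exists_coe_circle y
  rw [← ha, ← hb] at h
  rcases abs_eq_abs.1 h with h | h
  · left; rw [h]
  · right; rw [h, AddCircle.coe_neg]

lemma exists_proj (t : Torus) : ∃ y, proj y = t ∧ ∀ i, |y i| = ‖t i‖ := by
  choose y h1 h2 using fun i => exists_coe_circle (t i)
  exact ⟨y, funext h1, h2⟩

lemma proj_surjective : Function.Surjective proj := fun t =>
  let ⟨y, hy, _⟩ := exists_proj t
  ⟨y, hy⟩

lemma proj_add (x y : Fin 2 → ℝ) : proj (x + y) = proj x + proj y := rfl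

lemma proj_neg (x : Fin 2 → ℝ) : proj (-x) = -proj x := rfl

lemma proj_sub (x y : Fin 2 → ℝ) : proj (x - y) = proj x - proj y := rfl

/-- The first two coordinates fix `t 0` and `t 1` up to independent signs. The third coordinate ties
the signs together: when they are opposite, either sign of the sum allows one of them to be
corrected. -/
lemma tau_eq_iff {s t : Torus} : tau s = tau t ↔ s = t ∨ s = -t := by
  constructor
  · intro h
    have h0 : ‖s 0‖ = ‖t 0‖ := by have := congrArg (fun p : E3 => p 0) h; simpa using this
    have h1 : ‖s 1‖ = ‖t 1‖ := by have := congrArg (fun p : E3 => p 1) h; simpa using this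
    have h2 : ‖s 0 + s 1‖ = ‖t 0 + t 1‖ := by
      have := congrArg (fun p : E3 => p 2) h; simpa using this
    have key : ∀ {a b : UnitAddCircle}, s 0 = a → s 1 = b → s = ![a, b] := by
      rintro _ _ rfl rfl
      ext i; fin_cases i <;> rfl
    have ht : t = ![t 0, t 1] := by ext i; fin_cases i <;> rfl
    have ht' : -t = ![-t 0, -t 1] := by ext i; fin_cases i <;> rfl
    rw [ht', ht]
    simp only [Matrix.cons_val_zero, Matrix.cons_val_one]
    rcases circle_eq_or_neg h0 with h0 | h0 <;> rcases circle_eq_or_neg h1 with h1 | h1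
    · left; exact key h0 h1
    · rcases circle_eq_or_neg h2 with h2 | h2
      · left
        refine key h0 ?_
        rw [h0] at h2
        exact add_left_cancel h2
      · right
        refine key ?_ h1
        rw [h1, neg_add] at h2
        exact add_right_cancel h2
    · rcases circle_eq_or_neg h2 with h2 | h2
      · left
        refine key ?_ h1
        rw [h1] at h2
        exact add_right_cancel h2
      · right
        refine key h0 ?_
        rw [h0, neg_add] at h2
        exact add_left_cancel h2
    · right; exact key h0 h1
  · rintro (rfl | rfl)
    · rfl
    · exact tau_neg t

/-! ### The image of the folding map and the cone over it -/

/-- The gauge function of the tetrahedron. -/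
def gauge3 (p : E3) : ℝ :=
  max (max (-p 0 - p 1 - p 2) (-p 0 + p 1 + p 2)) (max (p 0 - p 1 + p 2) (p 0 + p 1 - p 2))

lemma mem_tetra {p : E3} : p ∈ tetra ↔ gauge3 p = 2 := Iff.rfl

lemma gauge3_smul {r : ℝ} (hr : 0 ≤ r) (p : E3) : gauge3 (r • p) = r * gauge3 p := by
  simp only [gauge3, PiLp.smul_apply, smul_eq_mul, mul_max_of_nonneg _ _ hr]
  ring_nf

/-- The preimage has first coordinate `(2 - p 0) / 8` and second coordinate `±(2 - p 1) / 8`. The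
face on which `p` lies decides the sign, and its equation says that the sum then folds to `(2 - p 2)
/ 8`; on the face `-p 0 - p 1 - p 2 = 2` this takes a shift by one. -/
lemma exists_tau_of_mem {p : E3} (hp : p ∈ tetra) : ∃ t, tau t = p := by
  have hg : max (max (-p 0 - p 1 - p 2) (-p 0 + p 1 + p 2))
      (max (p 0 - p 1 + p 2) (p 0 + p 1 - p 2)) = 2 := hp
  have h1 : -p 0 - p 1 - p 2 ≤ 2 := hg ▸ (le_max_left _ _).trans (le_max_left _ _)
  have h2 : -p 0 + p 1 + p 2 ≤ 2 := hg ▸ (le_max_right _ _).trans (le_max_left _ _)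
  have h3 : p 0 - p 1 + p 2 ≤ 2 := hg ▸ (le_max_left _ _).trans (le_max_right _ _)
  have h4 : p 0 + p 1 - p 2 ≤ 2 := hg ▸ (le_max_right _ _).trans (le_max_right _ _)
  have hc : (-p 0 - p 1 - p 2 = 2 ∨ -p 0 + p 1 + p 2 = 2) ∨
      (p 0 - p 1 + p 2 = 2 ∨ p 0 + p 1 - p 2 = 2) := by
    rcases max_choice (max (-p 0 - p 1 - p 2) (-p 0 + p 1 + p 2))
      (max (p 0 - p 1 + p 2) (p 0 + p 1 - p 2)) with h | h <;> rw [h] at hg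
    · left
      rcases max_choice (-p 0 - p 1 - p 2) (-p 0 + p 1 + p 2) with h | h <;> rw [h] at hg <;> simp [hg]
    · right
      rcases max_choice (p 0 - p 1 + p 2) (p 0 + p 1 - p 2) with h | h <;> rw [h] at hg <;> simp [hg]
  have key : ∀ y : ℝ, |y| = (2 - p 1) / 8 →
      ‖(((2 - p 0) / 8 + y : ℝ) : UnitAddCircle)‖ = (2 - p 2) / 8 →
      ∃ t, tau t = p := by
    intro y hy hz
    refine ⟨proj ![(2 - p 0) / 8, y], ?_⟩
    have e0 : ‖(((2 - p 0) / 8 : ℝ) : UnitAddCircle)‖ = (2 - p 0) / 8 := by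
      rw [norm_coe_circle] <;> rw [abs_of_nonneg] <;> linarith
    have e1 : ‖(y : UnitAddCircle)‖ = (2 - p 1) / 8 := by
      rw [norm_coe_circle] <;> rw [hy]; linarith
    ext i
    fin_cases i
    · change 2 - 8 * ‖(((2 - p 0) / 8 : ℝ) : UnitAddCircle)‖ = p 0
      rw [e0]; ring
    · change 2 - 8 * ‖(y : UnitAddCircle)‖ = p 1
      rw [e1]; ring
    · change 2 - 8 * ‖(((2 - p 0) / 8 : ℝ) : UnitAddCircle) + (y : UnitAddCircle)‖ = p 2
      rw [← AddCircle.coe_add, hz]; ring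
  rcases hc with (h | h) | (h | h)
  · apply key ((2 - p 1) / 8) (abs_of_nonneg (by linarith))
    rw [show (2 - p 0) / 8 + (2 - p 1) / 8 = -((2 - p 2) / 8) + 1 by linarith,
      AddCircle.coe_add, AddCircle.coe_period, add_zero, AddCircle.coe_neg, norm_neg,
      norm_coe_circle] <;> rw [abs_of_nonneg] <;> linarith
  · apply key (-((2 - p 1) / 8)) (by rw [abs_neg]; exact abs_of_nonneg (by linarith))
    rw [show (2 - p 0) / 8 + -((2 - p 1) / 8) = ((2 - p 2) / 8) by linarith,
      norm_coe_circle] <;> rw [abs_of_nonneg] <;> linarith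
  · apply key (-((2 - p 1) / 8)) (by rw [abs_neg]; exact abs_of_nonneg (by linarith))
    rw [show (2 - p 0) / 8 + -((2 - p 1) / 8) = -((2 - p 2) / 8) by linarith,
      AddCircle.coe_neg, norm_neg, norm_coe_circle] <;> rw [abs_of_nonneg] <;> linarith
  · apply key ((2 - p 1) / 8) (abs_of_nonneg (by linarith))
    rw [show (2 - p 0) / 8 + (2 - p 1) / 8 = ((2 - p 2) / 8) by linarith,
      norm_coe_circle] <;> rw [abs_of_nonneg] <;> linarith

lemma norm_add_coe {a b : ℝ} (ha : |a| ≤ 1 / 2) (hb : |b| ≤ 1 / 2) :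
    ‖(a : UnitAddCircle) + (b : UnitAddCircle)‖ =
      if |a + b| ≤ 1 / 2 then |a + b| else 1 - |a + b| := by
  rw [← AddCircle.coe_add]
  split_ifs with h
  · exact norm_coe_circle h
  · push Not at h
    rw [abs_le] at ha hb
    rcases le_total 0 (a + b) with h0 | h0
    · rw [abs_of_nonneg h0] at h ⊢
      rw [show a + b = -(1 - (a + b)) + 1 by ring, AddCircle.coe_add, AddCircle.coe_period,
        add_zero, AddCircle.coe_neg, norm_neg, norm_coe_circle] <;> rw [abs_of_nonneg] <;> linarith
    · rw [abs_of_nonpos h0] at h ⊢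
      rw [show a + b = (1 - -(a + b)) - 1 by ring, AddCircle.coe_sub, AddCircle.coe_period,
        sub_zero, norm_coe_circle] <;> rw [abs_of_nonneg] <;> linarith

lemma gauge3_tau (t : Torus) : gauge3 (tau t) = 2 := by
  obtain ⟨y, rfl, hy⟩ := exists_proj t
  have h0 : |y 0| ≤ 1 / 2 := (hy 0).trans_le (norm_circle_le _)
  have h1 : |y 1| ≤ 1 / 2 := (hy 1).trans_le (norm_circle_le _)
  have h2 : ‖proj y 0 + proj y 1‖ =
      if |y 0 + y 1| ≤ 1 / 2 then |y 0 + y 1| else 1 - |y 0 + y 1| := norm_add_coe h0 h1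
  simp only [gauge3, tau_zero, tau_one, tau_two, ← hy, h2]
  clear h2 hy
  split_ifs with h <;> rcases abs_cases (y 0) with ⟨e0, _⟩ | ⟨e0, _⟩ <;>
    rcases abs_cases (y 1) with ⟨e1, _⟩ | ⟨e1, _⟩ <;>
    rcases abs_cases (y 0 + y 1) with ⟨e2, _⟩ | ⟨e2, _⟩ <;>
    rw [e0] at h0 ⊢ <;> rw [e1] at h1 ⊢ <;> rw [e2] at h ⊢ <;>
    (apply le_antisymm
     · refine max_le (max_le ?_ ?_) (max_le ?_ ?_) <;> linarith
     · simp only [le_max_iff]; grind)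

lemma range_tau : Set.range tau = tetra :=
  Set.Subset.antisymm (Set.range_subset_iff.2 gauge3_tau) fun _ hp => exists_tau_of_mem hp

lemma tau_mem (t : Torus) : tau t ∈ tetra := gauge3_tau t

/-- The cone over the tetrahedron is the whole space. -/
lemma exists_smul_tau (p : E3) : ∃ r : ℝ, 0 ≤ r ∧ ∃ t, r • tau t = p := by
  have h1 : -p 0 - p 1 - p 2 ≤ gauge3 p := (le_max_left _ _).trans (le_max_left _ _)
  have h2 : -p 0 + p 1 + p 2 ≤ gauge3 p := (le_max_right _ _).trans (le_max_left _ _)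
  have h3 : p 0 - p 1 + p 2 ≤ gauge3 p := (le_max_left _ _).trans (le_max_right _ _)
  have h4 : p 0 + p 1 - p 2 ≤ gauge3 p := (le_max_right _ _).trans (le_max_right _ _)
  have hg : 0 ≤ gauge3 p := by linarith
  rcases hg.eq_or_lt with h | h
  · refine ⟨0, le_rfl, 0, ?_⟩
    ext i
    rw [zero_smul]
    fin_cases i <;> simp <;> linarith
  · obtain ⟨t, ht⟩ := exists_tau_of_mem (p := (2 / gauge3 p) • p) (by
      rw [mem_tetra, gauge3_smul (by positivity)]; field_simp)
    refine ⟨gauge3 p / 2, by positivity, t, ?_⟩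
    rw [ht, smul_smul]
    convert one_smul ℝ p using 2
    field_simp

/-- This makes `coneMap` independent of the chosen polar coordinates: the gauge recovers `r`, and
for `r ≠ 0` the torus point is known up to a sign, which commutes with `A` and is forgotten by
`tau`. -/
lemma smul_tau_congr {r r' : ℝ} (hr : 0 ≤ r) (hr' : 0 ≤ r') {t t' : Torus}
    (h : r • tau t = r' • tau t') (A : Matrix (Fin 2) (Fin 2) ℤ) :
    r • tau (tact A t) = r' • tau (tact A t') := by
  have hrr : r = r' := by
    have := congrArg gauge3 h
    rw [gauge3_smul hr, gauge3_smul hr', gauge3_tau, gauge3_tau] at this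
    linarith
  subst hrr
  rcases eq_or_ne r 0 with rfl | h0
  · simp
  · have h2 := smul_right_injective E3 h0 h
    rcases tau_eq_iff.1 h2 with rfl | rfl
    · rfl
    · rw [tact_neg, tau_neg]

/-- The action of an integer matrix on the cone over the tetrahedron. -/
def coneMap (A : Matrix (Fin 2) (Fin 2) ℤ) (p : E3) : E3 :=
  (exists_smul_tau p).choose • tau (tact A (exists_smul_tau p).choose_spec.2.choose)

lemma coneMap_smul_tau (A : Matrix (Fin 2) (Fin 2) ℤ) {r : ℝ} (hr : 0 ≤ r) (t : Torus) :
    coneMap A (r • tau t) = r • tau (tact A t) :=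
  smul_tau_congr (exists_smul_tau (r • tau t)).choose_spec.1 hr
    (exists_smul_tau (r • tau t)).choose_spec.2.choose_spec A

lemma coneMap_one (p : E3) : coneMap 1 p = p := by
  obtain ⟨r, hr, t, rfl⟩ := exists_smul_tau p
  rw [coneMap_smul_tau _ hr, tact_one]

lemma coneMap_mul (A B : Matrix (Fin 2) (Fin 2) ℤ) (p : E3) :
    coneMap (A * B) p = coneMap A (coneMap B p) := by
  obtain ⟨r, hr, t, rfl⟩ := exists_smul_tau p
  rw [coneMap_smul_tau _ hr, coneMap_smul_tau _ hr, coneMap_smul_tau _ hr, tact_mul]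

/-- The tropical Cayley-Markov action. -/
def coneAction : GL (Fin 2) ℤ →* Equiv.Perm E3 where
  toFun A :=
    { toFun := coneMap A.1
      invFun := coneMap A⁻¹.1
      left_inv := fun p => by rw [← coneMap_mul, Units.inv_mul, coneMap_one]
      right_inv := fun p => by rw [← coneMap_mul, Units.mul_inv, coneMap_one] }
  map_one' := by ext1 p; exact coneMap_one p
  map_mul' A B := by ext1 p; exact coneMap_mul A.1 B.1 p

/-! ### The three generators as linear maps of the torus -/

lemma tropF_smul {r : ℝ} (hr : 0 ≤ r) (u v : ℝ) : tropF (r * u) (r * v) = r * tropF u v := by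
  rcases hr.eq_or_lt with rfl | h
  · simp [tropF]
  · have e : ∀ a b : ℝ, |r * a| ≤ r * b ↔ |a| ≤ b := fun a b => by
      rw [abs_mul, abs_of_pos h, mul_le_mul_iff_right₀ h]
    have e' : ∀ a b : ℝ, |r * a| ≤ -(r * b) ↔ |a| ≤ -b := fun a b => by
      rw [← mul_neg, e]
    simp only [tropF, e, e']
    split_ifs <;> ring

lemma vieta_smul {r : ℝ} (hr : 0 ≤ r) (p : E3) : vieta (r • p) = r • vieta p := by
  ext i
  fin_cases i
  · rfl
  · rfl
  · change -(r * p 2) + 2 * tropF (r * p 0) (r * p 1) = r * (-p 2 + 2 * tropF (p 0) (p 1))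
    rw [tropF_smul hr]; ring

/-- In the coordinates `2 - 8‖·‖` this is the tropical Vieta relation `w + w' = 2 f(u, v)` between
the third coordinates belonging to the sum and to the difference. -/
lemma fold_add_fold {a b : ℝ} (ha : 0 ≤ a) (ha' : a ≤ 1 / 2) (hb : 0 ≤ b) (hb' : b ≤ 1 / 2) :
    (if |a + b| ≤ 1 / 2 then |a + b| else 1 - |a + b|) +
      (if |a - b| ≤ 1 / 2 then |a - b| else 1 - |a - b|) =
      (2 - tropF (2 - 8 * a) (2 - 8 * b)) / 4 := by
  have h : |a - b| ≤ 1 / 2 := abs_le.2 ⟨by linarith, by linarith⟩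
  rw [if_pos h, abs_of_nonneg (by linarith : 0 ≤ a + b)]
  unfold tropF
  rcases le_total a b with h1 | h1
  · rw [abs_of_nonpos (by linarith : a - b ≤ 0)]
    simp only [abs_le]
    grind
  · rw [abs_of_nonneg (by linarith : 0 ≤ a - b)]
    simp only [abs_le]
    grind

lemma vieta_tau (t : Torus) : vieta (tau t) = tau (tact matVieta.1 t) := by
  have e0 : tact matVieta.1 t 0 = t 0 := by simp [tact, matVieta]
  have e1 : tact matVieta.1 t 1 = -t 1 := by simp [tact, matVieta]
  ext i
  fin_cases i
  · change 2 - 8 * ‖t 0‖ = 2 - 8 * ‖tact matVieta.1 t 0‖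
    rw [e0]
  · change 2 - 8 * ‖t 1‖ = 2 - 8 * ‖tact matVieta.1 t 1‖
    rw [e1, norm_neg]
  · change -(2 - 8 * ‖t 0 + t 1‖) + 2 * tropF (2 - 8 * ‖t 0‖) (2 - 8 * ‖t 1‖) =
      2 - 8 * ‖tact matVieta.1 t 0 + tact matVieta.1 t 1‖
    rw [e0, e1]
    obtain ⟨y, rfl, hy⟩ := exists_proj t
    have h0 : |y 0| ≤ 1 / 2 := (hy 0).trans_le (norm_circle_le _)
    have h1 : |y 1| ≤ 1 / 2 := (hy 1).trans_le (norm_circle_le _)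
    have h2 : ‖proj y 0 + proj y 1‖ =
        if |y 0 + y 1| ≤ 1 / 2 then |y 0 + y 1| else 1 - |y 0 + y 1| := norm_add_coe h0 h1
    have h3 : ‖proj y 0 + -proj y 1‖ =
        if |y 0 + -y 1| ≤ 1 / 2 then |y 0 + -y 1| else 1 - |y 0 + -y 1| :=
      norm_add_coe h0 (by rwa [abs_neg])
    rw [← hy, ← hy, h2, h3]
    -- The fold is even, so both representatives may be taken nonnegative; changing the sign of one
    -- of them only exchanges the sum and the difference.
    rcases abs_cases (y 0) with ⟨e0, _⟩ | ⟨e0, _⟩ <;>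
      rcases abs_cases (y 1) with ⟨e1, _⟩ | ⟨e1, _⟩ <;>
      rw [e0] at h0 ⊢ <;> rw [e1] at h1 ⊢
    · have := fold_add_fold (a := y 0) (b := y 1) (by linarith) h0 (by linarith) h1
      rw [sub_eq_add_neg (y 0)] at this; linarith
    · have := fold_add_fold (a := y 0) (b := -y 1) (by linarith) h0 (by linarith) h1
      rw [sub_neg_eq_add] at this; linarith
    · have := fold_add_fold (a := -y 0) (b := y 1) (by linarith) h0 (by linarith) h1
      rw [show -y 0 + y 1 = -(y 0 + -y 1) by ring, show -y 0 - y 1 = -(y 0 + y 1) by ring,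
        abs_neg, abs_neg] at this
      linarith
    · have := fold_add_fold (a := -y 0) (b := -y 1) (by linarith) h0 (by linarith) h1
      rw [show -y 0 + -y 1 = -(y 0 + y 1) by ring, show -y 0 - -y 1 = -(y 0 + -y 1) by ring,
        abs_neg, abs_neg] at this
      linarith

lemma cyc_tau (t : Torus) : cyc (tau t) = tau (tact matCyc.1 t) := by
  have e0 : tact matCyc.1 t 0 = t 1 := by simp [tact, matCyc]
  have e1 : tact matCyc.1 t 1 = -t 0 + -t 1 := by simp [tact, matCyc]
  ext i
  fin_cases i
  · change 2 - 8 * ‖t 1‖ = 2 - 8 * ‖tact matCyc.1 t 0‖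
    rw [e0]
  · change 2 - 8 * ‖t 0 + t 1‖ = 2 - 8 * ‖tact matCyc.1 t 1‖
    rw [e1, ← neg_add, norm_neg]
  · change 2 - 8 * ‖t 0‖ = 2 - 8 * ‖tact matCyc.1 t 0 + tact matCyc.1 t 1‖
    rw [e0, e1, add_comm, neg_add_cancel_right, norm_neg]

lemma transp_tau (t : Torus) : transp (tau t) = tau (tact matTransp.1 t) := by
  have e0 : tact matTransp.1 t 0 = t 1 := by simp [tact, matTransp]
  have e1 : tact matTransp.1 t 1 = t 0 := by simp [tact, matTransp]
  ext i
  fin_cases i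
  · change 2 - 8 * ‖t 1‖ = 2 - 8 * ‖tact matTransp.1 t 0‖
    rw [e0]
  · change 2 - 8 * ‖t 0‖ = 2 - 8 * ‖tact matTransp.1 t 1‖
    rw [e1]
  · change 2 - 8 * ‖t 0 + t 1‖ = 2 - 8 * ‖tact matTransp.1 t 0 + tact matTransp.1 t 1‖
    rw [e0, e1, add_comm]

lemma cyc_smul (r : ℝ) (p : E3) : cyc (r • p) = r • cyc p := by
  ext i; fin_cases i <;> rfl

lemma transp_smul (r : ℝ) (p : E3) : transp (r • p) = r • transp p := by
  ext i; fin_cases i <;> rfl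

lemma isTropicalAction_coneAction : IsTropicalAction coneAction := by
  refine ⟨fun p => ?_, fun p => ?_, fun p => ?_⟩ <;>
    obtain ⟨r, hr, t, rfl⟩ := exists_smul_tau p
  · rw [vieta_smul hr, vieta_tau]; exact coneMap_smul_tau _ hr t
  · rw [cyc_smul, cyc_tau]; exact coneMap_smul_tau _ hr t
  · rw [transp_smul, transp_tau]; exact coneMap_smul_tau _ hr t

/-- The standard generators `S` and `T` of `SL₂(ℤ)` are words in the three matrices. Multiplication
by `matVieta` brings determinant `-1` back to determinant `1`. -/
lemma closure_generators :
    Subgroup.closure ({matVieta, matCyc, matTransp} : Set (GL (Fin 2) ℤ)) = ⊤ := by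
  set H := Subgroup.closure ({matVieta, matCyc, matTransp} : Set (GL (Fin 2) ℤ))
  have hV : matVieta ∈ H := Subgroup.subset_closure (by simp)
  have hC : matCyc ∈ H := Subgroup.subset_closure (by simp)
  have hX : matTransp ∈ H := Subgroup.subset_closure (by simp)
  have hSL : ∀ A : SL(2, ℤ), (A : GL (Fin 2) ℤ) ∈ H := by
    have : (⊤ : Subgroup SL(2, ℤ)) ≤ H.comap Matrix.SpecialLinearGroup.toGL := by
      rw [← SpecialLinearGroup.SL2Z_generators, Subgroup.closure_le]
      rintro A (rfl | rfl)
      · have : (ModularGroup.S : GL (Fin 2) ℤ) = matTransp * matVieta := by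
          ext i j
          fin_cases i <;> fin_cases j <;> rfl
        change (ModularGroup.S : GL (Fin 2) ℤ) ∈ H
        rw [this]; exact H.mul_mem hX hV
      · have : (ModularGroup.T : GL (Fin 2) ℤ) = matTransp * (matVieta * matCyc) := by
          ext i j
          fin_cases i <;> fin_cases j <;> rfl
        change (ModularGroup.T : GL (Fin 2) ℤ) ∈ H
        rw [this]; exact H.mul_mem hX (H.mul_mem hV hC)
    exact fun A => this (Subgroup.mem_top A)
  have hdetSL : ∀ G : GL (Fin 2) ℤ, G.1.det = 1 → G ∈ H := by
    intro G hG
    have : Matrix.SpecialLinearGroup.toGL (⟨G.1, hG⟩ : SL(2, ℤ)) = G := by ext i j; rfl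
    rw [← this]; exact hSL _
  refine (Subgroup.eq_top_iff' H).2 fun G => ?_
  have hu : IsUnit G.1.det := (Matrix.isUnit_iff_isUnit_det _).1 G.isUnit
  rcases Int.isUnit_iff.1 hu with h | h
  · exact hdetSL G h
  · have h2 : G * matVieta ∈ H := by
      apply hdetSL
      rw [Units.val_mul, Matrix.det_mul, h]
      simp [matVieta, Matrix.det_fin_two]
    exact (H.mul_mem_cancel_right hV).1 h2

/-- Both sides are compatible with products and inverses, so the generators suffice. Since every
point has the form `r • tau t`, this formula determines the action. -/
lemma IsTropicalAction.apply_smul_tau {Φ : GL (Fin 2) ℤ →* Equiv.Perm E3}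
    (hΦ : IsTropicalAction Φ) (A : GL (Fin 2) ℤ) {r : ℝ} (hr : 0 ≤ r) (t : Torus) :
    Φ A (r • tau t) = r • tau (tact A.1 t) := by
  have hA : A ∈ Subgroup.closure ({matVieta, matCyc, matTransp} : Set (GL (Fin 2) ℤ)) := by
    rw [closure_generators]; trivial
  induction hA using Subgroup.closure_induction generalizing t with
  | mem A hA =>
    rcases hA with rfl | rfl | rfl
    · rw [hΦ.1, vieta_smul hr, vieta_tau]
    · rw [hΦ.2.1, cyc_smul, cyc_tau]
    · rw [hΦ.2.2, transp_smul, transp_tau]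
  | one => rw [map_one, Units.val_one, tact_one]; rfl
  | mul A B _ _ hA hB => rw [map_mul, Equiv.Perm.mul_apply, hB, hA, Units.val_mul, tact_mul]
  | inv A _ hA =>
    rw [map_inv, Equiv.Perm.inv_eq_iff_eq, hA, ← tact_mul, Units.mul_inv, tact_one]

lemma IsTropicalAction.apply_tau {Φ : GL (Fin 2) ℤ →* Equiv.Perm E3}
    (hΦ : IsTropicalAction Φ) (A : GL (Fin 2) ℤ) (t : Torus) :
    Φ A (tau t) = tau (tact A.1 t) := by
  have := hΦ.apply_smul_tau A zero_le_one t
  rwa [one_smul, one_smul] at this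

theorem existsUnique_tropicalAction :
    ∃! Φ : GL (Fin 2) ℤ →* Equiv.Perm E3, IsTropicalAction Φ := by
  refine ⟨coneAction, isTropicalAction_coneAction, fun Φ hΦ => ?_⟩
  ext1 A
  ext1 p
  obtain ⟨r, hr, t, rfl⟩ := exists_smul_tau p
  rw [hΦ.apply_smul_tau A hr, isTropicalAction_coneAction.apply_smul_tau A hr]

lemma IsTropicalAction.map_neg_one {Φ : GL (Fin 2) ℤ →* Equiv.Perm E3}
    (hΦ : IsTropicalAction Φ) : Φ (-1) = 1 := by
  ext1 p
  obtain ⟨r, hr, t, rfl⟩ := exists_smul_tau p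
  rw [hΦ.apply_smul_tau _ hr]
  have : tact (-1 : GL (Fin 2) ℤ).1 t = -t := by
    ext i; fin_cases i <;> simp [tact]
  rw [this, tau_neg]; rfl

lemma IsTropicalAction.image_tetra {Φ : GL (Fin 2) ℤ →* Equiv.Perm E3}
    (hΦ : IsTropicalAction Φ) (A : GL (Fin 2) ℤ) : Φ A '' tetra = tetra := by
  apply Set.Subset.antisymm
  · rintro _ ⟨p, hp, rfl⟩
    obtain ⟨t, rfl⟩ := exists_tau_of_mem hp
    rw [hΦ.apply_tau]; exact tau_mem _
  · intro p hp
    obtain ⟨t, rfl⟩ := exists_tau_of_mem hp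
    refine ⟨tau (tact A⁻¹.1 t), tau_mem _, ?_⟩
    rw [hΦ.apply_tau, ← tact_mul, Units.mul_inv, tact_one]

/-! ### Measurability of the action -/

lemma measurable_vieta : Measurable vieta := by
  have h : ∀ i : Fin 3, Measurable fun p : E3 => p i := fun i => by fun_prop
  have hf : Measurable fun p : E3 => tropF (p 0) (p 1) := by
    unfold tropF
    refine Measurable.ite (measurableSet_le (by fun_prop) (by fun_prop)) (by fun_prop) ?_
    refine Measurable.ite (measurableSet_le (by fun_prop) (by fun_prop)) (by fun_prop) ?_
    exact Measurable.ite (measurableSet_le (by fun_prop) (by fun_prop)) (by fun_prop) (by fun_prop)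
  refine (PiLp.continuous_toLp 2 _).measurable.comp (measurable_pi_lambda _ fun i => ?_)
  fin_cases i
  · exact h 0
  · exact h 1
  · exact (h 2).neg.add (hf.const_mul 2)

lemma measurable_cyc : Measurable cyc := by
  refine (PiLp.continuous_toLp 2 _).measurable.comp (measurable_pi_lambda _ fun i => ?_)
  fin_cases i <;> simp <;> fun_prop

lemma measurable_transp : Measurable transp := by
  refine (PiLp.continuous_toLp 2 _).measurable.comp (measurable_pi_lambda _ fun i => ?_)
  fin_cases i <;> simp <;> fun_prop

lemma IsTropicalAction.measurable {Φ : GL (Fin 2) ℤ →* Equiv.Perm E3}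
    (hΦ : IsTropicalAction Φ) (A : GL (Fin 2) ℤ) : Measurable (Φ A) := by
  have hV : Measurable (Φ matVieta) := by
    rw [show (Φ matVieta : E3 → E3) = vieta from funext hΦ.1]; exact measurable_vieta
  have hC : Measurable (Φ matCyc) := by
    rw [show (Φ matCyc : E3 → E3) = cyc from funext hΦ.2.1]; exact measurable_cyc
  have hX : Measurable (Φ matTransp) := by
    rw [show (Φ matTransp : E3 → E3) = transp from funext hΦ.2.2]; exact measurable_transp
  have hmul : ∀ A B, Measurable (Φ A) → Measurable (Φ B) → Measurable (Φ (A * B)) := by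
    intro A B hA hB
    rw [map_mul]; exact hA.comp hB
  have hA : A ∈ Subgroup.closure ({matVieta, matCyc, matTransp} : Set (GL (Fin 2) ℤ)) := by
    rw [closure_generators]; trivial
  induction hA using Subgroup.closure_induction_left with
  | one => rw [map_one]; exact measurable_id
  | mul_left A hA B _ hB =>
    rcases hA with rfl | rfl | rfl
    · exact hmul _ _ hV hB
    · exact hmul _ _ hC hB
    · exact hmul _ _ hX hB
  | inv_mul_cancel A hA B _ hB =>
    rcases hA with rfl | rfl | rfl
    · have : matVieta⁻¹ = matVieta := by ext i j; fin_cases i <;> fin_cases j <;> rfl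
      rw [this]; exact hmul _ _ hV hB
    · have : matCyc⁻¹ = matCyc * matCyc := by
        ext i j; fin_cases i <;> fin_cases j <;> rfl
      rw [this]; exact hmul _ _ (hmul _ _ hC hC) hB
    · have : matTransp⁻¹ = matTransp := by ext i j; fin_cases i <;> fin_cases j <;> rfl
      rw [this]; exact hmul _ _ hX hB


/-! ### Surface area on the tetrahedron -/

/-- The normalised Haar measure on the torus. -/
def haarT : Measure Torus := Measure.pi fun _ => AddCircle.haarAddCircle

instance : haarT.IsAddHaarMeasure :=
  inferInstanceAs (Measure.IsAddHaarMeasure (Measure.pi fun _ => AddCircle.haarAddCircle))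

instance : IsProbabilityMeasure haarT :=
  inferInstanceAs (IsProbabilityMeasure (Measure.pi fun _ => AddCircle.haarAddCircle))

/-- The action of an integer matrix as a homomorphism. -/
def tactHom (A : Matrix (Fin 2) (Fin 2) ℤ) : Torus →+ Torus :=
  AddMonoidHom.mk' (tact A) (tact_add A)

lemma measurePreserving_tact (A : GL (Fin 2) ℤ) : MeasurePreserving (tact A.1) haarT haarT :=
  AddMonoidHom.measurePreserving (f := tactHom A.1) (continuous_tact A.1)
    (fun t => ⟨tact A⁻¹.1 t, by
      change tact A.1 (tact A⁻¹.1 t) = t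
      rw [← tact_mul, Units.mul_inv, tact_one]⟩) rfl

/-- The fundamental square of the torus. -/
def box : Set (Fin 2 → ℝ) := Set.univ.pi fun _ => Set.Ioc (-(1 / 2)) (1 / 2)

lemma continuous_proj : Continuous proj :=
  continuous_pi fun i => (AddCircle.continuous_mk' (1 : ℝ)).comp (continuous_apply i)

lemma measurePreserving_proj : MeasurePreserving proj (volume.restrict box) haarT := by
  have h : MeasurePreserving ((↑) : ℝ → UnitAddCircle)
      (volume.restrict (Set.Ioc (-(1 / 2)) (1 / 2))) AddCircle.haarAddCircle := by
    have h1 := UnitAddCircle.measurePreserving_mk (-(1 / 2))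
    have h2 : (volume : Measure UnitAddCircle) = AddCircle.haarAddCircle := by
      rw [AddCircle.volume_eq_smul_haarAddCircle]; simp
    rw [h2] at h1
    convert h1 using 3
    norm_num
  have h3 := measurePreserving_pi (fun _ : Fin 2 => volume.restrict (Set.Ioc (-(1 / 2) : ℝ) (1 / 2)))
    (fun _ : Fin 2 => (AddCircle.haarAddCircle : Measure UnitAddCircle)) (fun _ => h)
  rw [← Measure.restrict_pi_pi] at h3
  exact h3

lemma haarT_apply {S : Set Torus} (hS : MeasurableSet S) :
    haarT S = volume (proj ⁻¹' S ∩ box) := by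
  rw [← measurePreserving_proj.measure_preimage hS.nullMeasurableSet,
    Measure.restrict_apply (continuous_proj.measurable hS)]

lemma volume_preimage_mulVec {M : Matrix (Fin 2) (Fin 2) ℝ} (hM : M.det ≠ 0)
    (s : Set (Fin 2 → ℝ)) :
    volume ((fun y => M.mulVec y) ⁻¹' s) = ENNReal.ofReal |M.det⁻¹| * volume s := by
  have h : LinearMap.det (Matrix.toLin' M) ≠ 0 := by rwa [LinearMap.det_toLin']
  have := Measure.addHaar_preimage_linearMap (volume : Measure (Fin 2 → ℝ)) h s
  rwa [LinearMap.det_toLin'] at this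

/-- The lines in the plane over the edges of the tetrahedron. -/
def edgeLines : Set (Fin 2 → ℝ) :=
  ⋃ k : ℤ, ({y | y 0 = k / 2} ∪ {y | y 1 = k / 2}) ∪ {y | y 0 + y 1 = k / 2}

lemma volume_edgeLines : volume edgeLines = 0 := by
  refine measure_iUnion_null fun k => measure_union_null (measure_union_null ?_ ?_) ?_
  · exact Measure.pi_hyperplane _ _ _
  · exact Measure.pi_hyperplane _ _ _
  -- A shear takes the slanted lines to lines on which the first coordinate is constant.
  · have h := volume_preimage_mulVec (M := !![1, 1; 0, 1]) (by simp [Matrix.det_fin_two])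
      {y | y 0 = (k : ℝ) / 2}
    have h0 : volume {y : Fin 2 → ℝ | y 0 = (k : ℝ) / 2} = 0 := Measure.pi_hyperplane _ _ _
    rw [h0, mul_zero] at h
    convert h using 2
    ext y
    simp [dotProduct, Fin.sum_univ_two]

lemma exists_half_int {x : ℝ} (h : ‖(x : UnitAddCircle)‖ = 0 ∨ ‖(x : UnitAddCircle)‖ = 1 / 2) :
    ∃ k : ℤ, x = k / 2 := by
  rw [UnitAddCircle.norm_eq] at h
  rcases h with h | h
  · rw [abs_eq_zero] at h
    exact ⟨2 * round x, by push_cast; linarith⟩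
  · rcases abs_cases (x - round x) with ⟨e, _⟩ | ⟨e, _⟩ <;> rw [e] at h
    · exact ⟨2 * round x + 1, by push_cast; linarith⟩
    · exact ⟨2 * round x - 1, by push_cast; linarith⟩

lemma norm_ne_of_notMem_edgeLines {y : Fin 2 → ℝ} (hy : y ∉ edgeLines) (x : ℝ)
    (hx : x = y 0 ∨ x = y 1 ∨ x = y 0 + y 1) :
    0 < ‖(x : UnitAddCircle)‖ ∧ ‖(x : UnitAddCircle)‖ < 1 / 2 := by
  by_contra hc
  have : ‖(x : UnitAddCircle)‖ = 0 ∨ ‖(x : UnitAddCircle)‖ = 1 / 2 := by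
    have h1 := norm_nonneg (x : UnitAddCircle)
    have h2 := norm_circle_le (x : UnitAddCircle)
    rcases h1.eq_or_lt with h1 | h1
    · exact Or.inl h1.symm
    · rcases h2.eq_or_lt with h2 | h2
      · exact Or.inr h2
      · exact absurd ⟨h1, h2⟩ hc
  obtain ⟨k, hk⟩ := exists_half_int this
  refine hy (Set.mem_iUnion.2 ⟨k, ?_⟩)
  rcases hx with rfl | rfl | rfl
  · exact Or.inl (Or.inl hk)
  · exact Or.inl (Or.inr hk)
  · exact Or.inr hk

lemma abs_tau_proj_lt {y : Fin 2 → ℝ} (hy : y ∉ edgeLines) (i : Fin 3) :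
    |tau (proj y) i| < 2 := by
  have h := norm_ne_of_notMem_edgeLines hy
  rw [abs_lt]
  fin_cases i
  · have := h _ (Or.inl rfl)
    change -2 < 2 - 8 * ‖(y 0 : UnitAddCircle)‖ ∧ 2 - 8 * ‖(y 0 : UnitAddCircle)‖ < 2
    constructor <;> linarith
  · have := h _ (Or.inr (Or.inl rfl))
    change -2 < 2 - 8 * ‖(y 1 : UnitAddCircle)‖ ∧ 2 - 8 * ‖(y 1 : UnitAddCircle)‖ < 2
    constructor <;> linarith
  · have := h _ (Or.inr (Or.inr rfl))
    rw [AddCircle.coe_add] at this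
    change -2 < 2 - 8 * ‖(y 0 : UnitAddCircle) + (y 1 : UnitAddCircle)‖ ∧
      2 - 8 * ‖(y 0 : UnitAddCircle) + (y 1 : UnitAddCircle)‖ < 2
    constructor <;> linarith

/-- The points of space which are not on the boundary of the cube around the tetrahedron; on the
tetrahedron these are the points outside the edges. -/
def openCube : Set E3 := {p | ∀ i, |p i| < 2}

lemma measurableSet_openCube : MeasurableSet openCube := by
  have : openCube = ⋂ i, {p : E3 | |p i| < 2} := by ext; simp [openCube]
  rw [this]
  exact MeasurableSet.iInter fun i => measurableSet_lt (by fun_prop) measurable_const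

lemma measurableSet_tetra : MeasurableSet tetra := by
  rw [← range_tau]
  exact (isCompact_range continuous_tau).isClosed.measurableSet

lemma isCompact_tetra : IsCompact tetra := range_tau ▸ isCompact_range continuous_tau

lemma haarT_preimage_compl_openCube : haarT (tau ⁻¹' openCubeᶜ) = 0 := by
  rw [haarT_apply (continuous_tau.measurable measurableSet_openCube.compl)]
  refine measure_mono_null (fun y hy => ?_) volume_edgeLines
  by_contra h
  exact hy.1 (abs_tau_proj_lt h)

/-! ### The faces and their area -/

/-- The linear part of the parametrisation of a face. -/
def faceLin : EuclideanSpace ℝ (Fin 2) →ₗ[ℝ] E3 where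
  toFun y := !₂[8 * y 0, 8 * y 1, 8 * (y 0 + y 1)]
  map_add' x y := by ext i; fin_cases i <;> simp <;> ring
  map_smul' r y := by ext i; fin_cases i <;> simp <;> ring

/-- The affine parametrisation of the plane of a face. -/
def facePar (y : Fin 2 → ℝ) : E3 := !₂[2 - 8 * y 0, 2 - 8 * y 1, 2 - 8 * (y 0 + y 1)]

lemma continuous_facePar : Continuous facePar := by
  unfold facePar
  refine (PiLp.continuous_toLp 2 _).comp (continuous_pi fun i => ?_)
  fin_cases i <;> simp <;> fun_prop

/-- The parametrisation is the injective linear map `faceLin` followed by a point reflection. The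
value of the scaling factor is irrelevant, as the area gets normalised. -/
lemma exists_area_facePar : ∃ c : ℝ≥0∞, c ≠ 0 ∧ c ≠ ∞ ∧ ∀ B : Set (Fin 2 → ℝ),
    Measure.euclideanHausdorffMeasure 2 (facePar '' B) = c * volume B := by
  refine ⟨ENNReal.ofReal faceLin.normDet, ?_, ENNReal.ofReal_ne_top, fun B => ?_⟩
  · have h : faceLin.normDet ≠ 0 := by
      refine (faceLin.normDet_ne_zero_tfae.out 0 4 : _ ↔ Function.Injective faceLin).2 ?_
      intro x y hxy
      have h0 := congrArg (fun p : E3 => p 0) hxy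
      have h1 := congrArg (fun p : E3 => p 1) hxy
      simp [faceLin] at h0 h1
      ext i; fin_cases i
      · exact h0
      · exact h1
    simpa using lt_of_le_of_ne faceLin.normDet_nonneg h.symm
  · have h1 : facePar '' B =
        (fun p : E3 => !₂[2, 2, 2] - p) '' (faceLin '' (WithLp.toLp 2 '' B)) := by
      rw [Set.image_image, Set.image_image]
      refine Set.image_congr fun y _ => ?_
      ext i; fin_cases i <;> rfl
    have h2 : Isometry (fun p : E3 => (!₂[2, 2, 2] : E3) - p) :=
      Isometry.of_dist_eq fun p q => dist_sub_left _ _ _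
    rw [h1, h2.euclideanHausdorffMeasure_image]
    have h3 := faceLin.euclideanHausdorffMeasure_image_eq_normDet_mul_volume (WithLp.toLp 2 '' B)
    rw [finrank_euclideanSpace_fin] at h3
    rw [h3]
    congr 1
    rw [← (EuclideanSpace.volume_preserving_symm_measurableEquiv_toLp (Fin 2)).measure_preimage_equiv]
    congr 1
    ext x
    constructor
    · rintro ⟨y, hy, rfl⟩; exact hy
    · intro hx; exact ⟨_, hx, rfl⟩

/-- The reflections and half-turns which change the signs of coordinates. -/
def flip (s : Fin 3 → ℝ) (p : E3) : E3 := WithLp.toLp 2 fun i => s i * p i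

lemma isometry_flip {s : Fin 3 → ℝ} (hs : ∀ i, s i * s i = 1) : Isometry (flip s) := by
  refine Isometry.of_dist_eq fun p q => ?_
  rw [EuclideanSpace.dist_eq, EuclideanSpace.dist_eq]
  congr 1
  refine Finset.sum_congr rfl fun i _ => ?_
  change |s i * p i - s i * q i| ^ 2 = |p i - q i| ^ 2
  rw [sq_abs, sq_abs, ← mul_sub, mul_pow, pow_two (s i), hs, one_mul]

lemma flip_flip {s : Fin 3 → ℝ} (hs : ∀ i, s i * s i = 1) (p : E3) : flip s (flip s p) = p := by
  ext i
  change s i * (s i * p i) = p i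
  rw [← mul_assoc, hs, one_mul]

/-- An open face of the tetrahedron. -/
def openFace (s : Fin 3 → ℝ) : Set E3 :=
  openCube ∩ {p | s 0 * p 0 + s 1 * p 1 - s 2 * p 2 = 2}

lemma measurableSet_openFace (s : Fin 3 → ℝ) : MeasurableSet (openFace s) :=
  measurableSet_openCube.inter (measurableSet_eq_fun (by fun_prop) (by fun_prop))

lemma facePar_eq_tau {y : Fin 2 → ℝ} (h : facePar y ∈ openCube) :
    (0 < y 0 ∧ 0 < y 1 ∧ y 0 + y 1 < 1 / 2) ∧ facePar y = tau (proj y) := by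
  have h0 : |2 - 8 * y 0| < 2 := h 0
  have h1 : |2 - 8 * y 1| < 2 := h 1
  have h2 : |2 - 8 * (y 0 + y 1)| < 2 := h 2
  rw [abs_lt] at h0 h1 h2
  have hy : 0 < y 0 ∧ 0 < y 1 ∧ y 0 + y 1 < 1 / 2 := ⟨by linarith, by linarith, by linarith⟩
  refine ⟨hy, ?_⟩
  ext i
  fin_cases i
  · change 2 - 8 * y 0 = 2 - 8 * ‖(y 0 : UnitAddCircle)‖
    rw [norm_coe_circle] <;> rw [abs_of_nonneg] <;> linarith
  · change 2 - 8 * y 1 = 2 - 8 * ‖(y 1 : UnitAddCircle)‖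
    rw [norm_coe_circle] <;> rw [abs_of_nonneg] <;> linarith
  · change 2 - 8 * (y 0 + y 1) = 2 - 8 * ‖((y 0 + y 1 : ℝ) : UnitAddCircle)‖
    rw [norm_coe_circle] <;> rw [abs_of_nonneg] <;> linarith

lemma exists_facePar {p : E3} (hp : p 0 + p 1 - p 2 = 2) :
    facePar ![(2 - p 0) / 8, (2 - p 1) / 8] = p := by
  ext i
  fin_cases i
  · change 2 - 8 * ((2 - p 0) / 8) = p 0
    ring
  · change 2 - 8 * ((2 - p 1) / 8) = p 1
    ring
  · change 2 - 8 * ((2 - p 0) / 8 + (2 - p 1) / 8) = p 2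
    linarith

/-- Inside the fundamental square the face has two preimages, the triangle parametrised by `facePar`
and its negative. This is the factor two of the double cover. -/
lemma haarT_preimage_of_subset {S : Set E3} (hS : MeasurableSet S) (hSF : S ⊆ openFace 1) :
    haarT (tau ⁻¹' S) = 2 * volume (facePar ⁻¹' S) := by
  rw [haarT_apply (continuous_tau.measurable hS)]
  have hset : proj ⁻¹' (tau ⁻¹' S) ∩ box = facePar ⁻¹' S ∪ Neg.neg ⁻¹' (facePar ⁻¹' S) := by
    ext y
    constructor
    · rintro ⟨hy, hb⟩
      have hyS : tau (proj y) ∈ S := hy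
      have hF := hSF hyS
      have hb0 : y 0 ∈ Set.Ioc (-(1 / 2) : ℝ) (1 / 2) := hb 0 trivial
      have hb1 : y 1 ∈ Set.Ioc (-(1 / 2) : ℝ) (1 / 2) := hb 1 trivial
      have h0 : |y 0| ≤ 1 / 2 := abs_le.2 ⟨hb0.1.le, hb0.2⟩
      have h1 : |y 1| ≤ 1 / 2 := abs_le.2 ⟨hb1.1.le, hb1.2⟩
      have e0 : ‖proj y 0‖ = |y 0| := norm_coe_circle h0
      have e1 : ‖proj y 1‖ = |y 1| := norm_coe_circle h1
      have e2 : ‖proj y 0 + proj y 1‖ = _ := norm_add_coe h0 h1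
      have c0 : |tau (proj y) 0| < 2 := hF.1 0
      have c1 : |tau (proj y) 1| < 2 := hF.1 1
      have c2 : |tau (proj y) 2| < 2 := hF.1 2
      have hs : (1 : ℝ) * tau (proj y) 0 + 1 * tau (proj y) 1 - 1 * tau (proj y) 2 = 2 := hF.2
      rw [tau_zero, e0] at c0 hs
      rw [tau_one, e1] at c1 hs
      rw [tau_two] at c2 hs
      have e3 : ‖proj y 0 + proj y 1‖ = |y 0| + |y 1| := by linarith
      rw [e3] at e2 c2
      rw [abs_lt] at c0 c1 c2
      have hP : ∀ z : Fin 2 → ℝ, 0 ≤ z 0 → 0 ≤ z 1 → |y 0| = z 0 → |y 1| = z 1 →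
          tau (proj y) = tau (proj z) → facePar z ∈ S := by
        intro z hz0 hz1 hyz0 hyz1 hz
        have : facePar z = tau (proj z) := by
          refine (facePar_eq_tau fun i => ?_).2
          rw [abs_lt]
          fin_cases i
          · change -2 < 2 - 8 * z 0 ∧ 2 - 8 * z 0 < 2
            constructor <;> linarith
          · change -2 < 2 - 8 * z 1 ∧ 2 - 8 * z 1 < 2
            constructor <;> linarith
          · change -2 < 2 - 8 * (z 0 + z 1) ∧ 2 - 8 * (z 0 + z 1) < 2
            constructor <;> linarith
        rw [this, ← hz]; exact hyS
      -- The equation of the face forces the fold of `y 0 + y 1` to be `|y 0| + |y 1|`, which is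
      -- impossible for opposite signs.
      rcases abs_cases (y 0) with ⟨a0, _⟩ | ⟨a0, _⟩ <;>
        rcases abs_cases (y 1) with ⟨a1, _⟩ | ⟨a1, _⟩ <;>
        rw [a0, a1] at e2 <;> rw [a0] at c0 c2 <;> rw [a1] at c1 c2
      · left; exact hP y (by linarith) (by linarith) a0 a1 rfl
      · exfalso
        rcases abs_cases (y 0 + y 1) with ⟨a2, _⟩ | ⟨a2, _⟩ <;> rw [a2] at e2 <;>
          split_ifs at e2 <;> linarith
      · exfalso
        rcases abs_cases (y 0 + y 1) with ⟨a2, _⟩ | ⟨a2, _⟩ <;> rw [a2] at e2 <;>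
          split_ifs at e2 <;> linarith
      · right
        refine hP (-y) ?_ ?_ a0 a1 (by rw [proj_neg, tau_neg])
        · change 0 ≤ -y 0; linarith
        · change 0 ≤ -y 1; linarith
    · have hP : ∀ z, facePar z ∈ S → tau (proj z) ∈ S ∧ 0 < z 0 ∧ 0 < z 1 ∧ z 0 + z 1 < 1 / 2 := by
        intro z hz
        have := facePar_eq_tau (hSF hz).1
        exact ⟨this.2 ▸ hz, this.1⟩
      rintro (hy | hy)
      · obtain ⟨h, h0, h1, h2⟩ := hP y hy
        refine ⟨h, fun i _ => ?_⟩
        fin_cases i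
        · change y 0 ∈ Set.Ioc (-(1 / 2) : ℝ) (1 / 2)
          constructor <;> linarith
        · change y 1 ∈ Set.Ioc (-(1 / 2) : ℝ) (1 / 2)
          constructor <;> linarith
      · obtain ⟨h, h0, h1, h2⟩ := hP (-y) hy
        rw [proj_neg, tau_neg] at h
        change 0 < -y 0 at h0
        change 0 < -y 1 at h1
        change -y 0 + -y 1 < 1 / 2 at h2
        refine ⟨h, fun i _ => ?_⟩
        fin_cases i
        · change y 0 ∈ Set.Ioc (-(1 / 2) : ℝ) (1 / 2)
          constructor <;> linarith
        · change y 1 ∈ Set.Ioc (-(1 / 2) : ℝ) (1 / 2)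
          constructor <;> linarith
  have hm : MeasurableSet (facePar ⁻¹' S) := continuous_facePar.measurable hS
  rw [hset, measure_union _ (measurable_neg hm), Measure.measure_preimage_neg, two_mul]
  rw [Set.disjoint_left]
  intro y hy hy'
  have h1 := (facePar_eq_tau (hSF hy).1).1.1
  have h2 := (facePar_eq_tau (hSF hy').1).1.1
  change 0 < -y 0 at h2
  linarith

/-- The four sign changes which permute the faces simply transitively. -/
def faceSigns : Fin 4 → Fin 3 → ℝ := ![![1, 1, 1], ![-1, 1, -1], ![1, -1, -1], ![-1, -1, 1]]

lemma faceSigns_mul_self (j : Fin 4) (i : Fin 3) : faceSigns j i * faceSigns j i = 1 := by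
  fin_cases j <;> fin_cases i <;> norm_num [faceSigns]

lemma abs_faceSigns (j : Fin 4) (i : Fin 3) : |faceSigns j i| = 1 := by
  fin_cases j <;> fin_cases i <;> norm_num [faceSigns]

lemma norm_add_half (x : UnitAddCircle) : ‖x + ((1 / 2 : ℝ) : UnitAddCircle)‖ = 1 / 2 - ‖x‖ := by
  obtain ⟨y, rfl, hy⟩ := exists_coe_circle x
  have h := hy.trans_le (norm_circle_le _)
  rw [← hy, ← AddCircle.coe_add]
  rcases abs_cases y with ⟨e, _⟩ | ⟨e, _⟩ <;> rw [e] at h ⊢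
  · rw [show y + 1 / 2 = -(1 / 2 - y) + 1 by ring, AddCircle.coe_add, AddCircle.coe_period, add_zero,
      AddCircle.coe_neg, norm_neg, norm_coe_circle] <;> rw [abs_of_nonneg] <;> linarith
  · rw [norm_coe_circle] <;> rw [abs_of_nonneg] <;> linarith

/-- Adding `1 / 2` replaces `‖x‖` by `1 / 2 - ‖x‖`, that is, changes the sign of `2 - 8‖x‖`; a
nonzero half-period affects exactly two of the three arguments. Invariance of Haar measure thus
carries the area formula from one face to the others. -/
lemma exists_half_translation (j : Fin 4) : ∃ h : Torus, ∀ t, tau (t + h) = flip (faceSigns j) (tau t) := by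
  have hh : ((1 / 2 : ℝ) : UnitAddCircle) + ((1 / 2 : ℝ) : UnitAddCircle) = 0 := by
    rw [← AddCircle.coe_add]; norm_num
  fin_cases j
  · refine ⟨0, fun t => ?_⟩
    ext i
    rw [add_zero]
    fin_cases i <;> simp [flip, faceSigns]
  · refine ⟨![((1 / 2 : ℝ) : UnitAddCircle), 0], fun t => ?_⟩
    ext i
    fin_cases i
    · change 2 - 8 * ‖t 0 + ((1 / 2 : ℝ) : UnitAddCircle)‖ = -1 * (2 - 8 * ‖t 0‖)
      rw [norm_add_half]; ring
    · change 2 - 8 * ‖t 1 + 0‖ = 1 * (2 - 8 * ‖t 1‖)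
      rw [add_zero]; ring
    · change 2 - 8 * ‖(t 0 + ((1 / 2 : ℝ) : UnitAddCircle)) + (t 1 + 0)‖ = -1 * (2 - 8 * ‖t 0 + t 1‖)
      rw [add_zero, add_right_comm, norm_add_half]; ring
  · refine ⟨![0, ((1 / 2 : ℝ) : UnitAddCircle)], fun t => ?_⟩
    ext i
    fin_cases i
    · change 2 - 8 * ‖t 0 + 0‖ = 1 * (2 - 8 * ‖t 0‖)
      rw [add_zero]; ring
    · change 2 - 8 * ‖t 1 + ((1 / 2 : ℝ) : UnitAddCircle)‖ = -1 * (2 - 8 * ‖t 1‖)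
      rw [norm_add_half]; ring
    · change 2 - 8 * ‖(t 0 + 0) + (t 1 + ((1 / 2 : ℝ) : UnitAddCircle))‖ = -1 * (2 - 8 * ‖t 0 + t 1‖)
      rw [add_zero, ← add_assoc, norm_add_half]; ring
  · refine ⟨![((1 / 2 : ℝ) : UnitAddCircle), ((1 / 2 : ℝ) : UnitAddCircle)], fun t => ?_⟩
    ext i
    fin_cases i
    · change 2 - 8 * ‖t 0 + ((1 / 2 : ℝ) : UnitAddCircle)‖ = -1 * (2 - 8 * ‖t 0‖)
      rw [norm_add_half]; ring
    · change 2 - 8 * ‖t 1 + ((1 / 2 : ℝ) : UnitAddCircle)‖ = -1 * (2 - 8 * ‖t 1‖)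
      rw [norm_add_half]; ring
    · change 2 - 8 * ‖(t 0 + ((1 / 2 : ℝ) : UnitAddCircle)) + (t 1 + ((1 / 2 : ℝ) : UnitAddCircle))‖ =
        1 * (2 - 8 * ‖t 0 + t 1‖)
      rw [add_add_add_comm, hh, add_zero]; ring

lemma exists_faceSigns {p : E3} (hp : p ∈ tetra) :
    ∃ j, faceSigns j 0 * p 0 + faceSigns j 1 * p 1 - faceSigns j 2 * p 2 = 2 := by
  have hg : max (max (-p 0 - p 1 - p 2) (-p 0 + p 1 + p 2))
      (max (p 0 - p 1 + p 2) (p 0 + p 1 - p 2)) = 2 := hp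
  rcases max_choice (max (-p 0 - p 1 - p 2) (-p 0 + p 1 + p 2))
    (max (p 0 - p 1 + p 2) (p 0 + p 1 - p 2)) with h | h <;> rw [h] at hg
  · rcases max_choice (-p 0 - p 1 - p 2) (-p 0 + p 1 + p 2) with h | h <;> rw [h] at hg
    · exact ⟨3, by rw [← hg]; simp [faceSigns]; ring⟩
    · exact ⟨1, by rw [← hg]; simp [faceSigns]⟩
  · rcases max_choice (p 0 - p 1 + p 2) (p 0 + p 1 - p 2) with h | h <;> rw [h] at hg
    · exact ⟨2, by rw [← hg]; simp [faceSigns]; ring⟩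
    · exact ⟨0, by rw [← hg]; simp [faceSigns]⟩

lemma preimage_flip {s : Fin 3 → ℝ} (hs : ∀ i, s i * s i = 1) (S : Set E3) :
    flip s ⁻¹' S = flip s '' S := by
  ext p
  constructor
  · intro hp; exact ⟨flip s p, hp, flip_flip hs p⟩
  · rintro ⟨q, hq, rfl⟩
    change flip s (flip s q) ∈ S
    rwa [flip_flip hs]

/-- A point of the tetrahedron outside the open cube has a coordinate `±2`. After a sign change that
brings it to the plane of the first face, its parameter lies on `edgeLines`. -/
lemma area_tetra_diff_openCube :
    Measure.euclideanHausdorffMeasure 2 (tetra \ openCube) = 0 := by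
  obtain ⟨c, -, -, hc⟩ := exists_area_facePar
  have hsub : tetra \ openCube ⊆ ⋃ j, flip (faceSigns j) '' (facePar '' edgeLines) := by
    rintro p ⟨hp, hpc⟩
    obtain ⟨t, rfl⟩ := exists_tau_of_mem hp
    obtain ⟨j, hj⟩ := exists_faceSigns hp
    have hs := faceSigns_mul_self j
    set q := flip (faceSigns j) (tau t) with hq
    have hq2 : q 0 + q 1 - q 2 = 2 := hj
    refine Set.mem_iUnion.2 ⟨j, q, ⟨_, ?_, exists_facePar hq2⟩, flip_flip hs _⟩
    have habs : ∀ i, |q i| = |tau t i| := fun i => by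
      change |faceSigns j i * tau t i| = _
      rw [abs_mul, abs_faceSigns, one_mul]
    have h2 : ∀ x : UnitAddCircle, |2 - 8 * ‖x‖| ≤ 2 := fun x =>
      abs_le.2 ⟨by linarith [norm_circle_le x], by linarith [norm_nonneg x]⟩
    have hle : ∀ i, |tau t i| ≤ 2 := fun i => by fin_cases i <;> exact h2 _
    have hex : ∃ i, ¬ |tau t i| < 2 := by
      by_contra hcon
      push Not at hcon
      exact hpc hcon
    obtain ⟨i, hi⟩ := hex
    have hi2 : |q i| = 2 := (habs i).trans (le_antisymm (hle i) (not_lt.1 hi))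
    have hk : ∀ x : ℝ, |x| = 2 → ∃ k : ℤ, (2 - x) / 8 = k / 2 := by
      intro x hx
      rcases abs_eq (by norm_num : (0 : ℝ) ≤ 2) |>.1 hx with rfl | rfl
      · exact ⟨0, by norm_num⟩
      · exact ⟨1, by norm_num⟩
    obtain ⟨k, hk⟩ := hk _ hi2
    refine Set.mem_iUnion.2 ⟨k, ?_⟩
    fin_cases i
    · exact Or.inl (Or.inl hk)
    · exact Or.inl (Or.inr hk)
    · right
      change (2 - q 0) / 8 + (2 - q 1) / 8 = k / 2
      change (2 - q 2) / 8 = k / 2 at hk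
      linarith
  refine measure_mono_null hsub (measure_iUnion_null fun j => ?_)
  rw [(isometry_flip (faceSigns_mul_self j)).euclideanHausdorffMeasure_image, hc, volume_edgeLines,
    mul_zero]

lemma exists_area_eq : ∃ c : ℝ≥0∞, c ≠ 0 ∧ c ≠ ∞ ∧
    (Measure.euclideanHausdorffMeasure 2).restrict tetra = c • haarT.map tau := by
  obtain ⟨c, hc0, hctop, hc⟩ := exists_area_facePar
  have hτ := continuous_tau.measurable
  refine ⟨c / 2, by simp [hc0], ENNReal.div_ne_top hctop (by norm_num), ?_⟩
  have hmain : ∀ S, MeasurableSet S → S ⊆ openFace 1 →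
      Measure.euclideanHausdorffMeasure 2 S = c / 2 * haarT (tau ⁻¹' S) := by
    intro S hS hSF
    have : facePar '' (facePar ⁻¹' S) = S := by
      rw [Set.image_preimage_eq_iff]
      intro p hp
      have h := (hSF hp).2
      exact ⟨_, exists_facePar (by simpa using h)⟩
    rw [haarT_preimage_of_subset hS hSF, ← mul_assoc,
      ENNReal.div_mul_cancel (by norm_num) (by norm_num), ← hc, this]
  have hface : ∀ j S, MeasurableSet S → S ⊆ openFace (faceSigns j) →
      S ⊆ tetra ∧ Measure.euclideanHausdorffMeasure 2 S = c / 2 * haarT (tau ⁻¹' S) := by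
    intro j S hS hSF
    have hs := faceSigns_mul_self j
    obtain ⟨h, hh⟩ := exists_half_translation j
    have hm := isometry_flip hs
    have hsub : flip (faceSigns j) ⁻¹' S ⊆ openFace 1 := by
      intro p hp
      have h1 := hSF hp
      refine ⟨fun i => ?_, ?_⟩
      · have h2 : |faceSigns j i * p i| < 2 := h1.1 i
        rwa [abs_mul, abs_faceSigns, one_mul] at h2
      · have h2 : faceSigns j 0 * (faceSigns j 0 * p 0) + faceSigns j 1 * (faceSigns j 1 * p 1) -
          faceSigns j 2 * (faceSigns j 2 * p 2) = 2 := h1.2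
        simp only [← mul_assoc, hs] at h2
        exact h2
    have hSm : MeasurableSet (flip (faceSigns j) ⁻¹' S) := hm.continuous.measurable hS
    constructor
    · intro p hp
      have h1 : flip (faceSigns j) p ∈ flip (faceSigns j) ⁻¹' S := by
        change flip (faceSigns j) (flip (faceSigns j) p) ∈ S
        rwa [flip_flip hs]
      have h2 := hsub h1
      have h3 := exists_facePar (p := flip (faceSigns j) p) (by simpa using h2.2)
      have h4 := (facePar_eq_tau (h3.symm ▸ h2.1)).2
      rw [← flip_flip hs p, ← h3, h4, ← hh]
      exact tau_mem _
    · have e1 := hmain _ hSm hsub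
      rw [preimage_flip hs, hm.euclideanHausdorffMeasure_image] at e1
      rw [e1, ← preimage_flip hs]
      congr 1
      have e2 : tau ⁻¹' (flip (faceSigns j) ⁻¹' S) = (fun t => t + h) ⁻¹' (tau ⁻¹' S) := by
        ext t
        simp only [Set.mem_preimage, hh]
      rw [e2, measure_preimage_add_right]
  have hcover : (Set.univ : Set E3) =
      (((openFace (faceSigns 0) ∪ openFace (faceSigns 1)) ∪
        (openFace (faceSigns 2) ∪ openFace (faceSigns 3))) ∪ tetra \ openCube) ∪ tetraᶜ := by
    refine (Set.eq_univ_of_forall fun p => ?_).symm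
    by_cases hp : p ∈ tetra
    · left
      by_cases hpc : p ∈ openCube
      · left
        obtain ⟨j, hj⟩ := exists_faceSigns hp
        have : p ∈ openFace (faceSigns j) := ⟨hpc, hj⟩
        fin_cases j
        · exact Or.inl (Or.inl this)
        · exact Or.inl (Or.inr this)
        · exact Or.inr (Or.inl this)
        · exact Or.inr (Or.inr this)
      · exact Or.inr ⟨hp, hpc⟩
    · exact Or.inr hp
  -- Two measures agree as soon as their restrictions to the pieces of a finite cover do. They agree
  -- on the open faces, and both vanish on the edges and outside the tetrahedron.
  rw [← Measure.restrict_univ (μ := (Measure.euclideanHausdorffMeasure 2).restrict tetra),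
    ← Measure.restrict_univ (μ := (c / 2) • haarT.map tau), hcover]
  have hF : ∀ j, ((Measure.euclideanHausdorffMeasure 2).restrict tetra).restrict
      (openFace (faceSigns j)) = ((c / 2) • haarT.map tau).restrict (openFace (faceSigns j)) := by
    intro j
    ext S hS
    rw [Measure.restrict_apply hS, Measure.restrict_apply hS]
    have h := hface j (S ∩ openFace (faceSigns j)) (hS.inter (measurableSet_openFace _))
      Set.inter_subset_right
    rw [Measure.restrict_apply (hS.inter (measurableSet_openFace _)),
      Set.inter_eq_left.2 h.1, h.2, Measure.smul_apply,
      Measure.map_apply hτ (hS.inter (measurableSet_openFace _)), smul_eq_mul]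
  simp only [Measure.restrict_union_congr]
  refine ⟨⟨⟨⟨hF 0, hF 1⟩, hF 2, hF 3⟩, ?_⟩, ?_⟩
  · rw [Measure.restrict_eq_zero.2, Measure.restrict_eq_zero.2]
    · rw [Measure.smul_apply, Measure.map_apply hτ (measurableSet_tetra.diff measurableSet_openCube)]
      rw [measure_mono_null _ haarT_preimage_compl_openCube, smul_zero]
      exact fun t ht => ht.2
    · rw [Measure.restrict_apply (measurableSet_tetra.diff measurableSet_openCube)]
      exact measure_mono_null Set.inter_subset_left area_tetra_diff_openCube
  · rw [Measure.restrict_eq_zero.2, Measure.restrict_eq_zero.2]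
    · rw [Measure.smul_apply, Measure.map_apply hτ measurableSet_tetra.compl]
      have : tau ⁻¹' tetraᶜ = ∅ := by
        ext t; simp [tau_mem]
      rw [this, measure_empty, smul_zero]
    · rw [Measure.restrict_apply measurableSet_tetra.compl]
      simp

theorem tetraMeasure_eq : tetraMeasure = haarT.map tau := by
  obtain ⟨c, hc0, hctop, hc⟩ := exists_area_eq
  have hτ := continuous_tau.measurable
  have h1 : Measure.euclideanHausdorffMeasure 2 tetra = c := by
    have := congrArg (fun μ : Measure E3 => μ Set.univ) hc
    simpa [Measure.map_apply hτ MeasurableSet.univ] using this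
  rw [tetraMeasure, ProbabilityTheory.cond, hc, h1, smul_smul, ENNReal.inv_mul_cancel hc0 hctop,
    one_smul]

lemma measurePreserving_tau : MeasurePreserving tau haarT tetraMeasure :=
  ⟨continuous_tau.measurable, tetraMeasure_eq.symm⟩

instance : IsProbabilityMeasure tetraMeasure := by
  rw [tetraMeasure_eq]
  exact Measure.isProbabilityMeasure_map continuous_tau.measurable.aemeasurable

lemma IsTropicalAction.semiconj {Φ : GL (Fin 2) ℤ →* Equiv.Perm E3}
    (hΦ : IsTropicalAction Φ) (A : GL (Fin 2) ℤ) :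
    Function.Semiconj tau (tact A.1) (Φ A) := fun t => (hΦ.apply_tau A t).symm

lemma IsTropicalAction.measurePreserving {Φ : GL (Fin 2) ℤ →* Equiv.Perm E3}
    (hΦ : IsTropicalAction Φ) (A : GL (Fin 2) ℤ) :
    MeasurePreserving (Φ A) tetraMeasure tetraMeasure :=
  measurePreserving_tau.of_semiconj (measurePreserving_tact A) (hΦ.semiconj A) (hΦ.measurable A)

lemma tetraMeasure_compl_tetra : tetraMeasure tetraᶜ = 0 := by
  rw [tetraMeasure_eq, Measure.map_apply continuous_tau.measurable measurableSet_tetra.compl]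
  have : tau ⁻¹' tetraᶜ = ∅ := by
    ext t; simp [tau_mem]
  rw [this, measure_empty]


/-! ### Bounds for the metric and the topological entropy -/

/-- Gibbs' inequality, from `log x ≤ x - 1`; the comparison weights `q` need only have total mass at
most one. -/
lemma sum_negMulLog_le {ι : Type*} [Fintype ι] {p q : ι → ℝ} (hp : ∀ i, 0 ≤ p i)
    (hp1 : ∑ i, p i = 1) (hq : ∀ i, 0 < q i) (hq1 : ∑ i, q i ≤ 1) :
    ∑ i, Real.negMulLog (p i) ≤ ∑ i, p i * -Real.log (q i) := by
  have h : ∀ i, Real.negMulLog (p i) - p i * -Real.log (q i) ≤ q i - p i := by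
    intro i
    rcases (hp i).eq_or_lt with h0 | h0
    · rw [← h0]; simp [(hq i).le]
    · have h1 := Real.log_le_sub_one_of_pos (div_pos (hq i) h0)
      rw [Real.log_div (hq i).ne' h0.ne'] at h1
      have h2 := mul_le_mul_of_nonneg_left h1 (hp i)
      rw [mul_sub (p i) (q i / p i), mul_div_cancel₀ _ h0.ne'] at h2
      rw [Real.negMulLog]; linarith
  have := Finset.sum_le_sum fun i (_ : i ∈ Finset.univ) => h i
  rw [Finset.sum_sub_distrib, Finset.sum_sub_distrib] at this
  linarith

lemma sum_measureReal_mul {X : Type*} [MeasurableSpace X] (μ : Measure X) [IsProbabilityMeasure μ]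
    {ι : Type*} [Fintype ι] [MeasurableSpace ι] [MeasurableSingletonClass ι] {W : X → ι}
    (hW : Measurable W) (F : ι → ℝ) :
    ∑ a, μ.real (W ⁻¹' {a}) * F a = ∫ x, F (W x) ∂μ := by
  have : IsProbabilityMeasure (μ.map W) := Measure.isProbabilityMeasure_map hW.aemeasurable
  rw [← integral_map hW.aemeasurable (Measurable.of_discrete).aestronglyMeasurable,
    integral_fintype (Integrable.of_finite)]
  refine Finset.sum_congr rfl fun a _ => ?_
  rw [map_measureReal_apply hW (measurableSet_singleton a), smul_eq_mul]

/-- An inequality of Fano type. The word `W` is to be guessed from the code `R`, the letter `i` by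
`J i`. Gibbs' inequality is applied to the mixture that draws a code uniformly and then independent
letters concentrated on the guesses: the code costs `log N`, every letter `-log (1 - ε)`, and every
wrong guess at most `log (k / ε)` more. -/
lemma partitionEntropy_le_of_code {X : Type*} [MeasurableSpace X] (μ : Measure X)
    [IsProbabilityMeasure μ] {n k N : ℕ} {W : X → (Fin n → Fin k)} (hW : Measurable W)
    {R : X → Fin N} (hR : Measurable R) (J : Fin n → Fin N → Fin k) {ε : ℝ} (hε0 : 0 < ε)
    (hε1 : ε < 1) (hk : 0 < k) :
    partitionEntropy μ W ≤ Real.log N + n * -Real.log (1 - ε) +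
      Real.log (k / ε) * ∑ i, μ.real {x | W x i ≠ J i (R x)} := by
  obtain ⟨x₀⟩ := μ.nonempty_of_neZero
  have hN : 0 < N := (Nat.zero_le _).trans_lt (R x₀).2
  have hN' : (0 : ℝ) < N := Nat.cast_pos.2 hN
  have hk' : (0 : ℝ) < k := Nat.cast_pos.2 hk
  have hk1 : (1 : ℝ) ≤ k := Nat.one_le_cast.2 hk
  set L := Real.log (k / ε) with hL
  have hL0 : 0 ≤ L := Real.log_nonneg (by rw [le_div_iff₀ hε0]; linarith)
  have hε' : 0 ≤ -Real.log (1 - ε) := by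
    have := Real.log_nonpos (by linarith : 0 ≤ 1 - ε) (by linarith); linarith
  let w : Fin n → Fin N → Fin k → ℝ := fun i r j => if j = J i r then 1 - ε else ε / k
  have hw0 : ∀ i r j, 0 < w i r j := fun i r j => by
    dsimp only [w]; split_ifs
    · linarith
    · positivity
  have hw1 : ∀ i r, ∑ j, w i r j ≤ 1 := fun i r => by
    have h1 : ∀ j, w i r j ≤ (if j = J i r then 1 - ε else 0) + ε / k := fun j => by
      dsimp only [w]; split_ifs
      · have : 0 < ε / k := by positivity
        linarith
      · simp
    refine (Finset.sum_le_sum fun j _ => h1 j).trans ?_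
    rw [Finset.sum_add_distrib, Finset.sum_ite_eq']
    simp only [Finset.mem_univ, if_true, Finset.sum_const, Finset.card_univ, Fintype.card_fin,
      nsmul_eq_mul]
    rw [mul_div_cancel₀ _ hk'.ne']; linarith
  let q : (Fin n → Fin k) → ℝ := fun a => (N : ℝ)⁻¹ * ∑ r, ∏ i, w i r (a i)
  have hprod : ∀ r (a : Fin n → Fin k), 0 < ∏ i, w i r (a i) := fun r a => Finset.prod_pos fun i _ => hw0 _ _ _
  have hq0 : ∀ a, 0 < q a := fun a =>
    mul_pos (inv_pos.2 hN') (Finset.sum_pos (fun r _ => hprod r a) ⟨⟨0, hN⟩, Finset.mem_univ _⟩)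
  have hq1 : ∑ a, q a ≤ 1 := by
    rw [← Finset.mul_sum, Finset.sum_comm, inv_mul_le_iff₀ hN', mul_one]
    have : ∀ r, ∑ a : Fin n → Fin k, ∏ i, w i r (a i) ≤ 1 := fun r => by
      rw [← Fintype.piFinset_univ, Finset.sum_prod_piFinset]
      exact Finset.prod_le_one (fun i _ => Finset.sum_nonneg fun j _ => (hw0 _ _ _).le)
        fun i _ => hw1 i r
    refine (Finset.sum_le_sum fun r _ => this r).trans ?_
    simp
  have hp1 : ∑ a, μ.real (W ⁻¹' {a}) = 1 := by
    have := sum_measureReal_mul μ hW fun _ => 1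
    simpa using this
  refine (sum_negMulLog_le (fun a => measureReal_nonneg) hp1 hq0 hq1).trans ?_
  rw [sum_measureReal_mul μ hW fun a => -Real.log (q a)]
  have hset : ∀ i, MeasurableSet {x | W x i ≠ J i (R x)} := fun i =>
    (measurableSet_eq_fun ((measurable_pi_apply i).comp hW)
      ((Measurable.of_discrete (f := J i)).comp hR)).compl
  have hB : ∀ x, -Real.log (q (W x)) ≤ (Real.log N + n * -Real.log (1 - ε)) +
      L * ∑ i, Set.indicator {x | W x i ≠ J i (R x)} (fun _ => (1 : ℝ)) x := by
    intro x
    -- Of the mixture only the term of the true code of `x` is kept.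
    have h1 : (N : ℝ)⁻¹ * ∏ i, w i (R x) (W x i) ≤ q (W x) := by
      refine mul_le_mul_of_nonneg_left ?_ (inv_pos.2 hN').le
      exact Finset.single_le_sum (f := fun r => ∏ i, w i r (W x i)) (fun r _ => (hprod r _).le)
        (Finset.mem_univ (R x))
    have h2 := Real.log_le_log (mul_pos (inv_pos.2 hN') (hprod _ _)) h1
    rw [Real.log_mul (inv_pos.2 hN').ne' (hprod _ _).ne', Real.log_inv,
      Real.log_prod (fun i _ => (hw0 _ _ _).ne')] at h2
    have h3 : ∀ i, -Real.log (w i (R x) (W x i)) ≤ -Real.log (1 - ε) +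
        L * Set.indicator {x | W x i ≠ J i (R x)} (fun _ => (1 : ℝ)) x := by
      intro i
      by_cases h : W x i = J i (R x)
      · simp [w, h]
      · have : x ∈ {x | W x i ≠ J i (R x)} := h
        rw [Set.indicator_of_mem this, mul_one]
        dsimp only [w]
        rw [if_neg h, ← Real.log_inv, inv_div]
        linarith
    have h4 := Finset.sum_le_sum fun i (_ : i ∈ Finset.univ) => h3 i
    rw [Finset.sum_add_distrib, ← Finset.mul_sum, Finset.sum_neg_distrib, Finset.sum_const,
      Finset.card_univ, Fintype.card_fin, nsmul_eq_mul] at h4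
    linarith
  have hint : ∀ i, Integrable (Set.indicator {x | W x i ≠ J i (R x)} (fun _ => (1 : ℝ))) μ :=
    fun i => (integrable_const 1).indicator (hset i)
  have hintB : Integrable (fun x => (Real.log N + n * -Real.log (1 - ε)) +
      L * ∑ i, Set.indicator {x | W x i ≠ J i (R x)} (fun _ => (1 : ℝ)) x) μ :=
    (integrable_const _).add ((integrable_finsetSum _ fun i _ => hint i).const_mul L)
  have : IsProbabilityMeasure (μ.map W) := Measure.isProbabilityMeasure_map hW.aemeasurable
  have hintq : Integrable (fun x => -Real.log (q (W x))) μ :=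
    (Integrable.of_finite (μ := μ.map W) (f := fun a => -Real.log (q a))).comp_measurable hW
  refine (integral_mono hintq hintB hB).trans ?_
  rw [integral_add (integrable_const _) ((integrable_finsetSum _ fun i _ => hint i).const_mul L),
    integral_const, probReal_univ, one_smul, integral_const_mul,
    integral_finsetSum _ fun i _ => hint i]
  simp only [integral_indicator_const _ (hset _), smul_eq_mul, mul_one]
  exact le_rfl

/-- The map `g` has exponential growth rate of orbits at most `h`, at all scales. -/
def HasSmallCovers {X : Type*} [MetricSpace X] [MeasurableSpace X] (g : X → X) (h : ℝ) : Prop :=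
  ∀ δ > 0, ∀ ε > 0, ∀ᶠ n : ℕ in atTop, ∃ (N : ℕ) (R : X → Fin N), Measurable R ∧
    (N : ℝ) ≤ Real.exp (n * (h + ε)) ∧
    ∀ x y, R x = R y → ∀ i < n, dist (g^[i] x) (g^[i] y) < δ

/-- By inner regularity the atoms of `P` are nearly exhausted by disjoint compact sets, which lie at
positive distance from each other. Off a set of measure `κ`, an approximate position then reveals
the atom. -/
lemma exists_separated_compacts {X : Type*} [MetricSpace X] [CompactSpace X] [MeasurableSpace X]
    [BorelSpace X] (μ : Measure X) [IsProbabilityMeasure μ] {k : ℕ} {P : X → Fin k}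
    (hP : Measurable P) {κ : ℝ} (hκ : 0 < κ) :
    ∃ K : Fin k → Set X, ∃ δ > 0, (∀ j, MeasurableSet (K j)) ∧ (∀ j, ∀ x ∈ K j, P x = j) ∧
      (∀ i j, ∀ x ∈ K i, ∀ y ∈ K j, dist x y < δ → i = j) ∧ μ.real (⋃ j, K j)ᶜ ≤ κ := by
  have hk : 0 < k := by
    obtain ⟨x₀⟩ := μ.nonempty_of_neZero
    exact (Nat.zero_le _).trans_lt (P x₀).2
  have hk' : (0 : ℝ) < k := Nat.cast_pos.2 hk
  have hκk : ENNReal.ofReal (κ / k) ≠ 0 := by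
    rw [Ne, ENNReal.ofReal_eq_zero, not_le]; positivity
  choose K hKP hK hKμ using fun j : Fin k =>
    (hP (measurableSet_singleton j)).exists_isCompact_sdiff_lt (μ := μ) (measure_ne_top _ _) hκk
  have hsep : ∀ i j, ∀ᶠ δ : ℝ in 𝓝[>] 0, ∀ x ∈ K i, ∀ y ∈ K j, dist x y < δ → i = j := by
    intro i j
    rcases eq_or_ne i j with rfl | hij
    · exact Eventually.of_forall fun _ _ _ _ _ _ => rfl
    · have hd : Disjoint (K i) (K j) := by
        rw [Set.disjoint_left]
        intro x hxi hxj
        exact hij ((hKP i hxi : P x = i).symm.trans (hKP j hxj))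
      obtain ⟨r, hr, hr'⟩ := Metric.exists_pos_forall_lt_edist (hK i) (hK j).isClosed hd
      have : ∀ᶠ δ : ℝ in 𝓝[>] 0, δ < r :=
        eventually_nhdsWithin_of_eventually_nhds (eventually_lt_nhds (NNReal.coe_pos.2 hr))
      filter_upwards [this] with δ hδ x hx y hy hxy
      exfalso
      have h1 := hr' x hx y hy
      rw [edist_dist, ← ENNReal.ofReal_coe_nnreal,
        ENNReal.ofReal_lt_ofReal_iff_of_nonneg r.coe_nonneg] at h1
      linarith
  have hsep' := eventually_all.2 fun i => eventually_all.2 fun j => hsep i j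
  obtain ⟨δ, hδ, hδ0⟩ := (hsep'.and self_mem_nhdsWithin).exists
  refine ⟨K, δ, hδ0, fun j => (hK j).isClosed.measurableSet, fun j x hx => hKP j hx,
    hδ, ?_⟩
  have hsub : (⋃ j, K j)ᶜ ⊆ ⋃ j ∈ (Finset.univ : Finset (Fin k)), (P ⁻¹' {j} \ K j) := by
    intro x hx
    simp only [Set.mem_compl_iff, Set.mem_iUnion, not_exists] at hx
    simp only [Finset.mem_univ, Set.iUnion_true, Set.mem_iUnion]
    exact ⟨P x, rfl, hx _⟩
  refine (measureReal_mono hsub (measure_ne_top _ _)).trans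
    ((measureReal_biUnion_finset_le _ _).trans ?_)
  have : ∀ j, μ.real (P ⁻¹' {j} \ K j) ≤ κ / k := fun j =>
    ENNReal.toReal_le_of_le_ofReal (by positivity) (hKμ j).le
  refine (Finset.sum_le_sum fun j _ => this j).trans ?_
  simp only [Finset.sum_const, Finset.card_univ, Fintype.card_fin, nsmul_eq_mul]
  rw [mul_div_cancel₀ _ hk'.ne']

lemma measurable_joinPartition {X : Type*} [MeasurableSpace X] {g : X → X} (hg : Measurable g)
    {k : ℕ} {P : X → Fin k} (hP : Measurable P) (n : ℕ) : Measurable (joinPartition g P n) :=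
  measurable_pi_lambda _ fun i => hP.comp (hg.iterate i)

lemma EReal.le_of_forall_pos_le_coe_add {x : EReal} {h : ℝ}
    (H : ∀ η : ℝ, 0 < η → x ≤ ((h + η : ℝ) : EReal)) : x ≤ (h : EReal) := by
  rw [← EReal.le_of_forall_lt_iff_le]
  intro z hz
  have := H (z - h) (by linarith [EReal.coe_lt_coe_iff.1 hz])
  rwa [add_sub_cancel] at this

lemma EReal.le_of_forall_pos_coe_sub_le {x : EReal} {h : ℝ}
    (H : ∀ η : ℝ, 0 < η → ((h - η : ℝ) : EReal) ≤ x) : (h : EReal) ≤ x := by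
  rw [← EReal.ge_of_forall_gt_iff_ge]
  intro z hz
  have := H (h - z) (by linarith [EReal.coe_lt_coe_iff.1 hz])
  rwa [sub_sub_cancel] at this

/-- The cell of a point in a small cover predicts the atom at time `i` unless the `i`-th iterate
misses the separated compacts, and by invariance this has small probability at every time. The
coding inequality turns this into an entropy bound with three errors of `η / 3`. -/
theorem metricEntropy_le {X : Type*} [MetricSpace X] [CompactSpace X] [MeasurableSpace X]
    [BorelSpace X] (μ : Measure X) [IsProbabilityMeasure μ] {g : X → X}
    (hg : MeasurePreserving g μ μ) {h : ℝ} (H : HasSmallCovers g h) :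
    metricEntropy μ g ≤ (h : EReal) := by
  refine iSup_le fun k => iSup_le fun P => iSup_le fun hP => ?_
  refine EReal.le_of_forall_pos_le_coe_add fun η hη => ?_
  have hk : 0 < k := by
    obtain ⟨x₀⟩ := μ.nonempty_of_neZero
    exact (Nat.zero_le _).trans_lt (P x₀).2
  -- Chosen so that the cost `-log (1 - ε)` per letter is exactly `η / 3`.
  set ε := 1 - Real.exp (-(η / 3)) with hε
  have hε0 : 0 < ε := by
    have : Real.exp (-(η / 3)) < 1 := by
      rw [← Real.exp_zero]; exact Real.exp_lt_exp.2 (by linarith)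
    linarith
  have hε1 : ε < 1 := by have := Real.exp_pos (-(η / 3)); linarith
  have hlog : -Real.log (1 - ε) = η / 3 := by rw [hε, sub_sub_cancel, Real.log_exp, neg_neg]
  set L := Real.log (k / ε)
  have hL0 : 0 ≤ L := Real.log_nonneg (by
    have hk1 : (1 : ℝ) ≤ k := Nat.one_le_cast.2 hk
    rw [le_div_iff₀ hε0]; linarith)
  -- With this bound on the probability of a miss, wrong guesses cost at most `η / 3` per letter;
  -- the `+ 1` covers the case `L = 0`.
  obtain ⟨K, δ, hδ, hKm, hKP, hKsep, hKμ⟩ :=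
    exists_separated_compacts μ hP (κ := η / (3 * (L + 1))) (by positivity)
  refine limsup_le_of_le (h := ?_)
  filter_upwards [H δ hδ (η / 3) (by linarith), eventually_gt_atTop 0] with n hn hn0
  obtain ⟨N, R, hR, hN, hRδ⟩ := hn
  classical
  -- The guess is an index whose compact set is met at time `i` by the cell `r`; separation makes it
  -- unique if it exists.
  let J : Fin n → Fin N → Fin k := fun i r =>
    if hj : ∃ j, ∃ x, R x = r ∧ g^[i] x ∈ K j then hj.choose else ⟨0, hk⟩
  have hJ : ∀ (i : Fin n) (x : X), joinPartition g P n x i ≠ J i (R x) →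
      x ∈ g^[i] ⁻¹' (⋃ j, K j)ᶜ := by
    intro i x hx hmem
    obtain ⟨j, hj⟩ := Set.mem_iUnion.1 hmem
    have hex : ∃ j, ∃ y, R y = R x ∧ g^[i] y ∈ K j := ⟨j, x, rfl, hj⟩
    apply hx
    have hJe : J i (R x) = hex.choose := dif_pos hex
    obtain ⟨y, hy, hyK⟩ := hex.choose_spec
    rw [hJe, hKsep _ _ _ hyK _ hj (hRδ y x hy i i.2)]
    exact hKP j _ hj
  have hmis : ∀ i : Fin n, μ.real {x | joinPartition g P n x i ≠ J i (R x)} ≤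
      η / (3 * (L + 1)) := by
    intro i
    refine (measureReal_mono (fun x hx => hJ i x hx) (measure_ne_top _ _)).trans ?_
    rwa [measureReal_def, (hg.iterate i).measure_preimage
      (MeasurableSet.iUnion hKm).compl.nullMeasurableSet]
  have hcode := partitionEntropy_le_of_code μ (measurable_joinPartition hg.measurable hP n) hR J
    hε0 hε1 hk
  have hsum : ∑ i : Fin n, μ.real {x | joinPartition g P n x i ≠ J i (R x)} ≤
      n * (η / (3 * (L + 1))) := by
    refine (Finset.sum_le_sum fun i _ => hmis i).trans ?_
    simp
  have hNpos : 0 < N := by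
    obtain ⟨x₀⟩ := μ.nonempty_of_neZero
    exact (Nat.zero_le _).trans_lt (R x₀).2
  have hlogN : Real.log N ≤ n * (h + η / 3) := by
    rw [Real.log_le_iff_le_exp (Nat.cast_pos.2 hNpos)]; exact hN
  have hLη : L * (η / (3 * (L + 1))) ≤ η / 3 := by
    rw [mul_div_assoc', div_le_div_iff₀ (by positivity) (by norm_num)]
    nlinarith
  have hn0' : (0 : ℝ) < n := Nat.cast_pos.2 hn0
  rw [EReal.coe_le_coe_iff, div_le_iff₀ hn0']
  rw [hlog] at hcode
  have h5 := mul_le_mul_of_nonneg_left hsum hL0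
  have h6 := mul_le_mul_of_nonneg_left hLη hn0'.le
  calc _ ≤ _ := hcode
    _ ≤ n * (h + η / 3) + n * (η / 3) + L * (n * (η / (3 * (L + 1)))) := by
      gcongr
    _ ≤ (h + η) * n := by linarith

/-- One point from each nonempty cell gives a dynamical cover. -/
theorem coverEntropy_le {X : Type*} [MetricSpace X] [MeasurableSpace X] {g : X → X} {h : ℝ}
    (H : HasSmallCovers g h) : Dynamics.coverEntropy g Set.univ ≤ (h : EReal) := by
  classical
  rw [Dynamics.coverEntropy_eq_iSup_basis Metric.uniformity_basis_dist]
  refine iSup₂_le fun δ hδ => EReal.le_of_forall_pos_le_coe_add fun η hη => ?_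
  refine Eventually.expGrowthSup_le ?_
  filter_upwards [H δ hδ η hη] with n hn
  obtain ⟨N, R, -, hN, hRδ⟩ := hn
  let s : Finset X := Finset.univ.image fun r : Set.range R => r.2.choose
  have hcov : Dynamics.IsDynCoverOf g Set.univ {p | dist p.1 p.2 < δ} n (s : Set X) := by
    intro x _
    have hr : R (⟨R x, x, rfl⟩ : Set.range R).2.choose = R x :=
      (⟨R x, x, rfl⟩ : Set.range R).2.choose_spec
    refine ⟨_, Finset.mem_coe.2 (Finset.mem_image_of_mem _ (Finset.mem_univ ⟨R x, x, rfl⟩)), ?_⟩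
    rw [Dynamics.mem_dynEntourage]
    exact fun i hi => hRδ _ _ hr.symm i hi
  have hcard : s.card ≤ N := by
    refine Finset.card_image_le.trans ?_
    rw [Finset.card_univ]
    exact (Fintype.card_subtype_le _).trans (by simp)
  have h1 : (Dynamics.coverMincard g Set.univ {p | dist p.1 p.2 < δ} n) ≤ (N : ℕ∞) :=
    hcov.coverMincard_le_card.trans (by exact_mod_cast hcard)
  have h2 := ENat.toENNReal_mono h1
  refine h2.trans ?_
  rw [← EReal.coe_natCast, ← EReal.coe_mul, EReal.exp_coe, mul_comm]
  rw [ENat.toENNReal_coe, ← ENNReal.ofReal_natCast]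
  exact ENNReal.ofReal_le_ofReal hN

/-! ### Lower bounds from small Bowen sets -/

/-- Sets of points of `F` with nearby orbits are exponentially small, at rate `h`. -/
def HasSmallBowenSets {X : Type*} [MetricSpace X] [MeasurableSpace X] (μ : Measure X) (F : Set X)
    (g : X → X) (h : ℝ) : Prop :=
  ∀ ε > 0, ∃ δ > 0, ∃ᶠ n : ℕ in atTop, 0 < n ∧ ∀ E ⊆ F, MeasurableSet E →
    (∀ x ∈ E, ∀ y ∈ E, ∀ i < n, dist (g^[i] x) (g^[i] y) < δ) →
    μ.real E ≤ Real.exp (-(n * (h - ε)))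

/-- Points are sorted by the nearest among finitely many members of a dense sequence whose `δ /
2`-balls cover `F`. -/
lemma exists_small_partition {X : Type*} [MetricSpace X] [MeasurableSpace X] [BorelSpace X]
    [TopologicalSpace.SeparableSpace X] [Nonempty X] {F : Set X} (hF : IsCompact F) {δ : ℝ}
    (hδ : 0 < δ) : ∃ (k : ℕ) (P : X → Fin k), Measurable P ∧
      ∀ x ∈ F, ∀ y ∈ F, P x = P y → dist x y < δ := by
  let e := TopologicalSpace.denseSeq X
  obtain ⟨t, ht⟩ := hF.elim_finite_subcover (fun n => Metric.ball (e n) (δ / 2))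
    (fun n => Metric.isOpen_ball) fun x _ => by
      obtain ⟨n, hn⟩ := Metric.denseRange_iff.1 (TopologicalSpace.denseRange_denseSeq X) x (δ / 2)
        (by positivity)
      exact Set.mem_iUnion.2 ⟨n, hn⟩
  let N := t.sup id
  let I := SimpleFunc.nearestPtInd e N
  have hI : ∀ x ∈ F, dist (e (I x)) x < δ / 2 := by
    intro x hx
    obtain ⟨n, hn, hxn⟩ := Set.mem_iUnion₂.1 (ht hx)
    have h1 := SimpleFunc.edist_nearestPt_le e x (Finset.le_sup (f := id) hn : n ≤ N)
    rw [edist_dist, edist_dist, ENNReal.ofReal_le_ofReal_iff dist_nonneg] at h1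
    refine lt_of_le_of_lt h1 ?_
    rw [dist_comm]; exact hxn
  refine ⟨N + 1, fun x => Fin.ofNat (N + 1) (I x),
    (Measurable.of_discrete (f := Fin.ofNat (N + 1))).comp I.measurable, fun x hx y hy hxy => ?_⟩
  have hxy' : I x = I y := by
    have := congrArg Fin.val hxy
    change I x % (N + 1) = I y % (N + 1) at this
    rwa [Nat.mod_eq_of_lt (Nat.lt_succ_of_le (SimpleFunc.nearestPtInd_le e N x)),
      Nat.mod_eq_of_lt (Nat.lt_succ_of_le (SimpleFunc.nearestPtInd_le e N y))] at this
  have h1 := hI x hx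
  have h2 := hI y hy
  rw [hxy'] at h1
  calc dist x y ≤ dist (e (I y)) x + dist (e (I y)) y := dist_triangle_left _ _ _
    _ < δ := by linarith

lemma le_partitionEntropy {X : Type*} [MeasurableSpace X] (μ : Measure X)
    [IsProbabilityMeasure μ] {ι : Type*} [Fintype ι] [MeasurableSpace ι]
    [MeasurableSingletonClass ι] {W : X → ι} (hW : Measurable W) {c : ℝ}
    (h : ∀ a, μ.real (W ⁻¹' {a}) ≤ Real.exp (-c)) : c ≤ partitionEntropy μ W := by
  have hp1 : ∑ a, μ.real (W ⁻¹' {a}) = 1 := by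
    have := sum_measureReal_mul μ hW fun _ => 1
    simpa using this
  calc c = ∑ a, μ.real (W ⁻¹' {a}) * c := by rw [← Finset.sum_mul, hp1, one_mul]
    _ ≤ partitionEntropy μ W := Finset.sum_le_sum fun a _ => ?_
  rcases (measureReal_nonneg (μ := μ) (s := W ⁻¹' {a})).eq_or_lt with h0 | h0
  · rw [← h0]; simp
  · have := (Real.log_le_iff_le_exp h0).2 (h a)
    rw [Real.negMulLog, neg_mul, ← mul_neg]
    exact mul_le_mul_of_nonneg_left (by linarith) h0.le

/-- For a partition that is `δ`-fine on `F`, the atoms of the `n`-fold join are Bowen sets inside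
`F`, so each carries information at least `n * (h - ε)`. Infinitely many `n` are enough for the
upper limit. -/
theorem le_metricEntropy {X : Type*} [MetricSpace X] [MeasurableSpace X] [BorelSpace X]
    [TopologicalSpace.SeparableSpace X] (μ : Measure X) [IsProbabilityMeasure μ] {F : Set X}
    (hF : IsCompact F) (hFμ : μ Fᶜ = 0) {g : X → X} (hg : Measurable g) (hgF : Set.MapsTo g F F)
    {h : ℝ} (H : HasSmallBowenSets μ F g h) : (h : EReal) ≤ metricEntropy μ g := by
  have := μ.nonempty_of_neZero
  refine EReal.le_of_forall_pos_coe_sub_le fun ε hε => ?_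
  obtain ⟨δ, hδ, hn⟩ := H ε hε
  obtain ⟨k, P, hP, hPδ⟩ := exists_small_partition hF hδ
  refine le_trans ?_ (le_iSup_of_le k (le_iSup_of_le P (le_iSup_of_le hP le_rfl)))
  refine le_limsup_of_frequently_le (hn.mono fun n hn => ?_)
  obtain ⟨hn0, hn⟩ := hn
  rw [EReal.coe_le_coe_iff, le_div_iff₀ (Nat.cast_pos.2 hn0), mul_comm]
  have hW := measurable_joinPartition hg hP n
  refine le_partitionEntropy μ hW fun a => ?_
  have h1 := hn (joinPartition g P n ⁻¹' {a} ∩ F) Set.inter_subset_right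
    ((hW (measurableSet_singleton a)).inter hF.isClosed.measurableSet) (by
      rintro x ⟨hx, hxF⟩ y ⟨hy, hyF⟩ i hi
      refine hPδ _ (hgF.iterate i hxF) _ (hgF.iterate i hyF) ?_
      exact congrFun ((hx : joinPartition g P n x = a).trans
        (hy : joinPartition g P n y = a).symm) ⟨i, hi⟩)
  rwa [measureReal_def, measure_inter_conull hFμ] at h1

/-- A volume count: dynamical balls of radius `δ / 2` are Bowen sets for `δ`, and those of a cover
must add up to measure one. -/
theorem le_coverEntropy {X : Type*} [MetricSpace X] [MeasurableSpace X] [BorelSpace X]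
    (μ : Measure X) [IsProbabilityMeasure μ] {F : Set X} (hF : MeasurableSet F)
    (hFμ : μ Fᶜ = 0) {g : X → X} (hg : Measurable g) {h : ℝ} (H : HasSmallBowenSets μ F g h) :
    (h : EReal) ≤ Dynamics.coverEntropy g F := by
  classical
  refine EReal.le_of_forall_pos_coe_sub_le fun ε hε => ?_
  obtain ⟨δ, hδ, hn⟩ := H ε hε
  refine le_trans ?_ (Dynamics.coverEntropyEntourage_le_coverEntropy g F
    (Metric.dist_mem_uniformity (half_pos hδ)))
  refine Frequently.le_expGrowthSup (hn.mono fun n hn => ?_)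
  obtain ⟨hn0, hn⟩ := hn
  rw [← EReal.coe_natCast, ← EReal.coe_mul, EReal.exp_coe]
  rcases eq_or_ne (Dynamics.coverMincard g F {p : X × X | dist p.1 p.2 < δ / 2} n) ⊤ with ht | ht
  · rw [ht]; simp
  obtain ⟨s, hs, hcard⟩ := (Dynamics.coverMincard_finite_iff g F _ n).1 (lt_top_iff_ne_top.2 ht)
  rw [← hcard, ENat.toENNReal_coe, ← ENNReal.ofReal_natCast]
  refine ENNReal.ofReal_le_ofReal ?_
  let B : X → Set X := fun y => F ∩ ⋂ i : Fin n, {x | dist (g^[i] x) (g^[i] y) < δ / 2}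
  have hB : ∀ y, μ.real (B y) ≤ Real.exp (-(n * (h - ε))) := by
    intro y
    refine hn _ Set.inter_subset_left (hF.inter (MeasurableSet.iInter fun i => ?_)) ?_
    · exact (hg.iterate i) (measurableSet_ball (x := g^[i] y) (ε := δ / 2))
    · rintro x ⟨-, hx⟩ z ⟨-, hz⟩ i hi
      have h1 : dist (g^[i] x) (g^[i] y) < δ / 2 := Set.mem_iInter.1 hx ⟨i, hi⟩
      have h2 : dist (g^[i] z) (g^[i] y) < δ / 2 := Set.mem_iInter.1 hz ⟨i, hi⟩
      calc _ ≤ dist (g^[i] x) (g^[i] y) + dist (g^[i] z) (g^[i] y) := dist_triangle_right _ _ _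
        _ < δ := by linarith
  have hsub : F ⊆ ⋃ y ∈ s, B y := by
    intro x hx
    obtain ⟨y, hy, hxy⟩ := hs hx
    rw [Dynamics.mem_dynEntourage] at hxy
    exact Set.mem_iUnion₂.2 ⟨y, hy, hx, Set.mem_iInter.2 fun i => hxy i i.2⟩
  have h1 : (1 : ℝ) ≤ s.card * Real.exp (-(n * (h - ε))) := by
    have hF1 : μ.real F = 1 := by
      rw [measureReal_def, (prob_compl_eq_zero_iff hF).1 hFμ]; rfl
    rw [← hF1]
    refine (measureReal_mono hsub (measure_ne_top _ _)).trans
      ((measureReal_biUnion_finset_le _ _).trans ?_)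
    refine (Finset.sum_le_sum fun y _ => hB y).trans ?_
    simp
  rw [Real.exp_neg, ← div_eq_mul_inv, one_le_div (Real.exp_pos _)] at h1
  rwa [mul_comm]

/-- Every partition of the factor pulls back to a partition whose joins have the same distribution.
-/
lemma metricEntropy_map_le {X Y : Type*} [MeasurableSpace X] [MeasurableSpace Y] {μ : Measure X}
    {ν : Measure Y} {φ : X → Y} (hφ : MeasurePreserving φ μ ν) {f : X → X} {g : Y → Y}
    (hg : Measurable g) (h : Function.Semiconj φ f g) : metricEntropy ν g ≤ metricEntropy μ f := by
  refine iSup_le fun k => iSup_le fun P => iSup_le fun hP => ?_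
  refine le_trans (le_of_eq ?_) (le_iSup_of_le k (le_iSup_of_le (P ∘ φ)
    (le_iSup_of_le (hP.comp hφ.measurable) le_rfl)))
  congr 1
  ext n
  congr 2
  refine Finset.sum_congr rfl fun a _ => ?_
  have hm := measurable_joinPartition hg hP n (measurableSet_singleton a)
  rw [measureReal_def, measureReal_def, ← hφ.measure_preimage hm.nullMeasurableSet,
    ← Set.preimage_comp]
  congr 4
  ext x i
  simp only [joinPartition, Function.comp_apply, (h.iterate_right _).eq]


/-! ### Growth of the powers of an integer matrix -/

/-- The linear lift of the action on the torus. -/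
def lact (A : Matrix (Fin 2) (Fin 2) ℤ) (y : Fin 2 → ℝ) : Fin 2 → ℝ :=
  fun i => A i 0 * y 0 + A i 1 * y 1

lemma proj_lact (A : Matrix (Fin 2) (Fin 2) ℤ) (y : Fin 2 → ℝ) :
    proj (lact A y) = tact A (proj y) := by
  funext i
  simp only [proj, lact, tact, AddCircle.coe_add, ← zsmul_eq_mul, AddCircle.coe_zsmul]

lemma lact_mul (A B : Matrix (Fin 2) (Fin 2) ℤ) (y : Fin 2 → ℝ) :
    lact (A * B) y = lact A (lact B y) := by
  funext i
  simp only [lact, Matrix.mul_apply, Fin.sum_univ_two]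
  push_cast; ring

lemma lact_one (y : Fin 2 → ℝ) : lact 1 y = y := by
  have h : ∀ i, lact 1 y i = y i := by
    rw [Fin.forall_fin_two]; simp [lact]
  exact funext h

lemma lact_sub (A : Matrix (Fin 2) (Fin 2) ℤ) (x y : Fin 2 → ℝ) :
    lact A (x - y) = lact A x - lact A y := by
  funext i; simp only [lact, Pi.sub_apply]; ring

lemma lact_add (A : Matrix (Fin 2) (Fin 2) ℤ) (x y : Fin 2 → ℝ) :
    lact A (x + y) = lact A x + lact A y := by
  funext i; simp only [lact, Pi.add_apply]; ring

/-- The sum of the absolute values of the entries. -/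
def entryNorm (A : Matrix (Fin 2) (Fin 2) ℤ) : ℝ :=
  |(A 0 0 : ℝ)| + |(A 0 1 : ℝ)| + |(A 1 0 : ℝ)| + |(A 1 1 : ℝ)|

lemma abs_entry_le (A : Matrix (Fin 2) (Fin 2) ℤ) (i j : Fin 2) : |(A i j : ℝ)| ≤ entryNorm A := by
  have h := fun i j => abs_nonneg (A i j : ℝ)
  have := h 0 0; have := h 0 1; have := h 1 0; have := h 1 1
  fin_cases i <;> fin_cases j <;> simp only [entryNorm, Fin.zero_eta, Fin.mk_one] <;> linarith

lemma abs_lact_le (A : Matrix (Fin 2) (Fin 2) ℤ) {y : Fin 2 → ℝ} {r : ℝ} (hy : ∀ j, |y j| ≤ r)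
    (i : Fin 2) : |lact A y i| ≤ entryNorm A * r := by
  have hr : 0 ≤ r := (abs_nonneg _).trans (hy 0)
  have h1 : |lact A y i| ≤ |(A i 0 : ℝ)| * r + |(A i 1 : ℝ)| * r := by
    refine (abs_add_le _ _).trans (add_le_add ?_ ?_) <;> rw [abs_mul]
    · exact mul_le_mul_of_nonneg_left (hy 0) (abs_nonneg _)
    · exact mul_le_mul_of_nonneg_left (hy 1) (abs_nonneg _)
  refine h1.trans ?_
  rw [← add_mul]
  refine mul_le_mul_of_nonneg_right ?_ hr
  have h := fun i j => abs_nonneg (A i j : ℝ)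
  have := h 0 0; have := h 0 1; have := h 1 0; have := h 1 1
  fin_cases i <;> simp only [entryNorm, Fin.zero_eta, Fin.mk_one] <;> linarith

lemma one_le_entryNorm (A : SL(2, ℤ)) : 1 ≤ entryNorm A.1 := by
  have hd : A.1 0 0 * A.1 1 1 - A.1 0 1 * A.1 1 0 = 1 := by rw [← Matrix.det_fin_two]; exact A.2
  have h : ∃ i j, A.1 i j ≠ 0 := by
    by_contra! h; simp [h] at hd
  obtain ⟨i, j, hij⟩ := h
  refine le_trans ?_ (abs_entry_le A.1 i j)
  have := Int.one_le_abs hij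
  exact_mod_cast this

section

attribute [local instance] Matrix.linftyOpNormedRing Matrix.linftyOpNormedAlgebra

lemma linftyOpNorm_bounds (A : Matrix (Fin 2) (Fin 2) ℤ) :
    ‖A.map (Int.cast : ℤ → ℂ)‖ ≤ entryNorm A ∧
      entryNorm A ≤ 2 * ‖A.map (Int.cast : ℤ → ℂ)‖ := by
  have e : ‖A.map (Int.cast : ℤ → ℂ)‖ =
      max (|(A 0 0 : ℝ)| + |(A 0 1 : ℝ)|) (|(A 1 0 : ℝ)| + |(A 1 1 : ℝ)|) := by
    rw [Matrix.linfty_opNorm_def]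
    have : (Finset.univ : Finset (Fin 2)) = {0, 1} := rfl
    rw [this, Finset.sup_insert, Finset.sup_singleton]
    simp only [← this, Fin.sum_univ_two]
    rw [NNReal.coe_max]
    simp [Int.norm_eq_abs]
  rw [e, entryNorm]
  have h := fun i j => abs_nonneg (A i j : ℝ)
  have := h 0 0; have := h 0 1; have := h 1 0; have := h 1 1
  constructor
  · apply max_le <;> linarith
  · have := le_max_left (|(A 0 0 : ℝ)| + |(A 0 1 : ℝ)|) (|(A 1 0 : ℝ)| + |(A 1 1 : ℝ)|)
    have := le_max_right (|(A 0 0 : ℝ)| + |(A 0 1 : ℝ)|) (|(A 1 0 : ℝ)| + |(A 1 1 : ℝ)|)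
    linarith

/-- Gelfand's formula for an operator norm equivalent to `entryNorm`. Integer matrices of
determinant one have `entryNorm` at least one, which keeps the spectral radius away from zero and
allows taking logarithms. -/
lemma tendsto_log_entryNorm_pow (A : SL(2, ℤ)) :
    Tendsto (fun n : ℕ => Real.log (entryNorm (A.1 ^ n)) / n) atTop (𝓝 (logSpectralRadius A)) := by
  set a : Matrix (Fin 2) (Fin 2) ℂ := A.1.map (Int.cast : ℤ → ℂ) with ha
  have hpow : ∀ n, (A.1 ^ n).map (Int.cast : ℤ → ℂ) = a ^ n := fun n =>
    Matrix.map_pow (f := Int.castRingHom ℂ) A.1 n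
  have hone : ∀ n, 1 ≤ entryNorm (A.1 ^ n) := fun n => one_le_entryNorm (A ^ n)
  have hb : ∀ n, 1 / 2 ≤ ‖a ^ n‖ ∧ ‖a ^ n‖ ≤ entryNorm (A.1 ^ n) ∧
      entryNorm (A.1 ^ n) ≤ 2 * ‖a ^ n‖ := fun n => by
    have := linftyOpNorm_bounds (A.1 ^ n)
    rw [hpow] at this
    exact ⟨by linarith [hone n], this⟩
  have hG := spectrum.pow_norm_pow_one_div_tendsto_nhds_spectralRadius a
  have hfin : spectralRadius ℂ a ≠ ∞ :=
    ((spectrum.spectralRadius_le_nnnorm a).trans_lt ENNReal.coe_lt_top).ne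
  have hG' : Tendsto (fun n : ℕ => ‖a ^ n‖ ^ (1 / n : ℝ)) atTop (𝓝 (spectralRadius ℂ a).toReal) := by
    refine ((ENNReal.tendsto_toReal hfin).comp hG).congr fun n => ?_
    exact ENNReal.toReal_ofReal (by positivity)
  have hpos : 0 < (spectralRadius ℂ a).toReal := by
    have : (1 / 2 : ℝ) ≤ (spectralRadius ℂ a).toReal := by
      refine ge_of_tendsto hG' ?_
      filter_upwards [eventually_ge_atTop 1] with n hn
      have hn' : (1 : ℝ) ≤ n := Nat.one_le_cast.2 hn
      calc (1 / 2 : ℝ) = (1 / 2 : ℝ) ^ (1 : ℝ) := (Real.rpow_one _).symm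
        _ ≤ (1 / 2 : ℝ) ^ (1 / n : ℝ) := by
          apply Real.rpow_le_rpow_of_exponent_ge (by norm_num) (by norm_num)
          rw [div_le_one (by linarith)]; exact hn'
        _ ≤ _ := Real.rpow_le_rpow (by norm_num) (hb n).1 (by positivity)
    linarith
  have hL : Tendsto (fun n : ℕ => Real.log ‖a ^ n‖ / n) atTop (𝓝 (logSpectralRadius A)) := by
    refine ((Real.continuousAt_log hpos.ne').tendsto.comp hG').congr fun n => ?_
    have : 0 < ‖a ^ n‖ := by linarith [(hb n).1]
    simp only [Function.comp]
    rw [Real.log_rpow this]; ring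
  have hL2 : Tendsto (fun n : ℕ => Real.log 2 / n + Real.log ‖a ^ n‖ / n) atTop
      (𝓝 (logSpectralRadius A)) := by
    simpa using (tendsto_const_div_atTop_nhds_zero_nat (Real.log 2)).add hL
  refine tendsto_of_tendsto_of_tendsto_of_le_of_le hL hL2 (fun n => ?_) (fun n => ?_)
  · have : 0 < ‖a ^ n‖ := by linarith [(hb n).1]
    exact div_le_div_of_nonneg_right (Real.log_le_log this (hb n).2.1) (Nat.cast_nonneg n)
  · have h0 : 0 < ‖a ^ n‖ := by linarith [(hb n).1]
    simp only []
    rw [← add_div, ← Real.log_mul (by norm_num) h0.ne']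
    exact div_le_div_of_nonneg_right (Real.log_le_log (by linarith [hone n]) (hb n).2.2)
      (Nat.cast_nonneg n)

end

lemma logSpectralRadius_nonneg (A : SL(2, ℤ)) : 0 ≤ logSpectralRadius A :=
  ge_of_tendsto' (tendsto_log_entryNorm_pow A) fun n =>
    div_nonneg (Real.log_nonneg (one_le_entryNorm (A ^ n))) (Nat.cast_nonneg n)

/-- Trace `l + l⁻¹` and determinant `1` factor the characteristic polynomial as `(k - l) * (k -
l⁻¹)`. -/
lemma logSpectralRadius_eq (A : SL(2, ℤ)) {l : ℝ} (hl : 1 ≤ |l|)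
    (htr : l + l⁻¹ = ((A.1 0 0 + A.1 1 1 : ℤ) : ℝ)) : logSpectralRadius A = Real.log |l| := by
  have hl0 : l ≠ 0 := by rintro rfl; simp at hl; linarith
  have hlc : (l : ℂ) ≠ 0 := Complex.ofReal_ne_zero.2 hl0
  set a : Matrix (Fin 2) (Fin 2) ℂ := A.1.map (Int.cast : ℤ → ℂ) with ha
  have hd : A.1 0 0 * A.1 1 1 - A.1 0 1 * A.1 1 0 = 1 := by rw [← Matrix.det_fin_two]; exact A.2
  have hd' : (A.1 0 0 : ℂ) * A.1 1 1 - A.1 0 1 * A.1 1 0 = 1 := by exact_mod_cast hd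
  have htr' : (l : ℂ) + (l : ℂ)⁻¹ = (A.1 0 0 : ℂ) + A.1 1 1 := by
    have := congrArg (Complex.ofReal) htr
    push_cast at this; exact this
  have hmem : ∀ k : ℂ, k ∈ spectrum ℂ a ↔ k = l ∨ k = (l : ℂ)⁻¹ := by
    intro k
    rw [spectrum.mem_iff, Matrix.isUnit_iff_isUnit_det, isUnit_iff_ne_zero, not_not,
      Matrix.det_fin_two]
    have e : (algebraMap ℂ (Matrix (Fin 2) (Fin 2) ℂ) k - a) 0 0 *
        (algebraMap ℂ (Matrix (Fin 2) (Fin 2) ℂ) k - a) 1 1 -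
        (algebraMap ℂ (Matrix (Fin 2) (Fin 2) ℂ) k - a) 0 1 *
        (algebraMap ℂ (Matrix (Fin 2) (Fin 2) ℂ) k - a) 1 0 = (k - l) * (k - (l : ℂ)⁻¹) := by
      simp only [Matrix.sub_apply, Matrix.algebraMap_matrix_apply, ha, Matrix.map_apply]
      simp only [if_true, Algebra.algebraMap_self, RingHom.id_apply, Fin.isValue,
        zero_ne_one, one_ne_zero, if_false]
      have h1 : (l : ℂ) * (l : ℂ)⁻¹ = 1 := mul_inv_cancel₀ hlc
      linear_combination k * htr' - h1 + hd'
    rw [e, mul_eq_zero, sub_eq_zero, sub_eq_zero]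
  have hr : spectralRadius ℂ a = (‖(l : ℂ)‖₊ : ℝ≥0∞) := by
    apply le_antisymm
    · refine iSup₂_le fun k hk => ?_
      rcases (hmem k).1 hk with rfl | rfl
      · exact le_rfl
      · rw [ENNReal.coe_le_coe, ← NNReal.coe_le_coe, coe_nnnorm, coe_nnnorm, norm_inv,
          Complex.norm_real, Real.norm_eq_abs]
        exact (inv_le_one_of_one_le₀ hl).trans hl
    · exact le_iSup₂_of_le (l : ℂ) ((hmem _).2 (Or.inl rfl)) le_rfl
  rw [logSpectralRadius, ← ha, hr]
  simp

/-- A real eigenvalue of modulus at least one. -/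
lemma exists_eigenvalue {t : ℝ} (ht : 2 ≤ |t|) : ∃ l : ℝ, 1 ≤ |l| ∧ l + l⁻¹ = t ∧
    |t| / 2 ≤ |l| ∧ |l| ≤ |t| ∧ (2 < |t| → 1 < |l|) := by
  have key : ∀ s : ℝ, 2 ≤ s → ∃ l : ℝ, 1 ≤ l ∧ l + l⁻¹ = s ∧ s / 2 ≤ l ∧ l ≤ s ∧ (2 < s → 1 < l) := by
    intro s hs
    have hq : 0 ≤ s ^ 2 - 4 := by nlinarith
    have h1 := Real.sqrt_nonneg (s ^ 2 - 4)
    have h2 := Real.sq_sqrt hq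
    have h3 : √(s ^ 2 - 4) ≤ s := Real.sqrt_le_iff.2 ⟨by linarith, by linarith⟩
    refine ⟨(s + √(s ^ 2 - 4)) / 2, by linarith, ?_, by linarith, by linarith, fun h => by linarith⟩
    have : ((s + √(s ^ 2 - 4)) / 2)⁻¹ = (s - √(s ^ 2 - 4)) / 2 := by
      apply inv_eq_of_mul_eq_one_left; nlinarith
    rw [this]; ring
  obtain ⟨l, h1, h2, h3, h4, h5⟩ := key |t| ht
  have hl : |l| = l := abs_of_pos (by linarith)
  rcases abs_choice t with h | h
  · exact ⟨l, by rwa [hl], by rw [h2, h], by rwa [hl], by rwa [hl], by rwa [hl]⟩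
  · refine ⟨-l, by rwa [abs_neg, hl], ?_, by rwa [abs_neg, hl], by rwa [abs_neg, hl], by rwa [abs_neg, hl]⟩
    rw [inv_neg]; linarith

/-! ### Upper bound for the entropy -/

/-- The cells are the level sets of the pair of integer parts. -/
lemma exists_grid {X : Type*} [MeasurableSpace X] {u v : X → ℝ} (hu : Measurable u)
    (hv : Measurable v) {U V : ℝ} (hU : ∀ x, |u x| ≤ U) (hV : ∀ x, |v x| ≤ V) (hU0 : 0 ≤ U)
    (hV0 : 0 ≤ V) :
    ∃ (N : ℕ) (R : X → Fin N), Measurable R ∧ (N : ℝ) ≤ (2 * U + 3) * (2 * V + 3) ∧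
      ∀ x y, R x = R y → |u x - u y| < 1 ∧ |v x - v y| < 1 := by
  have key : ∀ {w : X → ℝ} {W : ℝ}, Measurable w → (∀ x, |w x| ≤ W) → 0 ≤ W →
      ∃ (N : ℕ) (R : X → Fin N), Measurable R ∧ (N : ℝ) ≤ 2 * W + 3 ∧
        ∀ x y, R x = R y → |w x - w y| < 1 := by
    intro w W hw hW hW0
    have hc := Nat.le_ceil W
    have hf : ∀ x, 0 ≤ ⌊w x⌋ + (⌈W⌉₊ : ℤ) ∧ ⌊w x⌋ + (⌈W⌉₊ : ℤ) < 2 * ⌈W⌉₊ + 1 := fun x => by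
      have := abs_le.1 (hW x)
      constructor
      · have : (-(⌈W⌉₊ : ℤ)) ≤ ⌊w x⌋ := Int.le_floor.2 (by push_cast; linarith)
        linarith
      · have : ⌊w x⌋ < (⌈W⌉₊ : ℤ) + 1 := Int.floor_lt.2 (by push_cast; linarith)
        linarith
    refine ⟨2 * ⌈W⌉₊ + 1, fun x => ⟨(⌊w x⌋ + (⌈W⌉₊ : ℤ)).toNat, ?_⟩, ?_, ?_, ?_⟩
    · have := hf x; omega
    · have h1 : Measurable fun x => (⌊w x⌋ + (⌈W⌉₊ : ℤ)).toNat :=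
        (Measurable.of_discrete (f := fun z : ℤ => (z + (⌈W⌉₊ : ℤ)).toNat)).comp hw.floor
      refine measurable_to_countable' fun j => ?_
      have : (fun x => (⟨(⌊w x⌋ + (⌈W⌉₊ : ℤ)).toNat, by have := hf x; omega⟩ :
          Fin (2 * ⌈W⌉₊ + 1))) ⁻¹' {j} = (fun x => (⌊w x⌋ + (⌈W⌉₊ : ℤ)).toNat) ⁻¹' {j.1} := by
        ext x; simp [Fin.ext_iff]
      rw [this]
      exact h1 (measurableSet_singleton _)
    · push_cast
      have := Nat.ceil_lt_add_one hW0
      linarith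
    · intro x y hxy
      have h1 := congrArg Fin.val hxy
      simp only at h1
      have := hf x; have := hf y
      exact Int.abs_sub_lt_one_of_floor_eq_floor (by omega)
  obtain ⟨N, R, hR, hN, h⟩ := key hu hU hU0
  obtain ⟨N', R', hR', hN', h'⟩ := key hv hV hV0
  refine ⟨N * N', fun x => finProdFinEquiv (R x, R' x),
    (Measurable.of_discrete (f := finProdFinEquiv)).comp (hR.prodMk hR'), ?_, ?_⟩
  · push_cast
    exact mul_le_mul hN hN' (Nat.cast_nonneg _) (by linarith)
  · intro x y hxy
    have := finProdFinEquiv.injective hxy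
    rw [Prod.mk.injEq] at this
    exact ⟨h x y this.1, h' x y this.2⟩

lemma exists_measurable_section : ∃ s : Torus → Fin 2 → ℝ, Measurable s ∧ (∀ t, proj (s t) = t) ∧
    ∀ t i, |s t i| ≤ 1 / 2 := by
  refine ⟨fun t i => (AddCircle.measurableEquivIoc (1 : ℝ) (-1 / 2) (t i) : ℝ), ?_, ?_, ?_⟩
  · refine measurable_pi_lambda _ fun i => ?_
    exact measurable_subtype_coe.comp
      ((AddCircle.measurableEquivIoc (1 : ℝ) (-1 / 2)).measurable.comp (measurable_pi_apply i))
  · intro t; funext i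
    exact AddCircle.coe_equivIoc
  · intro t i
    have := (AddCircle.measurableEquivIoc (1 : ℝ) (-1 / 2) (t i)).2
    rw [Set.mem_Ioc] at this
    rw [abs_le]; constructor <;> linarith

lemma dist_tact_lt {A : Matrix (Fin 2) (Fin 2) ℤ} {x y : Fin 2 → ℝ} {δ : ℝ} (hδ : 0 < δ)
    (h : ∀ j, |lact A (x - y) j| < δ) : dist (tact A (proj x)) (tact A (proj y)) < δ := by
  rw [← proj_lact, ← proj_lact, dist_eq_norm, ← proj_sub, ← lact_sub, pi_norm_lt_iff hδ]
  intro j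
  refine lt_of_le_of_lt ?_ (h j)
  exact (QuotientAddGroup.norm_mk_le_norm (S := AddSubgroup.zmultiples (1 : ℝ))).trans_eq
    (Real.norm_eq_abs _)

/-- Points are lifted to the fundamental square, which is cut into parallelograms by two linear
forms. The difference of two lifts is followed in the plane, and distances can only shrink under
projection. -/
lemma exists_small_cover (A : Matrix (Fin 2) (Fin 2) ℤ) {p q p' q' U V δ : ℝ} (hδ : 0 < δ)
    (hU : |p| + |q| ≤ U) (hV : |p'| + |q'| ≤ V) (n : ℕ)
    (h : ∀ d : Fin 2 → ℝ, |p * d 0 + q * d 1| < 1 → |p' * d 0 + q' * d 1| < 1 →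
      ∀ i < n, ∀ j, |lact (A ^ i) d j| < δ) :
    ∃ (N : ℕ) (R : Torus → Fin N), Measurable R ∧ (N : ℝ) ≤ (2 * U + 3) * (2 * V + 3) ∧
      ∀ x y, R x = R y → ∀ i < n, dist ((tact A)^[i] x) ((tact A)^[i] y) < δ := by
  obtain ⟨s, hs, hps, hb⟩ := exists_measurable_section
  have hm : ∀ p q : ℝ, Measurable fun t => p * s t 0 + q * s t 1 := fun p q =>
    (((measurable_pi_apply 0).comp hs).const_mul p).add
      (((measurable_pi_apply 1).comp hs).const_mul q)
  have hbd : ∀ {p q U : ℝ}, |p| + |q| ≤ U → ∀ t, |p * s t 0 + q * s t 1| ≤ U := by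
    intro p q U hU t
    refine (abs_add_le _ _).trans ?_
    rw [abs_mul, abs_mul]
    have h0 := hb t 0; have h1 := hb t 1
    nlinarith [abs_nonneg p, abs_nonneg q, abs_nonneg (s t 0), abs_nonneg (s t 1)]
  have h0 : ∀ {p q U : ℝ}, |p| + |q| ≤ U → 0 ≤ U := fun h => le_trans (by positivity) h
  obtain ⟨N, R, hR, hN, hRR⟩ := exists_grid (hm p q) (hm p' q') (hbd hU) (hbd hV) (h0 hU) (h0 hV)
  refine ⟨N, R, hR, hN, fun x y hxy i hi => ?_⟩
  obtain ⟨h1, h2⟩ := hRR x y hxy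
  rw [tact_iterate, tact_iterate]
  conv_lhs => rw [← hps x, ← hps y]
  refine dist_tact_lt hδ (h (s x - s y) ?_ ?_ i hi)
  · rw [Pi.sub_apply, Pi.sub_apply]; convert h1 using 2; ring
  · rw [Pi.sub_apply, Pi.sub_apply]; convert h2 using 2; ring

lemma eventually_le_exp (K : ℝ) {ε : ℝ} (hε : 0 < ε) : ∀ᶠ n : ℕ in atTop, K ≤ Real.exp (n * ε) :=
  (Real.tendsto_exp_atTop.comp
    (tendsto_natCast_atTop_atTop.atTop_mul_const hε)).eventually_ge_atTop K

lemma exists_entryNorm_pow_le (A : SL(2, ℤ)) {h : ℝ} (hh : logSpectralRadius A < h) :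
    ∃ B : ℝ, 1 ≤ B ∧ ∀ n : ℕ, entryNorm (A.1 ^ n) ≤ B * Real.exp (n * h) := by
  have hh0 : 0 ≤ h := (logSpectralRadius_nonneg A).trans hh.le
  obtain ⟨n₀, hn₀⟩ := eventually_atTop.1
    ((tendsto_log_entryNorm_pow A).eventually_lt_const hh)
  have hone : ∀ n, 1 ≤ entryNorm (A.1 ^ n) := fun n => one_le_entryNorm (A ^ n)
  have hs : 0 ≤ ∑ i ∈ Finset.range (n₀ + 1), entryNorm (A.1 ^ i) :=
    Finset.sum_nonneg fun i _ => by linarith [hone i]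
  refine ⟨1 + ∑ i ∈ Finset.range (n₀ + 1), entryNorm (A.1 ^ i), by linarith, fun n => ?_⟩
  have he : 1 ≤ Real.exp (n * h) := Real.one_le_exp (by positivity)
  rcases le_or_gt n n₀ with hn | hn
  · have h1 : entryNorm (A.1 ^ n) ≤ ∑ i ∈ Finset.range (n₀ + 1), entryNorm (A.1 ^ i) :=
      Finset.single_le_sum (f := fun i => entryNorm (A.1 ^ i)) (fun i _ => by linarith [hone i])
        (Finset.mem_range.2 (by omega))
    nlinarith
  · have hn' : (0 : ℝ) < n := Nat.cast_pos.2 (by omega)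
    have h1 := (div_lt_iff₀ hn').1 (hn₀ n hn.le)
    rw [Real.log_lt_iff_lt_exp (by linarith [hone n]), mul_comm] at h1
    nlinarith

/-- This serves trace `±2`, which occurs along the paths. The powers grow more slowly than any
exponential, so square cells of side about `exp (-n * ε / 4)` suffice. Their two sides give `exp (n
* ε / 2)`, and the other half of `ε` absorbs the constants. -/
lemma hasSmallCovers_of_logSpectralRadius_eq_zero (A : SL(2, ℤ)) (h : logSpectralRadius A = 0) :
    HasSmallCovers (tact A.1) (logSpectralRadius A) := by
  intro δ hδ ε hε
  obtain ⟨B, hB, hBn⟩ := exists_entryNorm_pow_le A (h := ε / 4) (by rw [h]; positivity)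
  filter_upwards [eventually_le_exp ((2 * (B / δ) + 3) * (2 * (B / δ) + 3)) (half_pos hε)]
    with n hn
  set e := Real.exp (n * (ε / 4)) with he
  have he1 : 1 ≤ e := Real.one_le_exp (by positivity)
  have hp : 0 < B * e / δ := by positivity
  obtain ⟨N, R, hR, hN, hRR⟩ := exists_small_cover A.1 (p := B * e / δ) (q := 0) (p' := 0)
    (q' := B * e / δ) (U := B * e / δ) (V := B * e / δ) hδ (by simp [abs_of_pos hp])
    (by simp [abs_of_pos hp]) n (by
      intro d h0 h1 i hi j
      rw [zero_mul, add_zero, abs_mul, abs_of_pos hp] at h0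
      rw [zero_mul, zero_add, abs_mul, abs_of_pos hp] at h1
      set r := max |d 0| |d 1| with hr
      have hr1 : B * e / δ * r < 1 := by
        rcases max_choice |d 0| |d 1| with h | h <;> rw [hr, h] <;> assumption
      have hr0 : 0 ≤ r := (abs_nonneg _).trans (le_max_left _ _)
      have hQ : entryNorm (A.1 ^ i) ≤ B * e := by
        refine (hBn i).trans (mul_le_mul_of_nonneg_left (Real.exp_le_exp.2 ?_) (by linarith))
        exact mul_le_mul_of_nonneg_right (Nat.cast_le.2 hi.le) (by linarith)
      have hj : ∀ j, |d j| ≤ r := by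
        rw [Fin.forall_fin_two]; exact ⟨le_max_left _ _, le_max_right _ _⟩
      refine (abs_lact_le _ hj j).trans_lt ((mul_le_mul_of_nonneg_right hQ hr0).trans_lt ?_)
      rwa [div_mul_eq_mul_div, div_lt_one hδ] at hr1)
  refine ⟨N, R, hR, hN.trans ?_, hRR⟩
  have h1 : 2 * (B * e / δ) + 3 ≤ e * (2 * (B / δ) + 3) := by
    rw [mul_div_right_comm]; nlinarith
  calc (2 * (B * e / δ) + 3) * (2 * (B * e / δ) + 3)
      ≤ (e * (2 * (B / δ) + 3)) * (e * (2 * (B / δ) + 3)) :=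
        mul_le_mul h1 h1 (by positivity) (by positivity)
    _ = e * e * ((2 * (B / δ) + 3) * (2 * (B / δ) + 3)) := by ring
    _ ≤ e * e * Real.exp (n * (ε / 2)) := mul_le_mul_of_nonneg_left hn (by positivity)
    _ = Real.exp (n * (logSpectralRadius A + ε)) := by
        rw [he, ← Real.exp_add, ← Real.exp_add, h]; congr 1; ring

/-- The row `(A 1 0, m - A 0 0)` is a left eigenvector of `A` for the eigenvalue `m`. -/
lemma eigenform_pow {A : Matrix (Fin 2) (Fin 2) ℤ} (hA : A.det = 1) {m : ℝ} (hm : m ≠ 0)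
    (htr : m + m⁻¹ = ((A 0 0 + A 1 1 : ℤ) : ℝ)) (d : Fin 2 → ℝ) (i : ℕ) :
    A 1 0 * lact (A ^ i) d 0 + (m - A 0 0) * lact (A ^ i) d 1 =
      m ^ i * (A 1 0 * d 0 + (m - A 0 0) * d 1) := by
  induction i with
  | zero => rw [pow_zero, lact_one, pow_zero, one_mul]
  | succ i ih =>
    rw [pow_succ', lact_mul, pow_succ', mul_assoc, ← ih]
    have hd : (A 0 0 : ℝ) * A 1 1 - A 0 1 * A 1 0 = 1 := by
      rw [Matrix.det_fin_two] at hA; exact_mod_cast hA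
    have h1 : m * m⁻¹ = 1 := mul_inv_cancel₀ hm
    push_cast at htr
    generalize lact (A ^ i) d = y
    simp only [lact]
    linear_combination -y 1 * hd - m * y 1 * htr + y 1 * h1

lemma hasSmallCovers_of_two_lt_abs_trace (A : SL(2, ℤ)) (h : 2 < |A.1 0 0 + A.1 1 1|) :
    HasSmallCovers (tact A.1) (logSpectralRadius A) := by
  have ht : 2 < |((A.1 0 0 + A.1 1 1 : ℤ) : ℝ)| := by exact_mod_cast h
  obtain ⟨l, hl1, hl, -, -, hl2⟩ := exists_eigenvalue ht.le
  replace hl2 := hl2 ht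
  have hl0 : l ≠ 0 := by rintro rfl; simp at hl2; linarith
  have hl' : l⁻¹ + l⁻¹⁻¹ = ((A.1 0 0 + A.1 1 1 : ℤ) : ℝ) := by rw [inv_inv, add_comm, hl]
  have hinv : |l⁻¹| ≤ 1 := by rw [abs_inv]; exact inv_le_one_of_one_le₀ hl1
  have hg : 0 < |l - l⁻¹| := by
    have := abs_sub_abs_le_abs_sub l l⁻¹
    linarith
  -- A triangular integer matrix of determinant one has trace `±2`, so this entry is a nonzero
  -- integer.
  have hc : 1 ≤ |(A.1 1 0 : ℝ)| := by
    have : A.1 1 0 ≠ 0 := by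
      intro h0
      have hd : A.1 0 0 * A.1 1 1 - A.1 0 1 * A.1 1 0 = 1 := by
        rw [← Matrix.det_fin_two]; exact A.2
      rw [h0, mul_zero, sub_zero] at hd
      rcases Int.mul_eq_one_iff_eq_one_or_neg_one.1 hd with ⟨h1, h2⟩ | ⟨h1, h2⟩ <;>
        rw [h1, h2] at h <;> norm_num at h
    exact_mod_cast Int.one_le_abs this
  rw [logSpectralRadius_eq A hl1 hl]
  intro δ hδ ε hε
  -- A vector is recovered from its two eigenforms: their difference is `(l - l⁻¹) * y 1`, and then
  -- either of them gives `y 0`. This `η` makes the recovered coordinates smaller than `δ`.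
  set η : ℝ := δ / (1 + (1 + |l - A.1 0 0|) * (2 / |l - l⁻¹|)) with hη
  have hη0 : 0 < η := by positivity
  have hrec : ∀ y : Fin 2 → ℝ, |A.1 1 0 * y 0 + (l - A.1 0 0) * y 1| < η →
      |A.1 1 0 * y 0 + (l⁻¹ - A.1 0 0) * y 1| < η → ∀ j, |y j| < δ := by
    intro y h1 h2
    have hδη : η + |l - A.1 0 0| * (2 * η / |l - l⁻¹|) + 2 * η / |l - l⁻¹| = δ := by
      have : δ = η * (1 + (1 + |l - A.1 0 0|) * (2 / |l - l⁻¹|)) := by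
        rw [hη, div_mul_cancel₀]; positivity
      rw [this]; ring
    have hp : 0 < 2 * η / |l - l⁻¹| := by positivity
    have hy1 : |y 1| < 2 * η / |l - l⁻¹| := by
      rw [lt_div_iff₀ hg, ← abs_mul]
      have : y 1 * (l - l⁻¹) = (A.1 1 0 * y 0 + (l - A.1 0 0) * y 1) -
        (A.1 1 0 * y 0 + (l⁻¹ - A.1 0 0) * y 1) := by ring
      rw [this]
      exact (abs_sub _ _).trans_lt (by linarith)
    have hla := abs_nonneg (l - A.1 0 0)
    rw [Fin.forall_fin_two]
    constructor
    · have h3 : |(A.1 1 0 : ℝ) * y 0| ≤ |A.1 1 0 * y 0 + (l - A.1 0 0) * y 1| +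
          |l - A.1 0 0| * |y 1| := by
        rw [← abs_mul]
        have : (A.1 1 0 : ℝ) * y 0 = (A.1 1 0 * y 0 + (l - A.1 0 0) * y 1) -
          (l - A.1 0 0) * y 1 := by ring
        conv_lhs => rw [this]
        exact abs_sub _ _
      rw [abs_mul] at h3
      have h4 : |y 0| ≤ |(A.1 1 0 : ℝ)| * |y 0| := le_mul_of_one_le_left (abs_nonneg _) hc
      have h5 := mul_le_mul_of_nonneg_left hy1.le hla
      linarith
    · have := mul_nonneg hla hp.le
      linarith
  set p : ℝ → ℝ := fun m => |(A.1 1 0 : ℝ)| + |m - A.1 0 0| with hp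
  have hp0 : ∀ m, 0 ≤ p m := fun m => by positivity
  filter_upwards [eventually_le_exp ((2 * (p l / η) + 3) * (2 * (p l⁻¹ / η) + 3)) hε] with n hn
  have hL : 1 ≤ |l| ^ n := one_le_pow₀ hl1
  have hk : 0 < |l| ^ n / η := by positivity
  have hk' : 0 < 1 / η := by positivity
  -- The expanding form must stay below `η` until time `n` and is cut `|l| ^ n` times finer; for the
  -- other form the initial mesh `η` is enough. Hence the number of cells is a constant times `|l| ^
  -- n`.
  obtain ⟨N, R, hR, hN, hRR⟩ := exists_small_cover A.1 (p := |l| ^ n / η * A.1 1 0)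
    (q := |l| ^ n / η * (l - A.1 0 0)) (p' := 1 / η * A.1 1 0)
    (q' := 1 / η * (l⁻¹ - A.1 0 0)) (U := |l| ^ n / η * p l) (V := 1 / η * p l⁻¹) hδ
    (by rw [abs_mul, abs_mul, abs_of_pos hk, ← mul_add])
    (by rw [abs_mul, abs_mul, abs_of_pos hk', ← mul_add]) n (by
      intro d h0 h1 i hi
      rw [mul_assoc, mul_assoc, ← mul_add, abs_mul, abs_of_pos hk, div_mul_eq_mul_div,
        div_lt_one hη0] at h0
      rw [mul_assoc, mul_assoc, ← mul_add, abs_mul, abs_of_pos hk', div_mul_eq_mul_div,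
        div_lt_one hη0, one_mul] at h1
      apply hrec
      · rw [eigenform_pow A.2 hl0 hl, abs_mul, abs_pow]
        refine lt_of_le_of_lt ?_ h0
        exact mul_le_mul_of_nonneg_right (pow_le_pow_right₀ hl1 hi.le) (abs_nonneg _)
      · rw [eigenform_pow A.2 (inv_ne_zero hl0) hl', abs_mul, abs_pow]
        refine lt_of_le_of_lt ?_ h1
        exact mul_le_of_le_one_left (abs_nonneg _) (pow_le_one₀ (abs_nonneg _) hinv))
  refine ⟨N, R, hR, hN.trans ?_, hRR⟩
  have h1 : 2 * (|l| ^ n / η * p l) + 3 ≤ |l| ^ n * (2 * (p l / η) + 3) := by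
    have : |l| ^ n / η * p l = |l| ^ n * (p l / η) := by ring
    rw [this]; linarith
  have h2 : 1 / η * p l⁻¹ = p l⁻¹ / η := by ring
  have h3 : 0 ≤ p l⁻¹ / η := div_nonneg (hp0 _) hη0.le
  calc (2 * (|l| ^ n / η * p l) + 3) * (2 * (1 / η * p l⁻¹) + 3)
      ≤ (|l| ^ n * (2 * (p l / η) + 3)) * (2 * (p l⁻¹ / η) + 3) := by
        rw [h2]; exact mul_le_mul_of_nonneg_right h1 (by linarith)
    _ = |l| ^ n * ((2 * (p l / η) + 3) * (2 * (p l⁻¹ / η) + 3)) := by ring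
    _ ≤ |l| ^ n * Real.exp (n * ε) := mul_le_mul_of_nonneg_left hn (by positivity)
    _ = Real.exp (n * (Real.log |l| + ε)) := by
        rw [mul_add, Real.exp_add, Real.exp_nat_mul (Real.log |l|), Real.exp_log (by linarith)]

lemma hasSmallCovers_tact (A : SL(2, ℤ)) (h : 2 ≤ |A.1 0 0 + A.1 1 1|) :
    HasSmallCovers (tact A.1) (logSpectralRadius A) := by
  rcases h.eq_or_lt with h | h
  · apply hasSmallCovers_of_logSpectralRadius_eq_zero
    rcases (abs_eq (by norm_num)).1 h.symm with h | h
    · rw [logSpectralRadius_eq A (l := 1) (by simp) (by rw [h]; norm_num)]; simp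
    · rw [logSpectralRadius_eq A (l := -1) (by simp) (by rw [h]; norm_num)]; simp
  · exact hasSmallCovers_of_two_lt_abs_trace A h

/-! ### Lower bound for the entropy -/

/-- A uniform form of `tau_eq_iff`: on the compact set of pairs that are `η`-far from both `s = t`
and `s = -t`, the distance of the images has a positive minimum. -/
lemma exists_dist_tau_lt {η : ℝ} (hη : 0 < η) :
    ∃ δ > 0, ∀ s t : Torus, dist (tau s) (tau t) < δ → ‖s - t‖ < η ∨ ‖s + t‖ < η := by
  set K : Set (Torus × Torus) := {p | η ≤ ‖p.1 - p.2‖ ∧ η ≤ ‖p.1 + p.2‖} with hK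
  have hKc : IsCompact K := by
    refine IsClosed.isCompact ?_
    exact (isClosed_le continuous_const (continuous_fst.sub continuous_snd).norm).inter
      (isClosed_le continuous_const (continuous_fst.add continuous_snd).norm)
  rcases K.eq_empty_or_nonempty with h | h
  · refine ⟨1, one_pos, fun s t _ => ?_⟩
    by_contra! h'
    exact (h ▸ Set.notMem_empty (s, t) : (s, t) ∉ K) h'
  · obtain ⟨⟨a, b⟩, hab, hmin⟩ := hKc.exists_isMinOn h
      ((continuous_tau.comp continuous_fst).dist (continuous_tau.comp continuous_snd)).continuousOn
    refine ⟨dist (tau a) (tau b), ?_, fun s t hst => ?_⟩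
    · refine dist_pos.2 fun h => ?_
      rcases tau_eq_iff.1 h with h | h
      · have := hab.1
        simp only [h, sub_self, norm_zero] at this
        linarith
      · have := hab.2
        simp only [h, neg_add_cancel, norm_zero] at this
        linarith
    · by_contra! h'
      have := isMinOn_iff.1 hmin (s, t) h'
      simp only [Function.comp_apply] at this
      linarith

lemma volume_small_strip_le {D : Matrix (Fin 2) (Fin 2) ℤ} (hD : 1 ≤ entryNorm D) {r : ℝ}
    (hr0 : 0 < r) (hr : r ≤ 1 / 4) :
    volume {y : Fin 2 → ℝ | (∀ i, |y i| ≤ r) ∧ ∀ i, |lact D y i| ≤ r} ≤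
      ENNReal.ofReal (entryNorm D)⁻¹ := by
  obtain ⟨i, j, hij⟩ : ∃ i j, entryNorm D / 4 ≤ |(D i j : ℝ)| := by
    by_contra! h
    have h1 := h 0 0; have h2 := h 0 1; have h3 := h 1 0; have h4 := h 1 1
    have : entryNorm D = |(D 0 0 : ℝ)| + |(D 0 1 : ℝ)| + |(D 1 0 : ℝ)| + |(D 1 1 : ℝ)| := rfl
    linarith
  -- The new variables are the `i`-th coordinate of the image and the original coordinate other than
  -- `j`, so the determinant is the large entry `D i j` up to sign.
  obtain ⟨M, hdet, hM⟩ : ∃ M : Matrix (Fin 2) (Fin 2) ℝ, |M.det| = |(D i j : ℝ)| ∧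
      ∀ y, M.mulVec y 0 = lact D y i ∧ ∃ j', M.mulVec y 1 = y j' := by
    rcases Fin.exists_fin_two.1 ⟨j, rfl⟩ with h | h
    · refine ⟨!![(D i 0 : ℝ), D i 1; 0, 1], ?_, fun y => ⟨?_, 1, ?_⟩⟩
      · rw [h, Matrix.det_fin_two_of]; simp
      · simp [Matrix.mulVec, dotProduct, Fin.sum_univ_two, lact]
      · simp [Matrix.mulVec, dotProduct, Fin.sum_univ_two]
    · refine ⟨!![(D i 0 : ℝ), D i 1; 1, 0], ?_, fun y => ⟨?_, 0, ?_⟩⟩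
      · rw [h, Matrix.det_fin_two_of]; simp
      · simp [Matrix.mulVec, dotProduct, Fin.sum_univ_two, lact]
      · simp [Matrix.mulVec, dotProduct, Fin.sum_univ_two]
  have hdet0 : 1 / 4 ≤ |M.det| := by rw [hdet]; linarith
  have hdne : M.det ≠ 0 := by
    intro h; rw [h, abs_zero] at hdet0; norm_num at hdet0
  have hsub : {y : Fin 2 → ℝ | (∀ i, |y i| ≤ r) ∧ ∀ i, |lact D y i| ≤ r} ⊆
      (fun y => M.mulVec y) ⁻¹' Metric.closedBall 0 r := by
    rintro y ⟨h1, h2⟩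
    rw [Set.mem_preimage, mem_closedBall_zero_iff, pi_norm_le_iff_of_nonneg hr0.le]
    obtain ⟨h3, j', h4⟩ := hM y
    rw [Fin.forall_fin_two, h3, h4]
    exact ⟨h2 i, h1 j'⟩
  refine (measure_mono hsub).trans ?_
  rw [volume_preimage_mulVec hdne, Real.volume_pi_closedBall _ hr0.le, ← ENNReal.ofReal_mul (abs_nonneg _)]
  apply ENNReal.ofReal_le_ofReal
  rw [abs_inv, hdet, Fintype.card_fin]
  have h1 : |(D i j : ℝ)|⁻¹ ≤ (entryNorm D / 4)⁻¹ := inv_anti₀ (by linarith) hij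
  calc |(D i j : ℝ)|⁻¹ * (2 * r) ^ 2 ≤ (entryNorm D / 4)⁻¹ * (1 / 4) :=
        mul_le_mul h1 (by nlinarith) (by positivity) (by positivity)
    _ = (entryNorm D)⁻¹ := by rw [inv_div]; ring

/-- A vector of size `r` has image of size at most `1 / 2`, where norm on the circle and absolute
value agree. By induction the smallness of the orbit on the torus therefore lifts to the plane, and
the first and last conditions cut out a thin strip. -/
lemma haarT_bowenBall_le {C : Matrix (Fin 2) (Fin 2) ℤ} {K : ℕ} (hK : 1 ≤ entryNorm (C ^ K))
    {r : ℝ} (hr0 : 0 < r) (hr : r ≤ 1 / 4) (hrC : entryNorm C * r ≤ 1 / 2) :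
    haarT {t | ∀ j : Fin (K + 1), ‖tact (C ^ (j : ℕ)) t‖ ≤ r} ≤
      ENNReal.ofReal (entryNorm (C ^ K))⁻¹ := by
  have hm : MeasurableSet {t | ∀ j : Fin (K + 1), ‖tact (C ^ (j : ℕ)) t‖ ≤ r} := by
    simp only [Set.ofPred_forall]
    exact MeasurableSet.iInter fun j =>
      (isClosed_le (continuous_tact _).norm continuous_const).measurableSet
  rw [haarT_apply hm]
  refine (measure_mono ?_).trans (volume_small_strip_le hK hr0 hr)
  rintro y ⟨hy, hyb⟩
  have hy' : ∀ j ≤ K, ∀ i, ‖((lact (C ^ j) y i : ℝ) : UnitAddCircle)‖ ≤ r := by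
    intro j hj i
    have h1 : ‖tact (C ^ j) (proj y)‖ ≤ r := hy ⟨j, by omega⟩
    rw [← proj_lact] at h1
    exact (norm_le_pi_norm (proj (lact (C ^ j) y)) i).trans h1
  have key : ∀ j ≤ K, ∀ i, |lact (C ^ j) y i| ≤ r := by
    intro j
    induction j with
    | zero =>
      intro h i
      have h1 := hy' 0 h i
      rw [pow_zero, lact_one] at h1 ⊢
      rwa [norm_coe_circle] at h1
      have := hyb i (Set.mem_univ i)
      rw [Set.mem_Ioc] at this
      rw [abs_le]; constructor <;> linarith
    | succ j ih =>
      intro h i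
      have h1 := hy' (j + 1) h i
      rwa [norm_coe_circle] at h1
      rw [pow_succ', lact_mul]
      exact (abs_lact_le C (ih (by omega)) i).trans hrC
  refine ⟨?_, key K le_rfl⟩
  have := key 0 (Nat.zero_le _)
  rwa [pow_zero, lact_one] at this

/-- At each of the `K + 1` times the orbit of a point of `S` is close to that of `t₀` or to that of
`-t₀`. For every pattern of signs the points following it lie in one translated Bowen ball of
doubled radius. -/
lemma haarT_preimage_tau_le {C : Matrix (Fin 2) (Fin 2) ℤ} {K : ℕ} (hK : 1 ≤ entryNorm (C ^ K))
    {η δ : ℝ} (hη0 : 0 < η) (hη : 2 * η ≤ 1 / 4) (hηC : entryNorm C * (2 * η) ≤ 1 / 2)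
    (hδ : ∀ s t : Torus, dist (tau s) (tau t) < δ → ‖s - t‖ < η ∨ ‖s + t‖ < η)
    {S : Set Torus} (hS : ∀ s ∈ S, ∀ t ∈ S, ∀ j ≤ K,
      dist (tau (tact (C ^ j) s)) (tau (tact (C ^ j) t)) < δ) :
    haarT S ≤ 2 ^ (K + 1) * ENNReal.ofReal (entryNorm (C ^ K))⁻¹ := by
  rcases S.eq_empty_or_nonempty with h | ⟨t₀, ht₀⟩
  · simp [h]
  let V : (Fin (K + 1) → Bool) → Set Torus := fun σ =>
    {t | ∀ j : Fin (K + 1), ‖tact (C ^ (j : ℕ)) (t - if σ j then t₀ else -t₀)‖ ≤ η}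
  have hcov : S ⊆ ⋃ σ, V σ := by
    intro t ht
    have h1 : ∀ j : Fin (K + 1), ∃ b : Bool,
        ‖tact (C ^ (j : ℕ)) (t - if b then t₀ else -t₀)‖ ≤ η := by
      intro j
      rcases hδ _ _ (hS t ht t₀ ht₀ j (by omega)) with h | h
      · exact ⟨true, by simpa [tact_sub] using h.le⟩
      · exact ⟨false, by simpa [tact_add] using h.le⟩
    choose σ hσ using h1
    exact Set.mem_iUnion.2 ⟨σ, hσ⟩
  have hV : ∀ σ, haarT (V σ) ≤ ENNReal.ofReal (entryNorm (C ^ K))⁻¹ := by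
    intro σ
    rcases (V σ).eq_empty_or_nonempty with h | ⟨t₁, ht₁⟩
    · simp [h]
    refine le_trans ?_ (haarT_bowenBall_le hK (by linarith : 0 < 2 * η) hη hηC)
    rw [← measure_preimage_add_right haarT (-t₁)
      {t | ∀ j : Fin (K + 1), ‖tact (C ^ (j : ℕ)) t‖ ≤ 2 * η}]
    refine measure_mono fun t ht => ?_
    intro j
    change ‖tact (C ^ (j : ℕ)) (t + -t₁)‖ ≤ 2 * η
    have e : t + -t₁ = (t - if σ j then t₀ else -t₀) - (t₁ - if σ j then t₀ else -t₀) := by abel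
    rw [e, tact_sub]
    refine (norm_sub_le _ _).trans ?_
    have := ht j; have := ht₁ j
    linarith
  refine (measure_mono hcov).trans ((measure_iUnion_fintype_le _ _).trans ?_)
  refine (Finset.sum_le_sum fun σ _ => hV σ).trans ?_
  simp

lemma IsTropicalAction.hasSmallBowenSets {Φ : GL (Fin 2) ℤ →* Equiv.Perm E3}
    (hΦ : IsTropicalAction Φ) (A : SL(2, ℤ)) :
    HasSmallBowenSets tetraMeasure tetra (Φ A) (logSpectralRadius A) := by
  intro ε hε
  set h := logSpectralRadius A with hh
  -- The orbit is observed at multiples of `m` only. The sign patterns then contribute `2 ^ (K + 1)`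
  -- over a time `m * K + 1`, a rate of at most about `ε / 3`.
  obtain ⟨m, hm⟩ := exists_nat_gt (3 / ε)
  have hm0 : 0 < m := Nat.cast_pos.1 (lt_trans (by positivity) hm)
  have hmε : 3 < m * ε := by rwa [div_lt_iff₀ hε] at hm
  have hsemi : Function.Semiconj tau (tact A.1) (Φ A) := hΦ.semiconj A
  set C := A.1 ^ m with hC
  have hone : ∀ n, 1 ≤ entryNorm (A.1 ^ n) := fun n => one_le_entryNorm (A ^ n)
  have hC1 : 1 ≤ entryNorm C := hone m
  -- Small enough that one step of `C` does not wrap around the torus, even at the doubled radius `2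
  -- * η`.
  set η : ℝ := 1 / (8 * entryNorm C) with hη
  have hη0 : 0 < η := by positivity
  have hηC : entryNorm C * (2 * η) = 1 / 4 := by rw [hη]; field_simp; norm_num
  obtain ⟨δ, hδ0, hδ⟩ := exists_dist_tau_lt hη0
  refine ⟨δ, hδ0, ?_⟩
  have hev : ∀ᶠ K : ℕ in atTop, 0 < m * K + 1 ∧ ∀ E ⊆ tetra, MeasurableSet E →
      (∀ x ∈ E, ∀ y ∈ E, ∀ i < m * K + 1, dist ((Φ A)^[i] x) ((Φ A)^[i] y) < δ) →
      tetraMeasure.real E ≤ Real.exp (-((m * K + 1 : ℕ) * (h - ε))) := by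
    have ht : Tendsto (fun K : ℕ => m * K) atTop atTop := tendsto_id.const_mul_atTop' hm0
    -- The requirement `h + 1 ≤ K` pays for the two surplus units, in the exponent `K + 1` and in
    -- the time `m * K + 1`.
    filter_upwards [ht.eventually ((tendsto_log_entryNorm_pow A).eventually_const_lt
      (show h - ε / 3 < h by linarith)), ht.eventually (eventually_ge_atTop 1),
      eventually_ge_atTop ⌈h + 1⌉₊] with K hK hK1 hKh
    refine ⟨by omega, fun E _ hE hdist => ?_⟩
    have hle : tetraMeasure E ≤ 2 ^ (K + 1) * ENNReal.ofReal (entryNorm (C ^ K))⁻¹ := by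
      rw [tetraMeasure_eq, Measure.map_apply continuous_tau.measurable hE]
      refine haarT_preimage_tau_le (by rw [hC, ← pow_mul]; exact hone _) hη0 (by nlinarith)
        (by linarith) hδ fun s hs t ht j hj => ?_
      have := hdist _ hs _ ht (m * j) (by have := Nat.mul_le_mul_left m hj; omega)
      rw [hC, ← pow_mul, ← tact_iterate, ← tact_iterate,
        (hsemi.iterate_right (m * j)).eq, (hsemi.iterate_right (m * j)).eq]
      exact this
    have hC0 : 0 < entryNorm (C ^ K) := by rw [hC, ← pow_mul]; linarith [hone (m * K)]
    have hle' : tetraMeasure.real E ≤ 2 ^ (K + 1) * (entryNorm (C ^ K))⁻¹ := by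
      refine ENNReal.toReal_le_of_le_ofReal (by positivity) (hle.trans_eq ?_)
      rw [ENNReal.ofReal_mul (by positivity), ENNReal.ofReal_pow (by norm_num)]
      norm_num
    refine hle'.trans ?_
    rw [← Real.log_le_iff_le_exp (by positivity), Real.log_mul (by positivity) (by positivity),
      Real.log_pow, Real.log_inv]
    have hmK : (0 : ℝ) < (m * K : ℕ) := Nat.cast_pos.2 hK1
    rw [lt_div_iff₀ hmK, pow_mul, ← hC] at hK
    have h2 : Real.log 2 ≤ 1 := by linarith [Real.log_two_lt_d9]
    have h3 : h + 1 ≤ K := (Nat.le_ceil _).trans (Nat.cast_le.2 hKh)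
    have h4 : (3 : ℝ) * K ≤ m * ε * K := mul_le_mul_of_nonneg_right hmε.le (Nat.cast_nonneg K)
    have h5 : ((K : ℝ) + 1) * Real.log 2 ≤ (K + 1) * 1 :=
      mul_le_mul_of_nonneg_left h2 (by positivity)
    push_cast at hK ⊢
    nlinarith
  have htend : Tendsto (fun K : ℕ => m * K + 1) atTop atTop :=
    (tendsto_add_atTop_nat 1).comp (tendsto_id.const_mul_atTop' hm0)
  exact htend.frequently hev.frequently

theorem IsTropicalAction.entropy_eq {Φ : GL (Fin 2) ℤ →* Equiv.Perm E3}
    (hΦ : IsTropicalAction Φ) (A : SL(2, ℤ)) (hA : 2 ≤ |A.1 0 0 + A.1 1 1|) :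
    metricEntropy tetraMeasure (Φ A) = (logSpectralRadius A : EReal) ∧
      Dynamics.coverEntropy (Φ A) tetra = (logSpectralRadius A : EReal) := by
  have hs := hΦ.semiconj A
  have hcov := hasSmallCovers_tact A hA
  have hB := hΦ.hasSmallBowenSets A
  have hmaps : Set.MapsTo (Φ A) tetra tetra := by
    intro x hx
    rw [← hΦ.image_tetra A]; exact Set.mem_image_of_mem _ hx
  refine ⟨le_antisymm ?_ (le_metricEntropy _ isCompact_tetra tetraMeasure_compl_tetra
    (hΦ.measurable A) hmaps hB), le_antisymm ?_ (le_coverEntropy tetraMeasure measurableSet_tetra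
    tetraMeasure_compl_tetra (hΦ.measurable A) hB)⟩
  · exact (metricEntropy_map_le measurePreserving_tau (hΦ.measurable A) hs).trans
      (metricEntropy_le haarT (measurePreserving_tact A) hcov)
  · rw [← range_tau, ← Set.image_univ]
    exact (Dynamics.coverEntropy_image_le_of_uniformContinuous hs
      (CompactSpace.uniformContinuous_of_continuous continuous_tau) _).trans (coverEntropy_le hcov)

/-! ### The Lyapunov exponent -/

/-- The slope is the sign of the representative nearest to zero, and `ρ` is its distance from the
two creases at norm `0` and `1 / 2`. -/
lemma exists_slope {x : ℝ} (h0 : 0 < ‖(x : UnitAddCircle)‖) (h1 : ‖(x : UnitAddCircle)‖ < 1 / 2) :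
    ∃ s : ℝ, |s| = 1 ∧ ∃ ρ > 0, ∀ d : ℝ, |d| < ρ →
      ‖((x + d : ℝ) : UnitAddCircle)‖ = ‖(x : UnitAddCircle)‖ + s * d := by
  obtain ⟨w, hw, hwn'⟩ := exists_coe_circle (x : UnitAddCircle)
  have hpos : 0 < |w| := hwn' ▸ h0
  refine ⟨w / |w|, by rw [abs_div, abs_abs, div_self hpos.ne'], min |w| (1 / 2 - |w|),
    lt_min hpos (by linarith), fun d hd => ?_⟩
  have hd1 := hd.trans_le (min_le_left _ _)
  have hd2 := hd.trans_le (min_le_right _ _)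
  rw [AddCircle.coe_add, ← hw, ← AddCircle.coe_add, norm_coe_circle, norm_coe_circle (by linarith)]
  · rcases abs_cases w with ⟨h, h'⟩ | ⟨h, h'⟩
    · rw [h] at hd1 hpos ⊢
      rw [div_self hpos.ne', abs_of_pos, one_mul]
      have := abs_lt.1 hd1; linarith
    · rw [h] at hd1 ⊢
      rw [div_neg, div_self (by linarith), abs_of_neg]
      · ring
      · have := abs_lt.1 hd1; linarith
  · exact (abs_add_le _ _).trans (by linarith)

/-- The differential of `tau ∘ proj`, with slopes `s` of the three coordinates. -/
def slopeMap (s : Fin 3 → ℝ) (d : Fin 2 → ℝ) : E3 := !₂[s 0 * d 0, s 1 * d 1, s 2 * (d 0 + d 1)]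

lemma exists_slopeMap {y : Fin 2 → ℝ} (hy : tau (proj y) ∈ openCube) :
    ∃ s : Fin 3 → ℝ, (∀ i, |s i| = 8) ∧ ∃ ρ > 0, ∀ d : Fin 2 → ℝ, (∀ i, |d i| < ρ) →
      tau (proj (y + d)) = tau (proj y) + slopeMap s d := by
  have hc : ∀ x : ℝ, |2 - 8 * ‖(x : UnitAddCircle)‖| < 2 →
      ∃ s : ℝ, |s| = 8 ∧ ∃ ρ > 0, ∀ d : ℝ, |d| < ρ →
      2 - 8 * ‖((x + d : ℝ) : UnitAddCircle)‖ = 2 - 8 * ‖(x : UnitAddCircle)‖ + s * d := by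
    intro x hx
    have := abs_lt.1 hx
    obtain ⟨s, hs, ρ, hρ, h⟩ := exists_slope (x := x) (by linarith) (by linarith)
    refine ⟨-8 * s, by rw [abs_mul, hs]; norm_num, ρ, hρ, fun d hd => ?_⟩
    rw [h d hd]; ring
  obtain ⟨s0, hs0, ρ0, hρ0, h0⟩ := hc (y 0) (hy 0)
  obtain ⟨s1, hs1, ρ1, hρ1, h1⟩ := hc (y 1) (hy 1)
  obtain ⟨s2, hs2, ρ2, hρ2, h2⟩ := hc (y 0 + y 1) (by rw [AddCircle.coe_add]; exact hy 2)
  refine ⟨![s0, s1, s2], ?_, min (min ρ0 ρ1) (ρ2 / 2), by positivity, fun d hd => ?_⟩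
  · intro i; fin_cases i <;> assumption
  · have e0 := h0 (d 0) ((hd 0).trans_le ((min_le_left _ _).trans (min_le_left _ _)))
    have e1 := h1 (d 1) ((hd 1).trans_le ((min_le_left _ _).trans (min_le_right _ _)))
    have e2 := h2 (d 0 + d 1) ((abs_add_le _ _).trans_lt (by
      have := (hd 0).trans_le (min_le_right _ _); have := (hd 1).trans_le (min_le_right _ _)
      linarith))
    ext i
    fin_cases i
    · exact e0
    · exact e1
    · have : y 0 + d 0 + (y 1 + d 1) = y 0 + y 1 + (d 0 + d 1) := by ring
      have e3 : tau (proj (y + d)) 2 = 2 - 8 * ‖((y 0 + d 0 + (y 1 + d 1) : ℝ) : UnitAddCircle)‖ := rfl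
      exact e3.trans (by rw [this]; exact e2)

/-- The differential of the action of `M` along the tetrahedron, between points with slopes `s`
and `s'`. -/
def diffMap (s s' : Fin 3 → ℝ) (M : Matrix (Fin 2) (Fin 2) ℤ) : E3 →L[ℝ] E3 :=
  LinearMap.toContinuousLinearMap
    { toFun := fun p => slopeMap s' (lact M ![p 0 / s 0, p 1 / s 1])
      map_add' := fun p q => by
        ext i; fin_cases i <;> simp [slopeMap, lact] <;> ring
      map_smul' := fun c p => by
        ext i; fin_cases i <;> simp [slopeMap, lact] <;> ring }

lemma diffMap_apply (s s' : Fin 3 → ℝ) (M : Matrix (Fin 2) (Fin 2) ℤ) (p : E3) :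
    diffMap s s' M p = slopeMap s' (lact M ![p 0 / s 0, p 1 / s 1]) := rfl

lemma diffMap_slopeMap {s s' : Fin 3 → ℝ} (hs : ∀ i, |s i| = 8) (M : Matrix (Fin 2) (Fin 2) ℤ)
    (d : Fin 2 → ℝ) : diffMap s s' M (slopeMap s d) = slopeMap s' (lact M d) := by
  have h : ∀ i, s i ≠ 0 := fun i h => by have := hs i; rw [h] at this; norm_num at this
  rw [diffMap_apply]
  congr 2
  funext i
  fin_cases i
  · exact mul_div_cancel_left₀ _ (h 0)
  · exact mul_div_cancel_left₀ _ (h 1)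

lemma E3.norm_le (p : E3) : ‖p‖ ≤ |p 0| + |p 1| + |p 2| := by
  rw [EuclideanSpace.norm_eq, Fin.sum_univ_three]
  simp only [Real.norm_eq_abs, sq_abs]
  have h0 := abs_nonneg (p 0); have h1 := abs_nonneg (p 1); have h2 := abs_nonneg (p 2)
  rw [Real.sqrt_le_iff]
  refine ⟨by positivity, ?_⟩
  rw [← sq_abs (p 0), ← sq_abs (p 1), ← sq_abs (p 2)]
  nlinarith [mul_nonneg h0 h1, mul_nonneg h0 h2, mul_nonneg h1 h2]

lemma E3.abs_apply_le (p : E3) (i : Fin 3) : |p i| ≤ ‖p‖ := by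
  rw [← Real.norm_eq_abs]; exact PiLp.norm_apply_le p i

lemma norm_diffMap_le {s s' : Fin 3 → ℝ} (hs : ∀ i, |s i| = 8) (hs' : ∀ i, |s' i| = 8)
    (M : Matrix (Fin 2) (Fin 2) ℤ) (p : E3) : ‖diffMap s s' M p‖ ≤ 4 * entryNorm M * ‖p‖ := by
  rw [diffMap_apply]
  set d : Fin 2 → ℝ := ![p 0 / s 0, p 1 / s 1] with hd
  have h0 : ∀ j, |d j| ≤ ‖p‖ / 8 := by
    rw [Fin.forall_fin_two]
    simp only [hd, Matrix.cons_val_zero, Matrix.cons_val_one, abs_div, hs]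
    exact ⟨div_le_div_of_nonneg_right (E3.abs_apply_le p 0) (by norm_num),
      div_le_div_of_nonneg_right (E3.abs_apply_le p 1) (by norm_num)⟩
  have h1 := abs_lact_le M h0 0
  have h2 := abs_lact_le M h0 1
  refine (E3.norm_le _).trans ?_
  have e0 : |slopeMap s' (lact M d) 0| = 8 * |lact M d 0| := by
    rw [← hs' 0, ← abs_mul]; rfl
  have e1 : |slopeMap s' (lact M d) 1| = 8 * |lact M d 1| := by
    rw [← hs' 1, ← abs_mul]; rfl
  have e2 : |slopeMap s' (lact M d) 2| = 8 * |lact M d 0 + lact M d 1| := by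
    rw [← hs' 2, ← abs_mul]; rfl
  rw [e0, e1, e2]
  have := abs_add_le (lact M d 0) (lact M d 1)
  linarith

/-- The test vector is the unit vector of a column that contains an entry of size at least
`entryNorm M / 4`. -/
lemma exists_norm_slopeMap_lact_ge {s s' : Fin 3 → ℝ} (hs : ∀ i, |s i| = 8)
    (hs' : ∀ i, |s' i| = 8) {M : Matrix (Fin 2) (Fin 2) ℤ} (hM : 1 ≤ entryNorm M) :
    ∃ d : Fin 2 → ℝ, 0 < ‖slopeMap s d‖ ∧
      entryNorm M / 8 * ‖slopeMap s d‖ ≤ ‖slopeMap s' (lact M d)‖ := by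
  obtain ⟨i, j, hij⟩ : ∃ i j, entryNorm M / 4 ≤ |(M i j : ℝ)| := by
    by_contra! h
    have h1 := h 0 0; have h2 := h 0 1; have h3 := h 1 0; have h4 := h 1 1
    have : entryNorm M = |(M 0 0 : ℝ)| + |(M 0 1 : ℝ)| + |(M 1 0 : ℝ)| + |(M 1 1 : ℝ)| := rfl
    linarith
  obtain ⟨d, hd0, hd1, hdM⟩ : ∃ d : Fin 2 → ℝ, |d 0| + |d 1| = 1 ∧ |d 0 + d 1| = 1 ∧
      lact M d i = M i j := by
    rcases Fin.exists_fin_two.1 ⟨j, rfl⟩ with rfl | rfl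
    · exact ⟨![1, 0], by simp, by simp, by simp [lact]⟩
    · exact ⟨![0, 1], by simp, by simp, by simp [lact]⟩
  have e0 : |slopeMap s d 0| = 8 * |d 0| := by rw [← hs 0, ← abs_mul]; rfl
  have e1 : |slopeMap s d 1| = 8 * |d 1| := by rw [← hs 1, ← abs_mul]; rfl
  have e2 : |slopeMap s d 2| = 8 * |d 0 + d 1| := by rw [← hs 2, ← abs_mul]; rfl
  refine ⟨d, ?_, ?_⟩
  · refine lt_of_lt_of_le ?_ (E3.abs_apply_le _ 2)
    rw [e2, hd1]; norm_num
  · have h1 : ‖slopeMap s d‖ ≤ 16 := by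
      refine (E3.norm_le _).trans ?_
      rw [e0, e1, e2, hd1]; linarith
    have h2 : 8 * |lact M d i| ≤ ‖slopeMap s' (lact M d)‖ := by
      rcases Fin.exists_fin_two.1 ⟨i, rfl⟩ with rfl | rfl
      · refine le_trans (le_of_eq ?_) (E3.abs_apply_le _ 0)
        rw [← hs' 0, ← abs_mul]; rfl
      · refine le_trans (le_of_eq ?_) (E3.abs_apply_le _ 1)
        rw [← hs' 1, ← abs_mul]; rfl
    rw [hdM] at h2
    nlinarith

/-- Nearby points of the tetrahedron have lifts near `y`, after a change of sign on the torus if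
necessary. -/
lemma exists_nhds_tetra {y : Fin 2 → ℝ} {ρ : ℝ} (hρ : 0 < ρ) :
    ∀ᶠ p in 𝓝[tetra] (tau (proj y)), ∃ d : Fin 2 → ℝ, (∀ i, |d i| < ρ) ∧
      tau (proj (y + d)) = p := by
  obtain ⟨δ, hδ, h⟩ := exists_dist_tau_lt hρ
  filter_upwards [self_mem_nhdsWithin, mem_nhdsWithin_of_mem_nhds (Metric.ball_mem_nhds _ hδ)]
    with p hp hpd
  obtain ⟨t, rfl⟩ := exists_tau_of_mem hp
  have key : ∀ t : Torus, ‖t - proj y‖ < ρ → ∃ d : Fin 2 → ℝ, (∀ i, |d i| < ρ) ∧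
      proj (y + d) = t := by
    intro t ht
    obtain ⟨d, hd, hdn⟩ := exists_proj (t - proj y)
    refine ⟨d, fun i => ?_, ?_⟩
    · rw [hdn]; exact (norm_le_pi_norm (t - proj y) i).trans_lt ht
    · rw [proj_add, hd]; abel
  rcases h _ _ (Metric.mem_ball.1 hpd) with h1 | h1
  · obtain ⟨d, hd, e⟩ := key t h1
    exact ⟨d, hd, by rw [e]⟩
  · obtain ⟨d, hd, e⟩ := key (-t) (by
      have e : -t - proj y = -(t + proj y) := by abel
      rwa [e, norm_neg])
    exact ⟨d, hd, by rw [e, tau_neg]⟩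

lemma slopeMap_mem_tangentConeAt {y : Fin 2 → ℝ} {s : Fin 3 → ℝ} {ρ : ℝ} (hρ : 0 < ρ)
    (h : ∀ d : Fin 2 → ℝ, (∀ i, |d i| < ρ) → tau (proj (y + d)) = tau (proj y) + slopeMap s d)
    (d : Fin 2 → ℝ) : slopeMap s d ∈ tangentConeAt ℝ tetra (tau (proj y)) := by
  refine mem_tangentConeAt_of_add_smul_mem (l := 𝓝[≠] (0 : ℝ)) (c := id) tendsto_id ?_
  have h1 : ∀ᶠ c : ℝ in 𝓝 0, ∀ i, |c * d i| < ρ := by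
    rw [eventually_all]
    intro i
    have : Tendsto (fun c : ℝ => |c * d i|) (𝓝 0) (𝓝 |0 * d i|) :=
      (continuous_abs.comp (continuous_id.mul continuous_const)).tendsto 0
    rw [zero_mul, abs_zero] at this
    exact this.eventually_lt_const hρ
  filter_upwards [eventually_nhdsWithin_of_eventually_nhds h1] with c hc
  have h2 := h (c • d) hc
  have h3 : slopeMap s (c • d) = c • slopeMap s d := by
    ext i; fin_cases i <;> simp [slopeMap] <;> ring
  rw [h3] at h2
  rw [id, ← h2]
  exact tau_mem _

/-- In charts that are affine at source and target, `g` coincides near the point with an affine map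
along the tetrahedron. -/
lemma hasFDerivWithinAt_of_semiconj {g : E3 → E3} {M : Matrix (Fin 2) (Fin 2) ℤ}
    (hg : ∀ t, g (tau t) = tau (tact M t)) {y : Fin 2 → ℝ} {s s' : Fin 3 → ℝ} {ρ ρ' : ℝ}
    (hρ : 0 < ρ) (hρ' : 0 < ρ') (hs8 : ∀ i, |s i| = 8)
    (hs : ∀ d : Fin 2 → ℝ, (∀ i, |d i| < ρ) → tau (proj (y + d)) = tau (proj y) + slopeMap s d)
    (hs' : ∀ d : Fin 2 → ℝ, (∀ i, |d i| < ρ') →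
      tau (proj (lact M y + d)) = tau (proj (lact M y)) + slopeMap s' d) :
    HasFDerivWithinAt g (diffMap s s' M) tetra (tau (proj y)) := by
  set x := tau (proj y) with hx
  have h1 : HasFDerivWithinAt (fun p => g x + diffMap s s' M (p - x)) (diffMap s s' M) tetra x := by
    have := ((diffMap s s' M).hasFDerivAt.comp x ((hasFDerivAt_id x).sub_const x)).const_add (g x)
    exact this.hasFDerivWithinAt
  refine h1.congr_of_eventuallyEq ?_ (by simp)
  set r := min ρ (ρ' / (1 + |entryNorm M|)) with hr
  have hr0 : 0 < r := lt_min hρ (by positivity)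
  filter_upwards [exists_nhds_tetra (y := y) hr0] with p hp
  obtain ⟨d, hd, rfl⟩ := hp
  have e1 := hs d fun i => (hd i).trans_le (min_le_left _ _)
  have e2 := hs' (lact M d) fun i => by
    refine (abs_lact_le M (fun j => (hd j).le) i).trans_lt ?_
    have h3 : (1 + |entryNorm M|) * r ≤ ρ' := by
      rw [mul_comm, ← le_div_iff₀ (by positivity)]; exact min_le_right _ _
    have := le_abs_self (entryNorm M)
    nlinarith
  rw [hg, ← proj_lact, lact_add, e2, e1, hx, hg, ← proj_lact, add_sub_cancel_left,
    diffMap_slopeMap hs8]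

lemma norm_diffMap_comp_subtypeL {x : E3} {s s' : Fin 3 → ℝ} (hs : ∀ i, |s i| = 8)
    (hs' : ∀ i, |s' i| = 8) {M : Matrix (Fin 2) (Fin 2) ℤ} (hM : 1 ≤ entryNorm M)
    (hx : ∀ d, slopeMap s d ∈ tangentConeAt ℝ tetra x) :
    entryNorm M / 8 ≤ ‖(diffMap s s' M).comp
        (Submodule.span ℝ (tangentConeAt ℝ tetra x)).subtypeL‖ ∧
      ‖(diffMap s s' M).comp (Submodule.span ℝ (tangentConeAt ℝ tetra x)).subtypeL‖ ≤
        4 * entryNorm M := by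
  constructor
  · obtain ⟨d, hd0, hd⟩ := exists_norm_slopeMap_lact_ge hs hs' hM
    have h1 := ((diffMap s s' M).comp
      (Submodule.span ℝ (tangentConeAt ℝ tetra x)).subtypeL).le_opNorm
        ⟨slopeMap s d, Submodule.subset_span (hx d)⟩
    have h2 : ((diffMap s s' M).comp (Submodule.span ℝ (tangentConeAt ℝ tetra x)).subtypeL)
        ⟨slopeMap s d, Submodule.subset_span (hx d)⟩ = slopeMap s' (lact M d) :=
      diffMap_slopeMap hs M d
    rw [h2] at h1
    exact le_of_mul_le_mul_right (hd.trans h1) hd0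
  · refine ContinuousLinearMap.opNorm_le_bound _ (by linarith) fun p => ?_
    exact norm_diffMap_le hs hs' M p

/-- By invariance of the measure almost every forward orbit avoids the edges altogether. All
iterates are then differentiable at the point, with tangential norms between `entryNorm (A ^ n) / 8`
and `4 * entryNorm (A ^ n)`. -/
theorem IsTropicalAction.hasLyapunovExponent {Φ : GL (Fin 2) ℤ →* Equiv.Perm E3}
    (hΦ : IsTropicalAction Φ) (A : SL(2, ℤ)) : HasLyapunovExponent (Φ A) (logSpectralRadius A) := by
  have hae : ∀ᵐ x ∂tetraMeasure, x ∈ openCube := by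
    rw [ae_iff]
    change tetraMeasure openCubeᶜ = 0
    rw [tetraMeasure_eq, Measure.map_apply continuous_tau.measurable measurableSet_openCube.compl]
    exact haarT_preimage_compl_openCube
  have hall : ∀ᵐ x ∂tetraMeasure, ∀ n : ℕ, (Φ A)^[n] x ∈ openCube :=
    ae_all_iff.2 fun n =>
      ((hΦ.measurePreserving A).iterate n).quasiMeasurePreserving.ae hae
  have htet : ∀ᵐ x ∂tetraMeasure, x ∈ tetra := by
    rw [ae_iff]; exact tetraMeasure_compl_tetra
  filter_upwards [hall, htet] with x hx hxt
  obtain ⟨t, rfl⟩ := exists_tau_of_mem hxt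
  obtain ⟨y, rfl⟩ := proj_surjective t
  have hsemi : Function.Semiconj tau (tact A.1) (Φ A) := hΦ.semiconj A
  have hg : ∀ (n : ℕ) t, (Φ A)^[n] (tau t) = tau (tact (A.1 ^ n) t) := fun n t => by
    rw [← tact_iterate]; exact ((hsemi.iterate_right n).eq t).symm
  have hloc : ∀ n : ℕ, ∃ s : Fin 3 → ℝ, (∀ i, |s i| = 8) ∧ ∃ ρ > 0, ∀ d : Fin 2 → ℝ,
      (∀ i, |d i| < ρ) →
      tau (proj (lact (A.1 ^ n) y + d)) = tau (proj (lact (A.1 ^ n) y)) + slopeMap s d := fun n => by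
    apply exists_slopeMap
    rw [proj_lact, ← hg]; exact hx n
  choose s hs ρ hρ hsρ using hloc
  have h0 := hsρ 0
  rw [pow_zero, lact_one] at h0
  have hone : ∀ n, 1 ≤ entryNorm (A.1 ^ n) := fun n => one_le_entryNorm (A ^ n)
  refine ⟨fun n => diffMap (s 0) (s n) (A.1 ^ n), fun n =>
    hasFDerivWithinAt_of_semiconj (hg n) (hρ 0) (hρ n) (hs 0) h0 (hsρ n), ?_⟩
  have hb := fun n => norm_diffMap_comp_subtypeL (hs 0) (hs n) (hone n)
    (slopeMap_mem_tangentConeAt (hρ 0) h0)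
  have hG := tendsto_log_entryNorm_pow A
  have h4 : Tendsto (fun n : ℕ => Real.log 4 / n + Real.log (entryNorm (A.1 ^ n)) / n) atTop
      (𝓝 (logSpectralRadius A)) := by
    simpa using (tendsto_const_div_atTop_nhds_zero_nat (Real.log 4)).add hG
  have h8 : Tendsto (fun n : ℕ => Real.log (entryNorm (A.1 ^ n)) / n - Real.log 8 / n) atTop
      (𝓝 (logSpectralRadius A)) := by
    simpa using hG.sub (tendsto_const_div_atTop_nhds_zero_nat (Real.log 8))
  refine tendsto_of_tendsto_of_tendsto_of_le_of_le h8 h4 (fun n => ?_) (fun n => ?_)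
  · have := hone n
    simp only []
    rw [← sub_div, ← Real.log_div (by linarith) (by norm_num)]
    exact div_le_div_of_nonneg_right (Real.log_le_log (by linarith) (hb n).1) (Nat.cast_nonneg n)
  · have := hone n
    simp only []
    rw [← add_div, ← Real.log_mul (by norm_num) (by linarith)]
    exact div_le_div_of_nonneg_right
      (Real.log_le_log (by linarith [(hb n).1]) (hb n).2) (Nat.cast_nonneg n)

/-! ### Ergodicity -/

/-- The Fourier coefficients of a function on the torus. -/
def torusCoeff (f : Torus → ℂ) (n : Fin 2 → ℤ) : ℂ :=
  ∫ t, UnitAddTorus.mFourier (-n) t * f t ∂haarT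

/-- The exponential monomials, as a Hilbert basis. -/
def torusBasis : HilbertBasis (Fin 2 → ℤ) ℂ (Lp ℂ 2 haarT) :=
  UnitAddTorus.mFourierBasis (d := Fin 2)

lemma coeFn_torusBasis (n : Fin 2 → ℤ) : torusBasis n =ᵐ[haarT] UnitAddTorus.mFourier n := by
  have h := UnitAddTorus.coeFn_mFourierLp (d := Fin 2) 2 n
  rw [← UnitAddTorus.coe_mFourierBasis] at h
  exact h

lemma torusBasis_repr {f : Torus → ℂ} (hf : MemLp f 2 haarT) (n : Fin 2 → ℤ) :
    torusBasis.repr (hf.toLp f) n = torusCoeff f n := by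
  refine (UnitAddTorus.mFourierBasis_repr (d := Fin 2) (hf.toLp f) n).trans ?_
  refine integral_congr_ae ?_
  filter_upwards [hf.coeFn_toLp] with t ht
  exact congrArg (UnitAddTorus.mFourier (-n) t * ·) ht

lemma torusCoeff_summable {f : Torus → ℂ} (hf : MemLp f 2 haarT) :
    Summable fun n => ‖torusCoeff f n‖ ^ 2 := by
  have h := (lp.memℓp (torusBasis.repr (hf.toLp f))).summable (by norm_num)
  refine h.congr fun n => ?_
  rw [torusBasis_repr hf]
  norm_num

lemma ae_eq_const_of_torusCoeff {f : Torus → ℂ} (hf : MemLp f 2 haarT)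
    (h0 : ∀ n ≠ 0, torusCoeff f n = 0) : ∃ c : ℂ, ∀ᵐ t ∂haarT, f t = c := by
  have h1 := (torusBasis.hasSum_repr (hf.toLp f)).unique (hasSum_single 0 fun n hn => by
    rw [torusBasis_repr hf, h0 n hn, zero_smul])
  rw [torusBasis_repr hf] at h1
  refine ⟨torusCoeff f 0, ?_⟩
  have h3 := Lp.coeFn_smul (torusCoeff f 0) (torusBasis 0)
  rw [← h1] at h3
  filter_upwards [hf.coeFn_toLp, coeFn_torusBasis 0, h3] with t e1 e2 e3
  rw [← e1, e3, Pi.smul_apply, e2, UnitAddTorus.mFourier_zero]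
  simp

lemma mFourier_tact (A : Matrix (Fin 2) (Fin 2) ℤ) (n : Fin 2 → ℤ) (t : Torus) :
    UnitAddTorus.mFourier n (tact A t) = UnitAddTorus.mFourier (A.transpose.mulVec n) t := by
  simp only [UnitAddTorus.mFourier, ContinuousMap.coe_mk, Fin.prod_univ_two, fourier_apply, tact,
    Matrix.mulVec, dotProduct, Fin.sum_univ_two, Matrix.transpose_apply, smul_add, add_smul,
    AddCircle.toCircle_add, smul_smul, Circle.coe_mul]
  rw [mul_comm (n 0) (A 0 0), mul_comm (n 0) (A 0 1), mul_comm (n 1) (A 1 0),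
    mul_comm (n 1) (A 1 1)]
  ring

/-- A change of variables: the matrix moves characters by its transpose. -/
lemma torusCoeff_mulVec (A : GL (Fin 2) ℤ) {f : Torus → ℂ} (hf : ∀ t, f (tact A.1 t) = f t)
    (hfm : Measurable f) (n : Fin 2 → ℤ) :
    torusCoeff f (A.1.transpose.mulVec n) = torusCoeff f n := by
  have hmp := measurePreserving_tact A
  have h : torusCoeff f n =
      ∫ t, UnitAddTorus.mFourier (-n) t * f t ∂(haarT.map (tact A.1)) := by
    rw [hmp.map_eq, torusCoeff]
  rw [h, integral_map hmp.measurable.aemeasurable]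
  · rw [torusCoeff]
    congr 1
    funext t
    rw [hf, mFourier_tact, Matrix.mulVec_neg]
  · exact ((UnitAddTorus.mFourier (-n)).continuous.measurable.mul hfm).aestronglyMeasurable

lemma lact_intCast (A : Matrix (Fin 2) (Fin 2) ℤ) (n : Fin 2 → ℤ) :
    lact A (fun i => (n i : ℝ)) = fun i => (A.mulVec n i : ℝ) := by
  funext i
  simp [lact, Matrix.mulVec, dotProduct, Fin.sum_univ_two]

/-- A nonzero integer vector has an infinite orbit under a hyperbolic matrix. -/
lemma injective_pow_mulVec {B : Matrix (Fin 2) (Fin 2) ℤ} (hB : B.det = 1)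
    (h : 2 < |B 0 0 + B 1 1|) {n : Fin 2 → ℤ} (hn : n ≠ 0) :
    Function.Injective fun k : ℕ => (B ^ k).mulVec n := by
  have ht : 2 < |((B 0 0 + B 1 1 : ℤ) : ℝ)| := by exact_mod_cast h
  obtain ⟨l, hl1, hl, -, -, hl2⟩ := exists_eigenvalue ht.le
  replace hl2 := hl2 ht
  have hl0 : l ≠ 0 := by rintro rfl; simp at hl2; linarith
  have hl' : l⁻¹ + l⁻¹⁻¹ = ((B 0 0 + B 1 1 : ℤ) : ℝ) := by rw [inv_inv, add_comm, hl]
  have hne : l - l⁻¹ ≠ 0 := by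
    intro h0
    have h1 : |l⁻¹| < 1 := by rw [abs_inv]; exact inv_lt_one_of_one_lt₀ hl2
    rw [← sub_eq_zero.1 h0] at h1
    linarith
  have hc : (B 1 0 : ℝ) ≠ 0 := by
    rw [Int.cast_ne_zero]
    intro h0
    rw [Matrix.det_fin_two, h0, mul_zero, sub_zero] at hB
    rcases Int.mul_eq_one_iff_eq_one_or_neg_one.1 hB with ⟨h1, h2⟩ | ⟨h1, h2⟩ <;>
      rw [h1, h2] at h <;> norm_num at h
  have hpow : ∀ {m : ℝ}, |m| ≠ 1 → m ≠ 0 → Function.Injective fun k : ℕ => m ^ k := by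
    intro m hm hm0 j k hjk
    have := congrArg abs hjk
    simp only [abs_pow] at this
    exact pow_right_injective₀ (abs_pos.2 hm0) hm this
  intro j k hjk
  simp only at hjk
  have hL : lact (B ^ j) (fun i => (n i : ℝ)) = lact (B ^ k) (fun i => (n i : ℝ)) := by
    rw [lact_intCast, lact_intCast, hjk]
  by_contra hne'
  -- A coincidence in the orbit makes both eigenforms vanish at `n`, since the powers of `l` and of
  -- `l⁻¹` are distinct; the two forms are independent.
  have hz : ∀ {m : ℝ}, |m| ≠ 1 → m ≠ 0 → m + m⁻¹ = ((B 0 0 + B 1 1 : ℤ) : ℝ) →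
      (B 1 0 * n 0 + (m - B 0 0) * n 1 : ℝ) = 0 := by
    intro m hm hm0 hm'
    have e1 := eigenform_pow hB hm0 hm' (fun i => (n i : ℝ)) j
    have e2 := eigenform_pow hB hm0 hm' (fun i => (n i : ℝ)) k
    rw [hL, e2] at e1
    by_contra h0
    exact hne' (hpow hm hm0 (mul_right_cancel₀ h0 e1)).symm
  have z1 := hz hl2.ne' hl0 hl
  have z2 := hz (by rw [abs_inv]; exact (inv_lt_one_of_one_lt₀ hl2).ne) (inv_ne_zero hl0) hl'
  have z3 : (l - l⁻¹) * n 1 = 0 := by linear_combination z1 - z2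
  have n1 : (n 1 : ℝ) = 0 := (mul_eq_zero.1 z3).resolve_left hne
  rw [n1, mul_zero, add_zero] at z1
  have n0 : (n 0 : ℝ) = 0 := (mul_eq_zero.1 z1).resolve_left hc
  apply hn
  have : ∀ i, n i = 0 := by
    rw [Fin.forall_fin_two]; exact ⟨by exact_mod_cast n0, by exact_mod_cast n1⟩
  exact funext this

/-- The Fourier coefficients of the indicator of an invariant set are square-summable and constant
along infinite orbits of nonzero frequencies, hence only the constant term survives. -/
lemma ergodic_tact (A : SL(2, ℤ)) (h : 2 < |A.1 0 0 + A.1 1 1|) :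
    Ergodic (tact A.1) haarT := by
  have hmp : MeasurePreserving (tact A.1) haarT haarT := measurePreserving_tact A
  refine ⟨hmp, ⟨fun s hs hsA => ?_⟩⟩
  rw [eventuallyConst_set']
  set f : Torus → ℂ := s.indicator fun _ => 1 with hf
  have hfm : Measurable f := measurable_const.indicator hs
  have hfL : MemLp f 2 haarT := (memLp_const 1).indicator hs
  have hfA : ∀ t, f (tact A.1 t) = f t := fun t => by
    have hiff : tact A.1 t ∈ s ↔ t ∈ s := by
      conv_rhs => rw [← hsA]
      rfl
    by_cases ht : t ∈ s
    · rw [hf, Set.indicator_of_mem ht, Set.indicator_of_mem (hiff.2 ht)]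
    · rw [hf, Set.indicator_of_notMem ht, Set.indicator_of_notMem (hiff.not.2 ht)]
  have hinv : ∀ n, torusCoeff f (A.1.transpose.mulVec n) = torusCoeff f n :=
    torusCoeff_mulVec A hfA hfm
  set B := A.1.transpose with hB
  have hiter : ∀ (k : ℕ) n, torusCoeff f ((B ^ k).mulVec n) = torusCoeff f n := by
    intro k
    induction k with
    | zero => intro n; rw [pow_zero, Matrix.one_mulVec]
    | succ k ih => intro n; rw [pow_succ', ← Matrix.mulVec_mulVec, hinv, ih]
  obtain ⟨c, hc⟩ := ae_eq_const_of_torusCoeff hfL fun n hn => by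
    by_contra hne
    have hinj : Function.Injective fun k : ℕ => (B ^ k).mulVec n := by
      exact injective_pow_mulVec (by rw [hB, Matrix.det_transpose]; exact A.2)
        (by rw [hB]; simpa using h) hn
    have h1 := (torusCoeff_summable hfL).comp_injective hinj
    have h2 : Summable fun _ : ℕ => ‖torusCoeff f n‖ ^ 2 :=
      h1.congr fun k => by simp only [Function.comp, hiter]
    rw [summable_const_iff] at h2
    exact hne (by simpa using h2)
  by_cases hc1 : c = 1
  · right
    filter_upwards [hc] with t ht
    rw [hc1] at ht
    have : t ∈ s := by
      by_contra h
      rw [hf, Set.indicator_of_notMem h] at ht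
      exact zero_ne_one ht
    exact eq_true this
  · left
    filter_upwards [hc] with t ht
    have : t ∉ s := by
      intro h
      rw [hf, Set.indicator_of_mem h] at ht
      exact hc1 ht.symm
    exact eq_false this

theorem IsTropicalAction.ergodic {Φ : GL (Fin 2) ℤ →* Equiv.Perm E3}
    (hΦ : IsTropicalAction Φ) (A : SL(2, ℤ)) (h : 2 < |A.1 0 0 + A.1 1 1|) :
    Ergodic (Φ A) tetraMeasure :=
  measurePreserving_tau.ergodic_of_ergodic_semiconj (ergodic_tact A h) (hΦ.measurable A)
    (hΦ.semiconj A)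

/-! ### Growth along the paths of the Farey tree -/

lemma edgeMatrix_succ (γ : ℕ → Bool) (n : ℕ) : edgeMatrix γ (n + 1) =
    edgeMatrix γ n * (if γ n then stepRight else stepLeft) := rfl

lemma mul_stepRight (A : SL(2, ℤ)) : (A * stepRight).1 0 0 = A.1 0 0 ∧
    (A * stepRight).1 0 1 = A.1 0 0 + A.1 0 1 ∧ (A * stepRight).1 1 0 = A.1 1 0 ∧
    (A * stepRight).1 1 1 = A.1 1 0 + A.1 1 1 := by
  have h : (A * stepRight).1 = A.1 * !![1, 1; 0, 1] := rfl
  simp [h, Matrix.mul_apply, Fin.sum_univ_two]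

lemma mul_stepLeft (A : SL(2, ℤ)) : (A * stepLeft).1 0 0 = A.1 0 0 + A.1 0 1 ∧
    (A * stepLeft).1 0 1 = A.1 0 1 ∧ (A * stepLeft).1 1 0 = A.1 1 0 + A.1 1 1 ∧
    (A * stepLeft).1 1 1 = A.1 1 1 := by
  have h : (A * stepLeft).1 = A.1 * !![1, 0; 1, 1] := rfl
  simp [h, Matrix.mul_apply, Fin.sum_univ_two]

lemma edgeMatrix_induction {γ : ℕ → Bool} {P : ℕ → ℤ → ℤ → ℤ → ℤ → Prop} (m : ℕ)
    (h0 : P m ((edgeMatrix γ m).1 0 0) ((edgeMatrix γ m).1 0 1) ((edgeMatrix γ m).1 1 0)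
      ((edgeMatrix γ m).1 1 1))
    (hR : ∀ n p q r s, P n p q r s → P (n + 1) p (p + q) r (r + s))
    (hL : ∀ n p q r s, P n p q r s → P (n + 1) (p + q) q (r + s) s) (n : ℕ) (hn : m ≤ n) :
    P n ((edgeMatrix γ n).1 0 0) ((edgeMatrix γ n).1 0 1) ((edgeMatrix γ n).1 1 0)
      ((edgeMatrix γ n).1 1 1) := by
  induction n, hn using Nat.le_induction with
  | base => exact h0
  | succ n _ ih =>
    rw [edgeMatrix_succ]
    cases γ n
    · obtain ⟨h1, h2, h3, h4⟩ := mul_stepLeft (edgeMatrix γ n)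
      simp only [Bool.false_eq_true, if_false]
      rw [h1, h2, h3, h4]
      exact hL _ _ _ _ _ ih
    · obtain ⟨h1, h2, h3, h4⟩ := mul_stepRight (edgeMatrix γ n)
      simp only [if_true]
      rw [h1, h2, h3, h4]
      exact hR _ _ _ _ _ ih

/-- The entries along a path of the Farey tree. -/
lemma edgeMatrix_pos (γ : ℕ → Bool) (n : ℕ) :
    1 ≤ (edgeMatrix γ n).1 0 0 ∧ 0 ≤ (edgeMatrix γ n).1 0 1 ∧ 0 ≤ (edgeMatrix γ n).1 1 0 ∧
      1 ≤ (edgeMatrix γ n).1 1 1 := by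
  refine edgeMatrix_induction (γ := γ) (P := fun _ p q r s => 1 ≤ p ∧ 0 ≤ q ∧ 0 ≤ r ∧ 1 ≤ s) 0 ?_
    ?_ ?_ n (Nat.zero_le n)
  · simp [edgeMatrix]
  · intro n p q r s h; omega
  · intro n p q r s h; omega

lemma edgeMatrix_det (γ : ℕ → Bool) (n : ℕ) :
    (edgeMatrix γ n).1 0 0 * (edgeMatrix γ n).1 1 1 -
      (edgeMatrix γ n).1 0 1 * (edgeMatrix γ n).1 1 0 = 1 := by
  rw [← Matrix.det_fin_two]; exact (edgeMatrix γ n).2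

lemma euclidEdge_eq (γ : ℕ → Bool) (n : ℕ) :
    ((euclidEdge γ n).1 : ℤ) = (edgeMatrix γ n).1 0 0 + (edgeMatrix γ n).1 1 0 ∧
      ((euclidEdge γ n).2 : ℤ) = (edgeMatrix γ n).1 0 1 + (edgeMatrix γ n).1 1 1 := by
  induction n with
  | zero => simp [edgeMatrix, euclidEdge]
  | succ n ih =>
    rw [edgeMatrix_succ, euclidEdge]
    cases γ n
    · obtain ⟨h1, h2, h3, h4⟩ := mul_stepLeft (edgeMatrix γ n)
      simp only [Bool.false_eq_true, if_false]
      rw [h1, h2, h3, h4]; push_cast; omega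
    · obtain ⟨h1, h2, h3, h4⟩ := mul_stepRight (edgeMatrix γ n)
      simp only [if_true]
      rw [h1, h2, h3, h4]; push_cast; omega

lemma euclidNumber_eq (γ : ℕ → Bool) (n : ℕ) : (euclidNumber γ n : ℤ) =
    (edgeMatrix γ n).1 0 0 + (edgeMatrix γ n).1 0 1 + (edgeMatrix γ n).1 1 0 +
      (edgeMatrix γ n).1 1 1 := by
  have := euclidEdge_eq γ n
  rw [euclidNumber]; push_cast; omega

lemma two_le_euclidNumber (γ : ℕ → Bool) (n : ℕ) : 2 ≤ euclidNumber γ n := by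
  have := euclidNumber_eq γ n
  have := edgeMatrix_pos γ n
  omega

lemma trace_le_euclidNumber (γ : ℕ → Bool) (n : ℕ) :
    (edgeMatrix γ n).1 0 0 + (edgeMatrix γ n).1 1 1 ≤ euclidNumber γ n := by
  have := euclidNumber_eq γ n
  have := edgeMatrix_pos γ n
  omega

/-- The first turn decides which row dominates ever after. After a left turn `p ≤ r`, `q ≤ s` and `r
≤ (n + 1) * s`, so the sum of the entries is at most `2 * (r + s) ≤ 2 * (n + 2) * s`; a right turn
exchanges the roles. At the root neither domination holds, so the induction starts at `n = 1`. -/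
lemma euclidNumber_le_trace (γ : ℕ → Bool) (n : ℕ) : (euclidNumber γ n : ℤ) ≤
    2 * (n + 2) * ((edgeMatrix γ n).1 0 0 + (edgeMatrix γ n).1 1 1) := by
  rw [euclidNumber_eq]
  rcases n.eq_zero_or_pos with rfl | hn
  · simp [edgeMatrix]
  cases h : γ 0
  · obtain ⟨h1, h2, h3, h4⟩ := mul_stepLeft (edgeMatrix γ 0)
    have key := edgeMatrix_induction (γ := γ)
      (P := fun n p q r s => 0 ≤ p ∧ 0 ≤ q ∧ 0 ≤ r ∧ 1 ≤ s ∧ p ≤ r ∧ q ≤ s ∧ r ≤ (n + 1) * s) 1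
      (by
        rw [edgeMatrix_succ, h]
        simp only [Bool.false_eq_true, if_false]
        rw [h1, h2, h3, h4]; simp [edgeMatrix]) (by
        intro n p q r s ⟨h1, h2, h3, h4, h5, h6, h7⟩
        refine ⟨by omega, by omega, by omega, by omega, by omega, by omega, ?_⟩
        push_cast; nlinarith) (by
        intro n p q r s ⟨h1, h2, h3, h4, h5, h6, h7⟩
        refine ⟨by omega, by omega, by omega, by omega, by omega, by omega, ?_⟩
        push_cast; nlinarith) n hn
    obtain ⟨h1, h2, h3, h4, h5, h6, h7⟩ := key
    nlinarith
  · obtain ⟨h1, h2, h3, h4⟩ := mul_stepRight (edgeMatrix γ 0)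
    have key := edgeMatrix_induction (γ := γ)
      (P := fun n p q r s => 1 ≤ p ∧ 0 ≤ q ∧ 0 ≤ r ∧ 0 ≤ s ∧ r ≤ p ∧ s ≤ q ∧ q ≤ (n + 1) * p) 1
      (by
        rw [edgeMatrix_succ, h]
        simp only [if_true]
        rw [h1, h2, h3, h4]; simp [edgeMatrix]) (by
        intro n p q r s ⟨h1, h2, h3, h4, h5, h6, h7⟩
        refine ⟨by omega, by omega, by omega, by omega, by omega, by omega, ?_⟩
        push_cast; nlinarith) (by
        intro n p q r s ⟨h1, h2, h3, h4, h5, h6, h7⟩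
        refine ⟨by omega, by omega, by omega, by omega, by omega, by omega, ?_⟩
        push_cast; nlinarith) n hn
    obtain ⟨h1, h2, h3, h4, h5, h6, h7⟩ := key
    nlinarith

lemma EReal.limsup_eq_of_tendsto_sub {u v : ℕ → ℝ} (h : Tendsto (fun n => u n - v n) atTop (𝓝 0)) :
    limsup (fun n => (u n : EReal)) atTop = limsup (fun n => (v n : EReal)) atTop := by
  have key : ∀ {u v : ℕ → ℝ}, Tendsto (fun n => u n - v n) atTop (𝓝 0) →
      limsup (fun n => (u n : EReal)) atTop ≤ limsup (fun n => (v n : EReal)) atTop := by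
    intro u v h
    have h' : limsup (fun n => ((u n - v n : ℝ) : EReal)) atTop = 0 :=
      ((continuous_coe_real_ereal.tendsto 0).comp h).limsup_eq
    have e : (fun n => (u n : EReal)) =
        (fun n => (v n : EReal)) + fun n => ((u n - v n : ℝ) : EReal) := by
      funext n
      rw [Pi.add_apply, ← EReal.coe_add]; congr 1; ring
    rw [e]
    refine (EReal.limsup_add_le (Or.inr ?_) (Or.inr ?_)).trans ?_
    · rw [h']; exact EReal.zero_ne_top
    · rw [h']; exact EReal.zero_ne_bot
    · rw [h', add_zero]
  refine le_antisymm (key h) (key ?_)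
  have := h.neg
  simpa using this

lemma tendsto_log_mul_add_div (K a : ℝ) (hK : 0 < K) (ha : 0 ≤ a) :
    Tendsto (fun n : ℕ => Real.log (K * (n + a)) / n) atTop (𝓝 0) := by
  have h1 : Tendsto (fun n : ℕ => Real.log n / n) atTop (𝓝 0) := by
    have := (Real.isLittleO_log_id_atTop.tendsto_div_nhds_zero).comp tendsto_natCast_atTop_atTop
    exact this
  have h2 := (tendsto_const_div_atTop_nhds_zero_nat (Real.log (K * (1 + a)))).add h1
  rw [add_zero] at h2
  have h3 := tendsto_const_div_atTop_nhds_zero_nat (Real.log K)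
  refine tendsto_of_tendsto_of_tendsto_of_le_of_le' h3 h2 ?_ ?_
  · filter_upwards [eventually_ge_atTop 1] with n hn
    have hn' : (1 : ℝ) ≤ n := Nat.one_le_cast.2 hn
    refine div_le_div_of_nonneg_right (Real.log_le_log hK ?_) (Nat.cast_nonneg n)
    nlinarith
  · filter_upwards [eventually_ge_atTop 1] with n hn
    have hn' : (1 : ℝ) ≤ n := Nat.one_le_cast.2 hn
    rw [← add_div, ← Real.log_mul (by positivity) (by positivity)]
    refine div_le_div_of_nonneg_right (Real.log_le_log (by positivity) ?_) (Nat.cast_nonneg n)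
    rw [mul_assoc]
    refine mul_le_mul_of_nonneg_left ?_ hK.le
    nlinarith

/-- The growth rates of the spectral radii and of the Euclid numbers agree. -/
lemma tendsto_logSpectralRadius_sub (γ : ℕ → Bool) :
    Tendsto (fun n : ℕ => logSpectralRadius (edgeMatrix γ n) / n -
      Real.log (euclidNumber γ n) / n) atTop (𝓝 0) := by
  -- For the trace `t` and the Euclid number `c`, the chain is `|l| ≤ t ≤ c ≤ 2 * (n + 2) * t ≤ 4 *
  -- (n + 2) * |l|`.
  have hb : ∀ n : ℕ, -Real.log (4 * (n + 2)) ≤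
      logSpectralRadius (edgeMatrix γ n) - Real.log (euclidNumber γ n) ∧
      logSpectralRadius (edgeMatrix γ n) - Real.log (euclidNumber γ n) ≤ 0 := by
    intro n
    set t : ℝ := (((edgeMatrix γ n).1 0 0 + (edgeMatrix γ n).1 1 1 : ℤ) : ℝ) with ht
    have ht2 : 2 ≤ t := by
      have := edgeMatrix_pos γ n
      rw [ht]
      exact_mod_cast (by omega : (2 : ℤ) ≤ (edgeMatrix γ n).1 0 0 + (edgeMatrix γ n).1 1 1)
    have htabs : |t| = t := abs_of_pos (by linarith)
    have h1 : t ≤ euclidNumber γ n := by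
      rw [ht]; exact_mod_cast trace_le_euclidNumber γ n
    have h2 : (euclidNumber γ n : ℝ) ≤ 2 * (n + 2) * t := by
      rw [ht]; exact_mod_cast euclidNumber_le_trace γ n
    obtain ⟨l, hl1, hl, hl2, hl3, -⟩ := exists_eigenvalue (t := t) (by rwa [htabs])
    rw [htabs] at hl2 hl3
    rw [logSpectralRadius_eq _ hl1 hl]
    have hl0 : 0 < |l| := by linarith
    have hc0 : (0 : ℝ) < euclidNumber γ n := by linarith
    constructor
    · have h3 : (euclidNumber γ n : ℝ) ≤ 4 * (n + 2) * |l| := by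
        refine h2.trans ?_
        have : (0 : ℝ) ≤ 4 * (n + 2) := by positivity
        nlinarith
      have h4 := Real.log_le_log hc0 h3
      rw [Real.log_mul (by positivity) hl0.ne'] at h4
      linarith
    · have := Real.log_le_log hl0 (hl3.trans h1)
      linarith
  have h4 := (tendsto_log_mul_add_div 4 2 (by norm_num) (by norm_num)).neg
  rw [neg_zero] at h4
  refine tendsto_of_tendsto_of_tendsto_of_le_of_le h4 tendsto_const_nhds (fun n => ?_) (fun n => ?_)
  · simp only []
    rw [← sub_div, ← neg_div]
    exact div_le_div_of_nonneg_right (hb n).1 (Nat.cast_nonneg n)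
  · simp only []
    rw [← sub_div]
    exact div_nonpos_of_nonpos_of_nonneg (hb n).2 (Nat.cast_nonneg n)

/-- Markov numbers grow like exponentials of Euclid numbers. -/
lemma markovTriple_bounds (γ : ℕ → Bool) (n : ℕ) :
    1 ≤ (markovTriple γ n).1 ∧ 1 ≤ (markovTriple γ n).2.1 ∧
    (markovTriple γ n).1 ≤ (markovTriple γ n).2.2 ∧
    (markovTriple γ n).2.1 ≤ (markovTriple γ n).2.2 ∧
    2 ^ (euclidEdge γ n).1 ≤ 2 * (markovTriple γ n).1 ∧
    3 * (markovTriple γ n).1 ≤ 3 ^ (euclidEdge γ n).1 ∧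
    2 ^ (euclidEdge γ n).2 ≤ 2 * (markovTriple γ n).2.1 ∧
    3 * (markovTriple γ n).2.1 ≤ 3 ^ (euclidEdge γ n).2 ∧
    2 ^ (euclidNumber γ n) ≤ 2 * (markovTriple γ n).2.2 ∧
    3 * (markovTriple γ n).2.2 ≤ 3 ^ (euclidNumber γ n) := by
  induction n with
  | zero => norm_num [markovTriple, euclidEdge, euclidNumber]
  | succ n ih =>
    simp only [euclidNumber] at ih
    simp only [euclidNumber, markovTriple, euclidEdge]
    generalize (markovTriple γ n).1 = x at ih ⊢
    generalize (markovTriple γ n).2.1 = y at ih ⊢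
    generalize (markovTriple γ n).2.2 = z at ih ⊢
    generalize (euclidEdge γ n).1 = a at ih ⊢
    generalize (euclidEdge γ n).2 = b at ih ⊢
    obtain ⟨h1, h2, h3, h4, h5, h6, h7, h8, h9, h10⟩ := ih
    have pa : (0 : ℤ) < 2 ^ a := by positivity
    have pb : (0 : ℤ) < 2 ^ b := by positivity
    have pc : (0 : ℤ) < 2 ^ (a + b) := by positivity
    cases γ n
    · simp only [Bool.false_eq_true, if_false]
      -- The new number is `3 * z * y - x` with `x ≤ z ≤ z * y`, so it lies between `2 * z * y` and
      -- `3 * z * y`. Hence lower bounds multiply after scaling by two and upper bounds after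
      -- scaling by three, while Euclid numbers add in the exponent.
      have m1 : (2 : ℤ) ^ (a + b) * 2 ^ b ≤ (2 * z) * (2 * y) :=
        mul_le_mul h9 h7 pb.le (by omega)
      have m2 : (3 * z) * (3 * y) ≤ (3 : ℤ) ^ (a + b) * 3 ^ b :=
        mul_le_mul h10 h8 (by omega) (by positivity)
      rw [← pow_add] at m1 m2
      have m3 : z * 1 ≤ z * y := mul_le_mul_of_nonneg_left h2 (by omega)
      have m4 : 3 * z * y = 3 * (z * y) := by ring
      have m5 : (2 * z) * (2 * y) = 4 * (z * y) := by ring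
      have m6 : (3 * z) * (3 * y) = 9 * (z * y) := by ring
      rw [m4]
      rw [m5] at m1
      rw [m6] at m2
      refine ⟨?_, ?_, ?_, ?_, ?_, ?_, ?_, ?_, ?_, ?_⟩ <;> omega
    · simp only [if_true]
      have m1 : (2 : ℤ) ^ a * 2 ^ (a + b) ≤ (2 * x) * (2 * z) :=
        mul_le_mul h5 h9 pc.le (by omega)
      have m2 : (3 * x) * (3 * z) ≤ (3 : ℤ) ^ a * 3 ^ (a + b) :=
        mul_le_mul h6 h10 (by omega) (by positivity)
      rw [← pow_add] at m1 m2
      have m3 : 1 * z ≤ x * z := mul_le_mul_of_nonneg_right h1 (by omega)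
      have m4 : 3 * x * z = 3 * (x * z) := by ring
      have m5 : (2 * x) * (2 * z) = 4 * (x * z) := by ring
      have m6 : (3 * x) * (3 * z) = 9 * (x * z) := by ring
      rw [m4]
      rw [m5] at m1
      rw [m6] at m2
      refine ⟨?_, ?_, ?_, ?_, ?_, ?_, ?_, ?_, ?_, ?_⟩ <;> omega

lemma lyapunovMarkov_eq (ξ : ℝ≥0∞) : lyapunovMarkov ξ = lyapunovEuclid ξ := by
  refine EReal.limsup_eq_of_tendsto_sub ?_
  set γ := pathTo ξ
  have hb : ∀ n : ℕ, Real.log (Real.log 2 / 2) ≤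
      Real.log (Real.log (markovNumber γ n)) - Real.log (euclidNumber γ n) ∧
      Real.log (Real.log (markovNumber γ n)) - Real.log (euclidNumber γ n) ≤
        Real.log (Real.log 3) := by
    intro n
    obtain ⟨h1, -, h2, -, -, -, -, -, h9, h10⟩ := markovTriple_bounds γ n
    have hc := two_le_euclidNumber γ n
    have hc' : (2 : ℝ) ≤ euclidNumber γ n := by exact_mod_cast hc
    change 2 ^ (euclidNumber γ n) ≤ 2 * markovNumber γ n at h9
    change 3 * markovNumber γ n ≤ 3 ^ (euclidNumber γ n) at h10
    have hz : (1 : ℤ) ≤ markovNumber γ n := h1.trans h2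
    have hz' : (1 : ℝ) ≤ markovNumber γ n := by exact_mod_cast hz
    have h9' : (2 : ℝ) ^ (euclidNumber γ n) ≤ 2 * markovNumber γ n := by exact_mod_cast h9
    have h10' : 3 * (markovNumber γ n : ℝ) ≤ 3 ^ (euclidNumber γ n) := by exact_mod_cast h10
    have l9 := Real.log_le_log (by positivity) h9'
    have l10 := Real.log_le_log (by positivity) h10'
    rw [Real.log_pow, Real.log_mul (by norm_num) (by linarith)] at l9
    rw [Real.log_pow, Real.log_mul (by norm_num) (by linarith)] at l10
    have p2 : 0 < Real.log 2 := Real.log_pos (by norm_num)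
    have p3 : 0 < Real.log 3 := Real.log_pos (by norm_num)
    -- The estimate gives `(c - 1) * log 2`, and `c ≥ 2` turns `c - 1` into at least `c / 2`.
    have lo : euclidNumber γ n * (Real.log 2 / 2) ≤ Real.log (markovNumber γ n) := by nlinarith
    have up : Real.log (markovNumber γ n) ≤ euclidNumber γ n * Real.log 3 := by nlinarith
    have hpos : 0 < Real.log (markovNumber γ n) := lt_of_lt_of_le (by positivity) lo
    have lo' := Real.log_le_log (by positivity) lo
    have up' := Real.log_le_log hpos up
    rw [Real.log_mul (by linarith) (by positivity)] at lo' up'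
    constructor <;> linarith
  refine tendsto_of_tendsto_of_tendsto_of_le_of_le
    (tendsto_const_div_atTop_nhds_zero_nat (Real.log (Real.log 2 / 2)))
    (tendsto_const_div_atTop_nhds_zero_nat (Real.log (Real.log 3))) (fun n => ?_) (fun n => ?_)
  · simp only []
    rw [← sub_div]
    exact div_le_div_of_nonneg_right (hb n).1 (Nat.cast_nonneg n)
  · simp only []
    rw [← sub_div]
    exact div_le_div_of_nonneg_right (hb n).2 (Nat.cast_nonneg n)

/-! ### Paths leading to a number -/

lemma natCast_div_lt_div {a b c d : ℕ} (hb : b ≠ 0) (hcd : d ≠ 0 ∨ c ≠ 0) (h : a * d < c * b) :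
    (a : ℝ≥0∞) / b < (c : ℝ≥0∞) / d := by
  have hb' : (b : ℝ≥0∞) ≠ 0 := Nat.cast_ne_zero.2 hb
  rcases eq_or_ne d 0 with rfl | hd
  · have hc : (c : ℝ≥0∞) ≠ 0 := Nat.cast_ne_zero.2 (hcd.resolve_left fun h => h rfl)
    rw [Nat.cast_zero, ENNReal.div_zero hc]
    exact ENNReal.div_lt_top (ENNReal.natCast_ne_top a) hb'
  · rw [ENNReal.lt_div_iff_mul_lt (Or.inl (Nat.cast_ne_zero.2 hd))
      (Or.inl (ENNReal.natCast_ne_top d)), ← ENNReal.mul_div_right_comm,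
      ENNReal.div_lt_iff (Or.inl hb') (Or.inl (ENNReal.natCast_ne_top b))]
    exact_mod_cast h

lemma mediant_strict (γ : ℕ → Bool) (n : ℕ) :
    lowerFraction (edgeMatrix γ n) < mediant (edgeMatrix γ n) ∧
      mediant (edgeMatrix γ n) < upperFraction (edgeMatrix γ n) := by
  have hp := edgeMatrix_pos γ n
  have hd := edgeMatrix_det γ n
  obtain ⟨h1, h2, h3, h4⟩ := hp
  obtain ⟨p, ep⟩ := Int.eq_ofNat_of_zero_le (zero_le_one.trans h1)
  obtain ⟨q, eq⟩ := Int.eq_ofNat_of_zero_le h2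
  obtain ⟨r, er⟩ := Int.eq_ofNat_of_zero_le h3
  obtain ⟨s, es⟩ := Int.eq_ofNat_of_zero_le (zero_le_one.trans h4)
  simp only [lowerFraction, mediant, upperFraction]
  rw [ep, eq, er, es] at hd ⊢
  rw [ep] at h1
  rw [es] at h4
  simp only [← Nat.cast_add, Int.toNat_natCast]
  have hd' : p * s = 1 + q * r := by zify; linarith
  constructor
  · exact natCast_div_lt_div (by omega) (by left; omega) (by nlinarith)
  · exact natCast_div_lt_div (by omega) (by right; omega) (by nlinarith)

lemma fractions_succ (γ : ℕ → Bool) (n : ℕ) :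
    lowerFraction (edgeMatrix γ (n + 1)) =
        (if γ n then mediant (edgeMatrix γ n) else lowerFraction (edgeMatrix γ n)) ∧
      upperFraction (edgeMatrix γ (n + 1)) =
        (if γ n then upperFraction (edgeMatrix γ n) else mediant (edgeMatrix γ n)) := by
  rw [edgeMatrix_succ]
  cases γ n
  · obtain ⟨h1, h2, h3, h4⟩ := mul_stepLeft (edgeMatrix γ n)
    simp only [Bool.false_eq_true, if_false, lowerFraction, upperFraction, mediant, h1, h2, h3, h4,
      and_self]
  · obtain ⟨h1, h2, h3, h4⟩ := mul_stepRight (edgeMatrix γ n)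
    simp only [if_true, lowerFraction, upperFraction, mediant, h1, h2, h3, h4, and_self]

lemma searchMatrix_eq (ξ : ℝ≥0∞) (n : ℕ) : searchMatrix ξ n = edgeMatrix (pathTo ξ) n := by
  induction n with
  | zero => rfl
  | succ n ih =>
    rw [edgeMatrix_succ, ← ih, searchMatrix]
    simp only [pathTo, decide_eq_true_eq]

lemma leadsTo_pathTo (ξ : ℝ≥0∞) : LeadsTo (pathTo ξ) ξ := by
  intro n
  induction n with
  | zero => simp [lowerFraction, upperFraction, edgeMatrix]
  | succ n ih =>
    obtain ⟨h1, h2⟩ := fractions_succ (pathTo ξ) n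
    rw [h1, h2]
    have h3 : pathTo ξ n = true ↔ mediant (edgeMatrix (pathTo ξ) n) ≤ ξ := by
      rw [← searchMatrix_eq, pathTo, decide_eq_true_eq]
    by_cases h : pathTo ξ n = true
    · rw [if_pos h, if_pos h]
      exact ⟨h3.1 h, ih.2⟩
    · rw [if_neg h, if_neg h]
      exact ⟨ih.1, (not_le.1 (h3.not.1 h)).le⟩

/-- A path that has reached its limit as a lower fraction turns left from then on. -/
lemma LeadsTo.left_of_lower_eq {γ : ℕ → Bool} {ξ : ℝ≥0∞} (h : LeadsTo γ ξ) {m : ℕ}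
    (hm : lowerFraction (edgeMatrix γ m) = ξ) (k : ℕ) (hk : m ≤ k) : γ k = false := by
  have key : ∀ k, m ≤ k → lowerFraction (edgeMatrix γ k) = ξ → γ k = false := by
    intro k _ hk
    by_contra hc
    rw [Bool.not_eq_false] at hc
    have h1 := (h (k + 1)).1
    rw [(fractions_succ γ k).1, if_pos hc, ← hk] at h1
    exact absurd h1 (not_le.2 (mediant_strict γ k).1)
  refine key k hk ?_
  induction k, hk using Nat.le_induction with
  | base => exact hm
  | succ k hk ih =>
    rw [(fractions_succ γ k).1, key k hk ih]
    simpa using ih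

/-- A left turn would replace the upper fraction `ξ` by a mediant strictly below it. -/
lemma LeadsTo.right_of_upper_eq {γ : ℕ → Bool} {ξ : ℝ≥0∞} (h : LeadsTo γ ξ) {m : ℕ}
    (hm : upperFraction (edgeMatrix γ m) = ξ) (k : ℕ) (hk : m ≤ k) : γ k = true := by
  have key : ∀ k, m ≤ k → upperFraction (edgeMatrix γ k) = ξ → γ k = true := by
    intro k _ hk
    by_contra hc
    have h1 := (h (k + 1)).2
    rw [(fractions_succ γ k).2, if_neg hc, ← hk] at h1
    exact absurd h1 (not_le.2 (mediant_strict γ k).2)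
  refine key k hk ?_
  induction k, hk using Nat.le_induction with
  | base => exact hm
  | succ k hk ih =>
    rw [(fractions_succ γ k).2, key k hk ih]
    simpa using ih

/-- While the turns stay the same, one side number is frozen and the other grows in arithmetic
progression, so the growth is linear. -/
lemma euclidNumber_add_le {γ : ℕ → Bool} {m : ℕ} {b : Bool} (h : ∀ k, m ≤ k → γ k = b) (k : ℕ) :
    euclidNumber γ (m + k) ≤ euclidNumber γ m * (k + 1) := by
  have key : ∀ k, if b then (euclidEdge γ (m + k)).1 = (euclidEdge γ m).1 ∧
      (euclidEdge γ (m + k)).2 = (euclidEdge γ m).2 + k * (euclidEdge γ m).1 else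
      (euclidEdge γ (m + k)).2 = (euclidEdge γ m).2 ∧
      (euclidEdge γ (m + k)).1 = (euclidEdge γ m).1 + k * (euclidEdge γ m).2 := by
    intro k
    induction k with
    | zero => cases b <;> simp
    | succ k ih =>
      have e : m + (k + 1) = (m + k) + 1 := by ring
      rw [e, euclidEdge, h (m + k) (by omega)]
      cases b
      · simp only [Bool.false_eq_true, if_false] at ih ⊢
        rw [ih.1, ih.2]; exact ⟨rfl, by ring⟩
      · simp only [if_true] at ih ⊢
        rw [ih.1, ih.2]; exact ⟨rfl, by ring⟩
  have := key k
  simp only [euclidNumber]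
  cases b
  · simp only [Bool.false_eq_true, if_false] at this
    rw [this.1, this.2]; nlinarith
  · simp only [if_true] at this
    rw [this.1, this.2]; nlinarith

lemma tendsto_log_euclidNumber_of_eventually_const {γ : ℕ → Bool} {m : ℕ} {b : Bool}
    (h : ∀ k, m ≤ k → γ k = b) :
    Tendsto (fun n : ℕ => Real.log (euclidNumber γ n) / n) atTop (𝓝 0) := by
  have hpos : ∀ n, (1 : ℝ) ≤ euclidNumber γ n := fun n => by
    have := two_le_euclidNumber γ n
    exact_mod_cast (by omega : 1 ≤ euclidNumber γ n)
  refine tendsto_of_tendsto_of_tendsto_of_le_of_le' tendsto_const_nhds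
    (tendsto_log_mul_add_div (euclidNumber γ m) 1 (by linarith [hpos m]) zero_le_one)
    (Eventually.of_forall fun n => div_nonneg (Real.log_nonneg (hpos n)) (Nat.cast_nonneg n)) ?_
  filter_upwards [eventually_ge_atTop m] with n hn
  refine div_le_div_of_nonneg_right (Real.log_le_log (by linarith [hpos n]) ?_) (Nat.cast_nonneg n)
  obtain ⟨k, rfl⟩ := Nat.exists_eq_add_of_le hn
  have h1 : (euclidNumber γ (m + k) : ℝ) ≤ euclidNumber γ m * (k + 1) := by
    exact_mod_cast euclidNumber_add_le h k
  refine h1.trans (mul_le_mul_of_nonneg_left ?_ (by linarith [hpos m]))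
  push_cast
  linarith [(Nat.cast_nonneg m : (0 : ℝ) ≤ m)]

lemma edgeMatrix_congr {γ γ' : ℕ → Bool} {n : ℕ} (h : ∀ k < n, γ k = γ' k) :
    edgeMatrix γ n = edgeMatrix γ' n := by
  induction n with
  | zero => rfl
  | succ n ih =>
    rw [edgeMatrix_succ, edgeMatrix_succ, ih fun k hk => h k (by omega), h n (by omega)]

/-- Two different paths to the same number are eventually constant. -/
lemma LeadsTo.tendsto_sub {γ γ' : ℕ → Bool} {ξ : ℝ≥0∞} (h : LeadsTo γ ξ) (h' : LeadsTo γ' ξ) :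
    Tendsto (fun n : ℕ => Real.log (euclidNumber γ n) / n - Real.log (euclidNumber γ' n) / n) atTop
      (𝓝 0) := by
  have key : ∀ {γ γ' : ℕ → Bool}, LeadsTo γ ξ → LeadsTo γ' ξ → ∀ n, (∀ k < n, γ k = γ' k) →
      γ n = true → γ' n = false →
      Tendsto (fun n : ℕ => Real.log (euclidNumber γ n) / n) atTop (𝓝 0) ∧
      Tendsto (fun n : ℕ => Real.log (euclidNumber γ' n) / n) atTop (𝓝 0) := by
    intro γ γ' h h' n hn ht hf
    have h1 := (h (n + 1)).1
    have h2 := (h' (n + 1)).2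
    have e1 := (fractions_succ γ n).1
    have e2 := (fractions_succ γ' n).2
    rw [if_pos ht] at e1
    rw [if_neg (by simp [hf]), ← edgeMatrix_congr hn] at e2
    -- At the first disagreement one path needs the common mediant to be at most `ξ` and the other
    -- at least `ξ`. So `ξ` is reached there, and both paths keep a constant direction afterwards.
    have e3 : mediant (edgeMatrix γ n) = ξ := le_antisymm (e1 ▸ h1) (e2 ▸ h2)
    exact ⟨tendsto_log_euclidNumber_of_eventually_const (h.left_of_lower_eq (e1.trans e3)),
      tendsto_log_euclidNumber_of_eventually_const (h'.right_of_upper_eq (e2.trans e3))⟩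
  by_cases hne : γ = γ'
  · simp [hne]
  · classical
    have hex : ∃ n, γ n ≠ γ' n := Function.ne_iff.1 hne
    have hmin : ∀ k < Nat.find hex, γ k = γ' k := fun k hk => not_not.1 (Nat.find_min hex hk)
    have hn := Nat.find_spec hex
    generalize Nat.find hex = n at hmin hn
    rcases hb : γ n with _ | _
    · have hb' : γ' n = true := by
        rw [hb] at hn; cases h0 : γ' n
        · exact absurd h0.symm hn
        · rfl
      obtain ⟨h1, h2⟩ := key h' h n (fun k hk => (hmin k hk).symm) hb' hb
      simpa using h2.sub h1
    · have hb' : γ' n = false := by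
        rw [hb] at hn; cases h0 : γ' n
        · rfl
        · exact absurd h0.symm hn
      obtain ⟨h1, h2⟩ := key h h' n hmin hb hb'
      simpa using h1.sub h2

lemma limsup_logSpectralRadius {γ : ℕ → Bool} {ξ : ℝ≥0∞} (h : LeadsTo γ ξ) :
    limsup (fun n : ℕ => ((logSpectralRadius (edgeMatrix γ n) / n : ℝ) : EReal)) atTop =
      lyapunovMarkov ξ := by
  rw [lyapunovMarkov_eq]
  refine EReal.limsup_eq_of_tendsto_sub ?_
  have := (tendsto_logSpectralRadius_sub γ).add (h.tendsto_sub (leadsTo_pathTo ξ))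
  rw [add_zero] at this
  refine this.congr fun n => ?_
  ring

lemma two_le_abs_trace_edgeMatrix (γ : ℕ → Bool) (n : ℕ) :
    2 ≤ |(edgeMatrix γ n).1 0 0 + (edgeMatrix γ n).1 1 1| := by
  have := edgeMatrix_pos γ n
  exact le_trans (by omega) (le_abs_self _)

lemma two_lt_abs_trace {A : SL(2, ℤ)} (hA : (A : Matrix (Fin 2) (Fin 2) ℤ).IsHyperbolic) :
    2 < |A.1 0 0 + A.1 1 1| := by
  have h : 0 < A.1.discr := hA
  rw [Matrix.discr_fin_two, Matrix.trace_fin_two] at h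
  have hd : A.1.det = 1 := A.2
  rw [hd] at h
  have : (2 : ℤ) ^ 2 < (A.1 0 0 + A.1 1 1) ^ 2 := by linarith
  simpa using sq_lt_sq.1 this

end

end CayleyMarkov

theorem theorem1 :
    (∃! Φ : GL (Fin 2) ℤ →* Equiv.Perm CayleyMarkov.E3, CayleyMarkov.IsTropicalAction Φ) ∧
    ∀ Φ : GL (Fin 2) ℤ →* Equiv.Perm CayleyMarkov.E3, CayleyMarkov.IsTropicalAction Φ →
      -- an action of `PSL(2, ℤ)` on the tetrahedron, preserving Lebesgue measure
      (Φ (-1) = 1 ∧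
        ∀ A : SL(2, ℤ), Φ A '' CayleyMarkov.tetra = CayleyMarkov.tetra ∧
          MeasurePreserving (Φ A) CayleyMarkov.tetraMeasure CayleyMarkov.tetraMeasure) ∧
      -- hyperbolic elements
      (∀ A : SL(2, ℤ), (A : Matrix (Fin 2) (Fin 2) ℤ).IsHyperbolic →
        Ergodic (Φ A) CayleyMarkov.tetraMeasure ∧
        CayleyMarkov.HasLyapunovExponent (Φ A) (CayleyMarkov.logSpectralRadius A) ∧
        CayleyMarkov.metricEntropy CayleyMarkov.tetraMeasure (Φ A) =
          (CayleyMarkov.logSpectralRadius A : EReal) ∧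
        Dynamics.coverEntropy (Φ A) CayleyMarkov.tetra =
          (CayleyMarkov.logSpectralRadius A : EReal)) ∧
      -- the two definitions of `Λ` agree, and `Λ` is the average growth along the paths
      (∀ ξ : ℝ≥0∞, CayleyMarkov.lyapunovMarkov ξ = CayleyMarkov.lyapunovEuclid ξ ∧
        CayleyMarkov.LeadsTo (CayleyMarkov.pathTo ξ) ξ ∧
        ∀ γ : ℕ → Bool, CayleyMarkov.LeadsTo γ ξ →
          (∃ l : ℕ → ℝ,
            (∀ n, CayleyMarkov.HasLyapunovExponent (Φ (CayleyMarkov.edgeMatrix γ n)) (l n)) ∧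
            limsup (fun n : ℕ => ((l n / n : ℝ) : EReal)) atTop =
              CayleyMarkov.lyapunovMarkov ξ) ∧
          limsup (fun n : ℕ => CayleyMarkov.metricEntropy CayleyMarkov.tetraMeasure
              (Φ (CayleyMarkov.edgeMatrix γ n)) / (n : EReal)) atTop =
            CayleyMarkov.lyapunovMarkov ξ ∧
          limsup (fun n : ℕ => Dynamics.coverEntropy (Φ (CayleyMarkov.edgeMatrix γ n))
              CayleyMarkov.tetra / (n : EReal)) atTop =
            CayleyMarkov.lyapunovMarkov ξ) := by
  refine ⟨CayleyMarkov.existsUnique_tropicalAction, fun Φ hΦ => ⟨⟨hΦ.map_neg_one, fun A =>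
    ⟨hΦ.image_tetra A, hΦ.measurePreserving A⟩⟩, fun A hA => ?_, fun ξ => ?_⟩⟩
  · have hA' := CayleyMarkov.two_lt_abs_trace hA
    exact ⟨hΦ.ergodic A hA', hΦ.hasLyapunovExponent A, hΦ.entropy_eq A hA'.le⟩
  · refine ⟨CayleyMarkov.lyapunovMarkov_eq ξ, CayleyMarkov.leadsTo_pathTo ξ, fun γ hγ => ?_⟩
    have h := CayleyMarkov.limsup_logSpectralRadius hγ
    have he := fun n => hΦ.entropy_eq (CayleyMarkov.edgeMatrix γ n)
      (CayleyMarkov.two_le_abs_trace_edgeMatrix γ n)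
    refine ⟨⟨fun n => CayleyMarkov.logSpectralRadius (CayleyMarkov.edgeMatrix γ n),
      fun n => hΦ.hasLyapunovExponent _, h⟩, ?_, ?_⟩
    · rw [← h]
      congr 1
      funext n
      rw [(he n).1, EReal.coe_div, EReal.coe_natCast]
    · rw [← h]
      congr 1
      funext n
      rw [(he n).2, EReal.coe_div, EReal.coe_natCast]
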